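/- Let $R,\mu,\kappa>0$ and $\gamma>1$ be constants, let $v_\pm>0$, $u_->0$, $\theta_\pm>0$, $u_+\in\mathbb R$, and put $p_+=R\theta_+/v_+$, $\sigma_-=-u_- /v_-$, $M_+=|u_+|/\sqrt{R\gamma\theta_+}$, $\delta^B=|(u_+-u_-,\theta_+-\theta_-)|$ (Euclidean norm). We consider the boundary layer problem for $(V,U,\Theta)(\xi)$, $\xi\ge 0$, with $V>0$, $\Theta>0$: $$-\sigma_-(V-v_+)-(U-u_+)=0,$$ $$U'=-\frac{\sigma_-}{\mu}V(U-u_+)+\frac R\mu\Big(\Theta-\frac{\theta_+}{v_+}V\Big),$$ $$\Theta'=-\frac{R\sigma_-V}{\kappa(\gamma-1)}(\Theta-\theta_+)+\frac{p_+}{\kappa}V(U-u_+)+\frac{\sigma_-V}{2\kappa}(U-u_+)^2,\tag{A}$$ $$(V,U,\Theta)(0)=(v_-,u_-,\theta_-),\qquad (V,U,\Theta)(+\infty)=(v_+,u_+,\theta_+),$$ and, for $(X,Y)=(U-u_+,\Theta-\theta_+)$, the autonomous problem derived from it under the relation $u_- /v_-=u_+/v_+$ (which is part of the problem), $$\binom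 XY'=J\binom XY+\binom{\frac1\mu X^2}{\big(\frac{R\theta_+}{\kappa u_+}-\frac{u_+}{2\kappa}\big)X^2+\frac{R}{\kappa(\gamma-1)}XY-\frac1{2\kappa}X^3},\qquad J=\begin{pmatrix}\frac{u_+^2-R\theta_+}{\mu u_+}&\frac R\mu\\ \frac{R\theta_+}\kappa&\frac{Ru_+}{\kappa(\gamma-1)}\end{pmatrix},\tag{B}$$ $(X,Y)(0)=(u_--u_+,\theta_--\theta_+)$, $(X,Y)(+\infty)=(0,0)$, with $u_++X>0$ and $\theta_++Y>0$. **Lemma 2.1 (Existence of BL-solution).** If $u_+\le 0$, then neither (A) nor (B) has a solution. If $u_+>0$, there is a constant $\delta>0$, depending only on $R,\gamma,\mu,\kappa,u_+,\theta_+$, such that the following holds whenever $0<\delta^B\le\delta$. *Case I (supersonic), $M_+>1$.* Neither (A) nor (B) has a solution. *Case II (transonic), $M_+=1$.* The point $(u_+,\theta_+)$ is a saddle-node of (B), viewed in the $(U,\Theta)$-plane: the linearization has a simple eigenvalue $0$ and a nonzero eigenvalue, and the quadratic coefficient of the field along the null direction is nonzero. There is a trajectory $\Gamma$ (depending only on $R,\gamma,\mu,\kappa,u_+,\theta_+$)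 tending to $(u_+,\theta_+)$ as $\xi\to+\infty$; it is unique in the sense that of $\Gamma$ and any other half-trajectory tending to $(u_+,\theta_+)$ one contains the other; and it is tangent at $(u_+,\theta_+)$ to the line $$(\gamma-1)u_+(U-u_+)+R\gamma(\Theta-\theta_+)=0 .$$ Each of (A) and (B) has a solution if and only if $u_- /v_-=u_+/v_+$ and $(u_-,\theta_-)\in\Gamma$. The solution is then unique and smooth on $[0,\infty)$, $(U,\Theta)(\xi)\in\Gamma$ for all $\xi\ge0$, and for every $n=0,1,2,\dots$ there is a constant $C=C_n$, independent of $v_\pm,u_-,\theta_-$, with $$\Big|\frac{d^n}{d\xi^n}(U-u_+,\Theta-\theta_+)(\xi)\Big|\le C\,\frac{(\delta^B)^{n+1}}{(1+\delta^B\xi)^{n+1}},\qquad \xi\ge0 .$$ *Case III (subsonic), $M_+<1$.* The point $(u_+,\theta_+)$ is a saddle of (B). There is a smooth one-dimensional manifold $\mathcal M$ through $(u_+,\theta_+)$ (depending only on $R,\gamma,\mu,\kappa,u_+,\theta_+$), consisting of $(u_+,\theta_+)$ and two trajectories that tend to $(u_+,\theta_+)$ as $\xi\to+\infty$ from opposite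 directions, tangent at $(u_+,\theta_+)$ to the line $$(1+a_2c_2u_+)(U-u_+)-a_2(\Theta-\theta_+)=0 .$$ Here $c_2$ is the positive solution of $$y^2+\Big(\frac{M_+^2\gamma-1}{M_+^2R\gamma}-\frac{\mu}{\kappa(\gamma-1)}\Big)y-\frac{\mu}{M_+^2R\gamma\kappa}=0,$$ and $a_2=-\frac{R}{\mu(\lambda_J^1-\lambda_J^2)}$, where $\lambda_J^1>0$ and $\lambda_J^2<0$ are the two eigenvalues of $J$. Each of (A) and (B) has a solution if and only if $u_- /v_-=u_+/v_+$ and $(u_-,\theta_-)\in\mathcal M$. The solution is then unique and smooth on $[0,\infty)$, $(U,\Theta)(\xi)\in\mathcal M$ for all $\xi\ge0$, and there is a constant $c>0$, and for every $n=0,1,2,\dots$ a constant $C=C_n$, all independent of $v_\pm,u_-,\theta_-$, with $$\Big|\frac{d^n}{d\xi^n}(U-u_+,\Theta-\theta_+)(\xi)\Big|\le C\,\delta^B e^{-c\xi},\qquad \xi\ge0 .$$ -/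

import Mathlib

open Set Filter Topology Asymptotics
open scoped ContDiff

noncomputable section

/-- The constants of a perfect viscous heat-conducting gas: gas constant `R`, adiabatic exponent
`γ`, viscosity `μ` and heat conductivity `κ`. -/
structure Gas where
  R : ℝ
  γ : ℝ
  μ : ℝ
  κ : ℝ
  R_pos : 0 < R
  one_lt_γ : 1 < γ
  μ_pos : 0 < μ
  κ_pos : 0 < κ

/-- Mach number `M = |u| / √(R γ θ)`; the sound speed `v √(γ p / v)` equals `√(R γ θ)`. -/
def mach (g : Gas) (u θ : ℝ) : ℝ := |u| / √(g.R * g.γ * θ)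

/-- The Euclidean length `|(a, b)|`. -/
def len (a b : ℝ) : ℝ := √(a ^ 2 + b ^ 2)

/-- The boundary layer problem once integrated over `(ξ, ∞)`, with boundary state `(vm, um, θm)`,
right end state `(vp, up, θp)` and speed `σ = -um / vm`: a triple `(V, U, Θ)` on `[0, ∞)` with
positive specific volume and positive temperature. -/
structure IsBLSolution (g : Gas) (vm um θm vp up θp : ℝ) (V U Θ : ℝ → ℝ) : Prop where
  V_pos : ∀ ξ, 0 ≤ ξ → 0 < V ξ
  Θ_pos : ∀ ξ, 0 ≤ ξ → 0 < Θ ξ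
  cont_U : ContinuousOn U (Ici 0)
  cont_Θ : ContinuousOn Θ (Ici 0)
  mass : ∀ ξ, 0 ≤ ξ → -(-um / vm) * (V ξ - vp) - (U ξ - up) = 0
  momentum : ∀ ξ, 0 < ξ → HasDerivAt U
    (-(-um / vm) / g.μ * V ξ * (U ξ - up) + g.R / g.μ * (Θ ξ - θp / vp * V ξ)) ξ
  energy : ∀ ξ, 0 < ξ → HasDerivAt Θ
    (-(g.R * (-um / vm) * V ξ) / (g.κ * (g.γ - 1)) * (Θ ξ - θp)
      + (g.R * θp / vp) / g.κ * V ξ * (U ξ - up)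
      + (-um / vm) * V ξ / (2 * g.κ) * (U ξ - up) ^ 2) ξ
  V_zero : V 0 = vm
  U_zero : U 0 = um
  Θ_zero : Θ 0 = θm
  V_lim : Tendsto V atTop (𝓝 vp)
  U_lim : Tendsto U atTop (𝓝 up)
  Θ_lim : Tendsto Θ atTop (𝓝 θp)

/-- The matrix of the linear part of the perturbation system. -/
def linPart (g : Gas) (up θp : ℝ) : Matrix (Fin 2) (Fin 2) ℝ :=
  !![(up ^ 2 - g.R * θp) / (g.μ * up), g.R / g.μ;
     g.R * θp / g.κ, g.R * up / (g.κ * (g.γ - 1))]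

/-- First component of the nonlinear part. -/
def nonlin₁ (g : Gas) (x : ℝ) : ℝ := 1 / g.μ * x ^ 2

/-- Second component of the nonlinear part. -/
def nonlin₂ (g : Gas) (up θp x y : ℝ) : ℝ :=
  (g.R * θp / (g.κ * up) - up / (2 * g.κ)) * x ^ 2 + g.R / (g.κ * (g.γ - 1)) * x * y
    - 1 / (2 * g.κ) * x ^ 3

/-- The vector field of the perturbation system in the variables `(U - up, Θ - θp)`. -/
def pertField (g : Gas) (up θp : ℝ) (w : ℝ × ℝ) : ℝ × ℝ :=
  (linPart g up θp 0 0 * w.1 + linPart g up θp 0 1 * w.2 + nonlin₁ g w.1,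
   linPart g up θp 1 0 * w.1 + linPart g up θp 1 1 * w.2 + nonlin₂ g up θp w.1 w.2)

/-- The same vector field in the `(U, Θ)`-plane, where the equilibrium is `(up, θp)`. -/
def blField (g : Gas) (up θp : ℝ) (q : ℝ × ℝ) : ℝ × ℝ :=
  pertField g up θp (q - (up, θp))

/-- The autonomous perturbation problem for `(X, Y) = (U - up, Θ - θp)` on `[0, ∞)`. It is posed
under the relation `um / vm = up / vp` under which the system is derived; velocity (equivalently,
specific volume) and temperature stay positive. -/
structure IsPertSolution (g : Gas) (vm um θm vp up θp : ℝ) (X Y : ℝ → ℝ) : Prop where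
  flux : um / vm = up / vp
  U_pos : ∀ ξ, 0 ≤ ξ → 0 < up + X ξ
  Θ_pos : ∀ ξ, 0 ≤ ξ → 0 < θp + Y ξ
  cont_X : ContinuousOn X (Ici 0)
  cont_Y : ContinuousOn Y (Ici 0)
  ode_X : ∀ ξ, 0 < ξ → HasDerivAt X (pertField g up θp (X ξ, Y ξ)).1 ξ
  ode_Y : ∀ ξ, 0 < ξ → HasDerivAt Y (pertField g up θp (X ξ, Y ξ)).2 ξ
  X_zero : X 0 = um - up
  Y_zero : Y 0 = θm - θp
  X_lim : Tendsto X atTop (𝓝 0)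
  Y_lim : Tendsto Y atTop (𝓝 0)

/-- `p` is a saddle of the planar vector field `f`: an equilibrium whose linearization has one
positive and one negative eigenvalue. -/
def IsSaddle (f : ℝ × ℝ → ℝ × ℝ) (p : ℝ × ℝ) : Prop :=
  f p = 0 ∧ DifferentiableAt ℝ f p ∧
  ∃ l₁ l₂ : ℝ, 0 < l₁ ∧ l₂ < 0 ∧
    Module.End.HasEigenvalue (fderiv ℝ f p : ℝ × ℝ →ₗ[ℝ] ℝ × ℝ) l₁ ∧
    Module.End.HasEigenvalue (fderiv ℝ f p : ℝ × ℝ →ₗ[ℝ] ℝ × ℝ) l₂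

/-- `p` is a saddle-node of the planar vector field `f`: an equilibrium at which `f` is smooth,
whose linearization `L` has a simple eigenvalue `0` and a nonzero real eigenvalue, and with nonzero
quadratic coefficient `ℓ (D²f (r, r))`, where `L r = 0` and `ℓ ∘ L = 0`. -/
def IsSaddleNode (f : ℝ × ℝ → ℝ × ℝ) (p : ℝ × ℝ) : Prop :=
  f p = 0 ∧ ContDiffAt ℝ ∞ f p ∧
  (∃ l : ℝ, l ≠ 0 ∧ Module.End.HasEigenvalue (fderiv ℝ f p : ℝ × ℝ →ₗ[ℝ] ℝ × ℝ) l) ∧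
  ∃ (r : ℝ × ℝ) (ℓ : ℝ × ℝ →L[ℝ] ℝ), r ≠ 0 ∧ ℓ ≠ 0 ∧
    fderiv ℝ f p r = 0 ∧ ℓ.comp (fderiv ℝ f p) = 0 ∧
    iteratedDeriv 2 (fun t : ℝ => ℓ (f (p + t • r))) 0 ≠ 0

/-- `Γ` is a (half-)trajectory of `w' = f(w)` that tends to the equilibrium `p` as `ξ → +∞` and
does not consist of `p` alone. -/
def IsTrajectoryInto (f : ℝ × ℝ → ℝ × ℝ) (p : ℝ × ℝ) (Γ : Set (ℝ × ℝ)) : Prop :=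
  ∃ w : ℝ → ℝ × ℝ, (∀ ξ, 0 < ξ → HasDerivAt w (f (w ξ)) ξ) ∧ (∀ ξ, 0 < ξ → w ξ ≠ p) ∧
    Tendsto w atTop (𝓝 p) ∧ Γ = w '' Ioi 0

/-- The set `Γ` is tangent at `p` to the line `a (U - p.1) + b (Θ - p.2) = 0`. -/
def TangentToLine (Γ : Set (ℝ × ℝ)) (p : ℝ × ℝ) (a b : ℝ) : Prop :=
  (fun q : ℝ × ℝ => a * (q.1 - p.1) + b * (q.2 - p.2)) =o[𝓝[Γ] p] fun q => q - p

/-- The set `Γ` reaches `p` along the ray of direction `e`. -/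
def TangentToRay (Γ : Set (ℝ × ℝ)) (p e : ℝ × ℝ) : Prop :=
  (fun q : ℝ × ℝ => (q - p) - (‖q - p‖ / ‖e‖) • e) =o[𝓝[Γ] p] fun q => q - p

/-- `M` is a smooth curve through `p`: the graph, over an open
interval of the axis `p + ℝ e` around `p`, of a smooth function with values in the direction `e'`
that vanishes to first order at `p`. -/
def IsSmoothGraphOver (M : Set (ℝ × ℝ)) (p e e' : ℝ × ℝ) : Prop :=
  ∃ (a b : ℝ) (h : ℝ → ℝ), a < 0 ∧ 0 < b ∧ ContDiffOn ℝ ∞ h (Ioo a b) ∧ h 0 = 0 ∧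
    deriv h 0 = 0 ∧ M = (fun s : ℝ => p + s • e + h s • e') '' Ioo a b

/-- The length of the `n`-th derivative of `(U - up, Θ - θp)` at `ξ`, on the half line `[0, ∞)`. -/
def derivLen (n : ℕ) (up θp : ℝ) (U Θ : ℝ → ℝ) (ξ : ℝ) : ℝ :=
  len (iteratedDerivWithin n (fun x => U x - up) (Ici 0) ξ)
    (iteratedDerivWithin n (fun x => Θ x - θp) (Ici 0) ξ)

/-- Neither the boundary layer problem nor the perturbation problem has a solution. -/
def NoSolution (g : Gas) (vm um θm vp up θp : ℝ) : Prop :=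
  (¬ ∃ V U Θ : ℝ → ℝ, IsBLSolution g vm um θm vp up θp V U Θ) ∧
  (¬ ∃ X Y : ℝ → ℝ, IsPertSolution g vm um θm vp up θp X Y)

/-- The boundary layer problem and the perturbation problem are solvable exactly when the two end
states carry the same flux and `(um, θm)` lies in `S`. -/
def SolvableIff (g : Gas) (vm um θm vp up θp : ℝ) (S : Set (ℝ × ℝ)) : Prop :=
  ((∃ V U Θ : ℝ → ℝ, IsBLSolution g vm um θm vp up θp V U Θ) ↔
    um / vm = up / vp ∧ (um, θm) ∈ S) ∧
  ((∃ X Y : ℝ → ℝ, IsPertSolution g vm um θm vp up θp X Y) ↔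
    um / vm = up / vp ∧ (um, θm) ∈ S)

/-- Uniqueness of the solution, on `[0, ∞)`, for both problems. -/
def AtMostOneSolution (g : Gas) (vm um θm vp up θp : ℝ) : Prop :=
  (∀ V U Θ V' U' Θ' : ℝ → ℝ, IsBLSolution g vm um θm vp up θp V U Θ →
    IsBLSolution g vm um θm vp up θp V' U' Θ' →
    EqOn V V' (Ici 0) ∧ EqOn U U' (Ici 0) ∧ EqOn Θ Θ' (Ici 0)) ∧
  (∀ X Y X' Y' : ℝ → ℝ, IsPertSolution g vm um θm vp up θp X Y →
    IsPertSolution g vm um θm vp up θp X' Y' → EqOn X X' (Ici 0) ∧ EqOn Y Y' (Ici 0))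

end

/-! The mass equation at the boundary gives `um / vm = up / vp`, hence `V = (vp / up) U`, and `um >
0` forces `up > 0`. Both problems then ask which points lie on an orbit of one planar polynomial
field that tends to the equilibrium 0 while velocity and temperature stay positive. Uniqueness of
solutions is Cauchy-Lipschitz. The linear part J has positive trace when the Mach number is at least
1, and its determinant has the sign of the Mach number minus 1, so its eigenvalues are both
positive, 0 and positive, or of opposite signs.

The analysis near 0 is local, but data near 0 might start an orbit that makes a large excursion
before it returns. Thermodynamics excludes this: entropy minus conductive entropy flux is a function
of the state, and it increases along orbits at the rate of entropy production, which vanishes only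
at equilibria. Crossing an annulus around 0 costs a fixed amount of this function, while an orbit
that starts near 0 and ends at 0 has almost none to spend (`exists_forall_stay_of_lyapunov`,
`exists_forall_stay`).

Decaying orbits are compared by quadratic forms. If a form increases strictly along J, it also
increases along the difference of two small decaying orbits, and since it tends to 0 it is
nonpositive (`exists_quadForm_sub_nonpos`). Supersonic: a positive definite form works, so only the
constant orbit decays. Subsonic: in eigencoordinates, s stable and t unstable, the form `t² - s²`
works, so two small decaying orbits with equal initial s coincide. A convergent power series gives a
curve of decaying orbits on which s fills a neighbourhood of 0 (`exists_invariant_curve`,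
`exists_stable_curve`); hence there are no others.

Transonic: linear coordinates bring the field to the form `x' = f₀ x² + ...`, `y' = l y + ...` with
`f₀ < 0 < l`. Monotonicity of `y² - C x³` confines decaying orbits to a cusp around the positive
x-axis. In the chart `y = x z`, with `s = 1 / x` as the new variable, the slope z satisfies an
unstable scalar equation, whose bounded solution is a fixed point of a contraction. It yields one
decaying orbit, with x of order `1 / ξ`, and any other small one lies on it
(`SaddleNodeForm.exists_stable_orbit`).

In the last two cases each solution is a time shift of one or two fixed orbits, so uniform constants
come from these orbits alone. Derivative bounds follow by differentiating the equation. In the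
transonic case the unstable component gains its extra power of x because a bounded solution of `v' =
l v + g` is controlled by later values of g (`abs_le_of_bounded_unstable`). -/

section Uniqueness

/-! ### Uniqueness and smoothness for autonomous equations -/

variable {E : Type*} [NormedAddCommGroup E] [NormedSpace ℝ E] {f : E → E} {w v : ℝ → E}

/-- Solutions are only assumed continuous at the left endpoint. The one-sided derivative there,
which the Grönwall argument uses, is the limit of `f (w x)`. -/
lemma hasDerivWithinAt_Ici_of_ode (hf : Continuous f) {a : ℝ} (hw : ContinuousOn w (Ici a))
    (hw' : ∀ ξ, a < ξ → HasDerivAt w (f (w ξ)) ξ) : HasDerivWithinAt w (f (w a)) (Ici a) a := by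
  refine hasDerivWithinAt_Ici_of_tendsto_deriv (s := Ioi a)
    (fun x hx => (hw' x hx).differentiableAt.differentiableWithinAt)
    ((hw a self_mem_Ici).mono Ioi_subset_Ici_self) self_mem_nhdsWithin ?_
  have h1 : Tendsto (fun x => f (w x)) (𝓝[>] a) (𝓝 (f (w a))) :=
    (hf.tendsto _).comp ((hw a self_mem_Ici).mono Ioi_subset_Ici_self)
  refine h1.congr' ?_
  filter_upwards [self_mem_nhdsWithin] with x hx using (hw' x hx).deriv.symm

/-- Forward uniqueness for an autonomous equation with locally Lipschitz right-hand side. -/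
theorem eqOn_Ici_of_ode (hf : LocallyLipschitz f) {a : ℝ}
    (hw : ContinuousOn w (Ici a)) (hw' : ∀ ξ, a < ξ → HasDerivAt w (f (w ξ)) ξ)
    (hv : ContinuousOn v (Ici a)) (hv' : ∀ ξ, a < ξ → HasDerivAt v (f (v ξ)) ξ)
    (h0 : w a = v a) : EqOn w v (Ici a) := by
  intro b hb
  have hwc : ContinuousOn w (Icc a b) := hw.mono Icc_subset_Ici_self
  have hvc : ContinuousOn v (Icc a b) := hv.mono Icc_subset_Ici_self
  -- Both pieces of orbit lie in one compact set, on which `f` has a single Lipschitz constant.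
  obtain ⟨K, hK⟩ := LocallyLipschitzOn.exists_lipschitzOnWith_of_compact
    ((isCompact_Icc.image_of_continuousOn hwc).union (isCompact_Icc.image_of_continuousOn hvc))
    (hf.locallyLipschitzOn)
  have key : ∀ u : ℝ → E, ContinuousOn u (Ici a) → (∀ ξ, a < ξ → HasDerivAt u (f (u ξ)) ξ) →
      ∀ t ∈ Ico a b, HasDerivWithinAt u (f (u t)) (Ici t) t := by
    intro u hu hu' t ht
    rcases ht.1.eq_or_lt with rfl | h
    · exact hasDerivWithinAt_Ici_of_ode hf.continuous hu hu'
    · exact (hu' t h).hasDerivWithinAt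
  exact ODE_solution_unique_of_mem_Icc_right (v := fun _ => f) (s := fun _ => _)
    (fun _ _ => hK) hwc (key w hw hw')
    (fun t ht => Or.inl (mem_image_of_mem w (Ico_subset_Icc_self ht))) hvc (key v hv hv')
    (fun t ht => Or.inr (mem_image_of_mem v (Ico_subset_Icc_self ht))) h0 (right_mem_Icc.2 hb)

/-- Two-sided uniqueness for an autonomous equation with locally Lipschitz right-hand side. -/
theorem eqOn_Ioi_of_ode (hf : LocallyLipschitz f) {a t : ℝ} (ht : a < t)
    (hw : ∀ ξ, a < ξ → HasDerivAt w (f (w ξ)) ξ) (hv : ∀ ξ, a < ξ → HasDerivAt v (f (v ξ)) ξ)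
    (h0 : w t = v t) : EqOn w v (Ioi a) := by
  have hwc : ContinuousOn w (Ioi a) := fun x hx => (hw x hx).continuousAt.continuousWithinAt
  have hvc : ContinuousOn v (Ioi a) := fun x hx => (hv x hx).continuousAt.continuousWithinAt
  intro b (hb : a < b)
  rcases le_total t b with h | h
  · exact eqOn_Ici_of_ode hf (hwc.mono (Ici_subset_Ioi.2 ht)) (fun ξ hξ => hw ξ (ht.trans hξ))
      (hvc.mono (Ici_subset_Ioi.2 ht)) (fun ξ hξ => hv ξ (ht.trans hξ)) h0 h
  · have hsub : Icc b t ⊆ Ioi a := fun x hx => hb.trans_le hx.1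
    have hwc' := hwc.mono hsub
    have hvc' := hvc.mono hsub
    obtain ⟨K, hK⟩ := LocallyLipschitzOn.exists_lipschitzOnWith_of_compact
      ((isCompact_Icc.image_of_continuousOn hwc').union (isCompact_Icc.image_of_continuousOn hvc'))
      (hf.locallyLipschitzOn)
    exact ODE_solution_unique_of_mem_Icc_left (v := fun _ => f) (s := fun _ => _)
      (fun _ _ => hK) hwc' (fun x hx => (hw x (hb.trans hx.1)).hasDerivWithinAt)
      (fun x hx => Or.inl (mem_image_of_mem w (Ioc_subset_Icc_self hx))) hvc'
      (fun x hx => (hv x (hb.trans hx.1)).hasDerivWithinAt)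
      (fun x hx => Or.inr (mem_image_of_mem v (Ioc_subset_Icc_self hx))) h0 (left_mem_Icc.2 h)

/-- Solutions of an equation with smooth right-hand side are smooth. -/
theorem contDiffOn_of_ode (hf : ContDiff ℝ ∞ f) {s : Set ℝ} (hs : IsOpen s)
    (hw : ∀ ξ ∈ s, HasDerivAt w (f (w ξ)) ξ) : ContDiffOn ℝ ∞ w s := by
  refine contDiffOn_infty.2 fun n => ?_
  induction n with
  | zero =>
    exact contDiffOn_zero.2 fun x hx => (hw x hx).continuousAt.continuousWithinAt
  | succ n ih =>
    rw [Nat.cast_add, Nat.cast_one, contDiffOn_succ_iff_deriv_of_isOpen hs]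
    refine ⟨fun x hx => (hw x hx).differentiableAt.differentiableWithinAt, by simp, ?_⟩
    have : ContDiffOn ℝ n (fun x => f (w x)) s :=
      (hf.of_le (by exact_mod_cast le_top)).comp_contDiffOn ih
    exact this.congr fun x hx => (hw x hx).deriv

end Uniqueness

/-! ### Decay of derivatives, order by order -/

section DerivBound

/-- `f` and its first `N` derivatives are `O(x ^ m * y ^ j)` on `(0, ∞)`. -/
def DerivBound (x y : ℝ → ℝ) (m N : ℕ) (f : ℝ → ℝ) : Prop :=
  ∃ C : ℝ, 0 < C ∧ ∀ j ≤ N, ∀ ξ, 0 < ξ → |iteratedDeriv j f ξ| ≤ C * (x ξ ^ m * y ξ ^ j)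

variable {x y f g h : ℝ → ℝ} {m m' N : ℕ}

lemma DerivBound.add
    (hf : DerivBound x y m N f) (hg : DerivBound x y m N g)
    (hfs : ContDiffOn ℝ ∞ f (Ioi 0)) (hgs : ContDiffOn ℝ ∞ g (Ioi 0)) :
    DerivBound x y m N (fun ξ => f ξ + g ξ) := by
  obtain ⟨C, hC, hfC⟩ := hf
  obtain ⟨D, hD, hgD⟩ := hg
  refine ⟨C + D, by positivity, fun j hj ξ hξ => ?_⟩
  have h1 : ContDiffAt ℝ j f ξ := (hfs.contDiffAt (Ioi_mem_nhds hξ)).of_le (by exact_mod_cast le_top)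
  have h2 : ContDiffAt ℝ j g ξ := (hgs.contDiffAt (Ioi_mem_nhds hξ)).of_le (by exact_mod_cast le_top)
  rw [iteratedDeriv_fun_add h1 h2, add_mul]
  exact (abs_add_le _ _).trans (add_le_add (hfC j hj ξ hξ) (hgD j hj ξ hξ))

lemma DerivBound.const_mul (hx : ∀ ξ, 0 < ξ → 0 ≤ x ξ) (hy : ∀ ξ, 0 < ξ → 0 ≤ y ξ) (c : ℝ)
    (hf : DerivBound x y m N f) :
    DerivBound x y m N (fun ξ => c * f ξ) := by
  obtain ⟨C, hC, hfC⟩ := hf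
  refine ⟨|c| * C + 1, by positivity, fun j hj ξ hξ => ?_⟩
  have := hfC j hj ξ hξ
  have hpos : 0 ≤ x ξ ^ m * y ξ ^ j := by have := hx ξ hξ; have := hy ξ hξ; positivity
  rw [iteratedDeriv_const_mul_field, abs_mul]
  nlinarith [mul_le_mul_of_nonneg_left this (abs_nonneg c)]

/-- In Leibniz's formula every term carries the same weight, and the binomial coefficients sum to `2
^ j`. The weight `y` is taken to be 1 for exponential decay, and `x` for algebraic decay, where each
derivative gains a factor `x`. -/
lemma DerivBound.mul (hx : ∀ ξ, 0 < ξ → 0 ≤ x ξ) (hy : ∀ ξ, 0 < ξ → 0 ≤ y ξ)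
    (hf : DerivBound x y m N f) (hg : DerivBound x y m' N g)
    (hfs : ContDiffOn ℝ ∞ f (Ioi 0)) (hgs : ContDiffOn ℝ ∞ g (Ioi 0)) :
    DerivBound x y (m + m') N (fun ξ => f ξ * g ξ) := by
  obtain ⟨C, hC, hfC⟩ := hf
  obtain ⟨D, hD, hgD⟩ := hg
  refine ⟨2 ^ N * (C * D), by positivity, fun j hj ξ hξ => ?_⟩
  have h1 : ContDiffAt ℝ j f ξ := (hfs.contDiffAt (Ioi_mem_nhds hξ)).of_le (by exact_mod_cast le_top)
  have h2 : ContDiffAt ℝ j g ξ := (hgs.contDiffAt (Ioi_mem_nhds hξ)).of_le (by exact_mod_cast le_top)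
  have hx0 := hx ξ hξ
  have hy0 := hy ξ hξ
  rw [iteratedDeriv_fun_mul h1 h2]
  calc |∑ i ∈ Finset.range (j + 1), (j.choose i : ℝ) * iteratedDeriv i f ξ * iteratedDeriv (j - i) g ξ|
      ≤ ∑ i ∈ Finset.range (j + 1), (j.choose i : ℝ) * (C * D * (x ξ ^ (m + m') * y ξ ^ j)) := by
        refine (Finset.abs_sum_le_sum_abs _ _).trans (Finset.sum_le_sum fun i hi => ?_)
        have hij : i ≤ j := Nat.lt_succ_iff.1 (Finset.mem_range.1 hi)
        rw [abs_mul, abs_mul, Nat.abs_cast, mul_assoc]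
        refine mul_le_mul_of_nonneg_left ?_ (Nat.cast_nonneg _)
        calc |iteratedDeriv i f ξ| * |iteratedDeriv (j - i) g ξ|
            ≤ (C * (x ξ ^ m * y ξ ^ i)) * (D * (x ξ ^ m' * y ξ ^ (j - i))) :=
              mul_le_mul (hfC i (hij.trans hj) ξ hξ) (hgD _ ((Nat.sub_le _ _).trans hj) ξ hξ)
                (abs_nonneg _) (by positivity)
          _ = C * D * (x ξ ^ (m + m') * (y ξ ^ i * y ξ ^ (j - i))) := by ring
          _ = C * D * (x ξ ^ (m + m') * y ξ ^ j) := by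
              rw [← pow_add, Nat.add_sub_cancel' hij]
    _ = 2 ^ j * (C * D * (x ξ ^ (m + m') * y ξ ^ j)) := by
        rw [← Finset.sum_mul, ← Nat.cast_sum, Nat.sum_range_choose]; norm_num
    _ ≤ 2 ^ N * (C * D * (x ξ ^ (m + m') * y ξ ^ j)) := by
        gcongr; norm_num
    _ = _ := by ring

lemma DerivBound.mono_exp (hx : ∀ ξ, 0 < ξ → 0 ≤ x ξ) (hx1 : ∀ ξ, 0 < ξ → x ξ ≤ 1)
    (hy : ∀ ξ, 0 < ξ → 0 ≤ y ξ) (hm : m' ≤ m) (hf : DerivBound x y m N f) :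
    DerivBound x y m' N f := by
  obtain ⟨C, hC, hfC⟩ := hf
  refine ⟨C, hC, fun j hj ξ hξ => (hfC j hj ξ hξ).trans ?_⟩
  have := hy ξ hξ
  gcongr C * (?_ * _)
  exact pow_le_pow_of_le_one (hx ξ hξ) (hx1 ξ hξ) hm

/-- A bound for one more derivative, from bounds for the right-hand side of `f' = g`. -/
lemma DerivBound.succ (hx : ∀ ξ, 0 < ξ → 0 ≤ x ξ) (hy : ∀ ξ, 0 < ξ → 0 ≤ y ξ)
    (hf : DerivBound x y m N f) (hfg : ∀ ξ, 0 < ξ → HasDerivAt f (g ξ) ξ)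
    (hg : ∃ C, 0 < C ∧ ∀ ξ, 0 < ξ → |iteratedDeriv N g ξ| ≤ C * (x ξ ^ m * y ξ ^ (N + 1))) :
    DerivBound x y m (N + 1) f := by
  obtain ⟨C, hC, hfC⟩ := hf
  obtain ⟨D, hD, hgD⟩ := hg
  refine ⟨C + D, by positivity, fun j hj ξ hξ => ?_⟩
  have hx0 := hx ξ hξ
  have hy0 := hy ξ hξ
  have hpos : 0 ≤ x ξ ^ m * y ξ ^ j := by positivity
  rcases Nat.le_add_one_iff.1 hj with hj | rfl
  · nlinarith [hfC j hj ξ hξ]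
  · have h1 : EqOn (deriv f) g (Ioi 0) := fun t ht => (hfg t ht).deriv
    have h2 : iteratedDeriv (N + 1) f ξ = iteratedDeriv N g ξ := by
      rw [iteratedDeriv_succ']
      exact h1.iteratedDeriv_of_isOpen isOpen_Ioi N hξ
    rw [h2]
    nlinarith [hgD ξ hξ]

/-- A bounded solution of `v' = l v + g` with `l > 0` is controlled by the later values of `g`. -/
lemma abs_le_of_bounded_unstable {l : ℝ} (hl : 0 < l) {v g : ℝ → ℝ} {a M B : ℝ}
    (hv : ∀ ξ, a ≤ ξ → HasDerivAt v (l * v ξ + g ξ) ξ) (hB : ∀ ξ, a ≤ ξ → |v ξ| ≤ B)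
    (hg : ∀ ξ, a ≤ ξ → |g ξ| ≤ M) : |v a| ≤ M / l := by
  have key : ∀ (v g : ℝ → ℝ), (∀ ξ, a ≤ ξ → HasDerivAt v (l * v ξ + g ξ) ξ) →
      (∀ ξ, a ≤ ξ → |v ξ| ≤ B) → (∀ ξ, a ≤ ξ → |g ξ| ≤ M) → v a ≤ M / l := by
    intro v g hv hB hg
    -- The integrating factor turns the equation into monotonicity: this function is nondecreasing
    -- because `M + g ≥ 0`, and it tends to 0 because `v` is bounded, so it is nonpositive at `a`.
    have hd : ∀ ξ, a ≤ ξ → HasDerivAt (fun ξ => (v ξ - M / l) * Real.exp (-l * ξ))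
        ((M + g ξ) * Real.exp (-l * ξ)) ξ := by
      intro ξ hξ
      have h1 := ((hv ξ hξ).sub_const (M / l)).mul (((hasDerivAt_id' ξ).const_mul (-l)).exp)
      refine h1.congr_deriv ?_
      field_simp
      ring
    have hmono : MonotoneOn (fun ξ => (v ξ - M / l) * Real.exp (-l * ξ)) (Ici a) := by
      refine monotoneOn_of_deriv_nonneg (convex_Ici a)
        (fun ξ hξ => (hd ξ hξ).continuousAt.continuousWithinAt)
        (fun ξ hξ => (hd ξ (interior_subset hξ)).differentiableAt.differentiableWithinAt) ?_
      intro ξ hξ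
      rw [(hd ξ (interior_subset hξ)).deriv]
      have := (abs_le.1 (hg ξ (interior_subset hξ))).1
      have := Real.exp_pos (-l * ξ)
      nlinarith
    have hexp : Tendsto (fun ξ : ℝ => Real.exp (-l * ξ)) atTop (𝓝 0) := by
      refine Real.tendsto_exp_atBot.comp ?_
      exact tendsto_id.const_mul_atTop_of_neg (by linarith)
    have hlim : Tendsto (fun ξ => (v ξ - M / l) * Real.exp (-l * ξ)) atTop (𝓝 0) := by
      refine squeeze_zero_norm' (a := fun ξ => (B + |M / l|) * Real.exp (-l * ξ)) ?_
        (by simpa using hexp.const_mul (B + |M / l|))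
      filter_upwards [eventually_ge_atTop a] with ξ hξ
      rw [Real.norm_eq_abs, abs_mul, abs_of_pos (Real.exp_pos _)]
      gcongr
      exact (abs_sub _ _).trans (add_le_add (hB ξ hξ) le_rfl)
    have h0 : (v a - M / l) * Real.exp (-l * a) ≤ 0 := by
      refine ge_of_tendsto hlim ?_
      filter_upwards [eventually_ge_atTop a] with ξ hξ using hmono self_mem_Ici hξ hξ
    have := nonpos_of_mul_nonpos_left h0 (Real.exp_pos _)
    linarith
  refine abs_le.2 ⟨?_, key v g hv hB hg⟩
  have := key (fun ξ => - v ξ) (fun ξ => - g ξ)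
    (fun ξ hξ => (hv ξ hξ).fun_neg.congr_deriv (by ring))
    (fun ξ hξ => by simpa using hB ξ hξ) (fun ξ hξ => by simpa using hg ξ hξ)
  linarith

end DerivBound

/-! ### Confinement by a Lyapunov function -/

/-- The squared Euclidean length on `ℝ × ℝ`. -/
def sqLen (q : ℝ × ℝ) : ℝ := q.1 ^ 2 + q.2 ^ 2

lemma continuous_sqLen : Continuous sqLen := by unfold sqLen; fun_prop

lemma sqLen_nonneg (q : ℝ × ℝ) : 0 ≤ sqLen q := by unfold sqLen; positivity

lemma norm_sq_le_sqLen (q : ℝ × ℝ) : ‖q‖ ^ 2 ≤ sqLen q := by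
  unfold sqLen
  rw [Prod.norm_def]
  rcases max_cases ‖q.1‖ ‖q.2‖ with ⟨h, -⟩ | ⟨h, -⟩ <;> rw [h, Real.norm_eq_abs, sq_abs] <;>
    nlinarith [sq_nonneg q.1, sq_nonneg q.2]

lemma sqLen_le_norm_sq (q : ℝ × ℝ) : sqLen q ≤ 2 * ‖q‖ ^ 2 := by
  unfold sqLen
  have h1 := norm_fst_le q
  have h2 := norm_snd_le q
  rw [Real.norm_eq_abs] at h1 h2
  rw [← sq_abs q.1, ← sq_abs q.2]
  nlinarith [abs_nonneg q.1, abs_nonneg q.2]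

lemma isCompact_sqLen_le (r : ℝ) : IsCompact {q : ℝ × ℝ | sqLen q ≤ r} := by
  refine (isCompact_closedBall (0 : ℝ × ℝ) (√r)).of_isClosed_subset
    (isClosed_le continuous_sqLen continuous_const) fun q hq => ?_
  rw [mem_closedBall_zero_iff]
  exact Real.le_sqrt_of_sq_le ((norm_sq_le_sqLen q).trans hq)

lemma monotoneOn_le_of_tendsto {v : ℝ → ℝ} {l : ℝ} (hv : MonotoneOn v (Ici 0))
    (hl : Tendsto v atTop (𝓝 l)) {ξ : ℝ} (hξ : 0 ≤ ξ) : v ξ ≤ l := by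
  refine ge_of_tendsto hl ?_
  filter_upwards [eventually_ge_atTop ξ] with t ht using hv hξ (hξ.trans ht) ht

lemma monotoneOn_Ici_of_hasDerivAt_nonneg {v v' : ℝ → ℝ} {a : ℝ} (hc : ContinuousOn v (Ici a))
    (hd : ∀ ξ, a < ξ → HasDerivAt v (v' ξ) ξ) (h0 : ∀ ξ, a < ξ → 0 ≤ v' ξ) :
    MonotoneOn v (Ici a) := by
  refine monotoneOn_of_deriv_nonneg (convex_Ici a) hc ?_ ?_ <;> rw [interior_Ici]
  · exact fun ξ hξ => (hd ξ hξ).differentiableAt.differentiableWithinAt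
  · exact fun ξ hξ => by rw [(hd ξ hξ).deriv]; exact h0 ξ hξ

/-- If `N` is a strict Lyapunov function near `0`, then the trajectories that start near `0` and
tend to `0` stay near `0`. -/
theorem exists_forall_stay_of_lyapunov {f : ℝ × ℝ → ℝ × ℝ} (hf : Continuous f) {Ω : Set (ℝ × ℝ)}
    {N G : ℝ × ℝ → ℝ} (hN0 : ContinuousAt N 0) (hG : ContinuousOn G Ω)
    (hG0 : ∀ q ∈ Ω, 0 ≤ G q) {r : ℝ} (hr : 0 < r) (hball : ∀ q, sqLen q ≤ r ^ 2 → q ∈ Ω)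
    (hGpos : ∀ q, 0 < sqLen q → sqLen q ≤ r ^ 2 → 0 < G q) :
    ∃ δ, 0 < δ ∧ ∀ w : ℝ → ℝ × ℝ, ContinuousOn w (Ici 0) →
      (∀ ξ, 0 < ξ → HasDerivAt w (f (w ξ)) ξ) →
      ContinuousOn (fun ξ => N (w ξ)) (Ici 0) →
      (∀ ξ, 0 < ξ → HasDerivAt (fun ξ => N (w ξ)) (G (w ξ)) ξ) →
      (∀ ξ, 0 ≤ ξ → w ξ ∈ Ω) → Tendsto w atTop (𝓝 0) → sqLen (w 0) ≤ δ ^ 2 →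
      ∀ ξ, 0 ≤ ξ → sqLen (w ξ) < r ^ 2 := by
  -- A cutoff of the squared length: 0 inside radius `r / 2`, 1 outside radius `r`. Its derivative
  -- lives on the annulus `K`, where the dissipation has a positive minimum.
  set χ : ℝ → ℝ := fun v => Real.smoothTransition ((v - r ^ 2 / 4) / (r ^ 2 * 3 / 4)) with hχ
  have hχs : ContDiff ℝ 1 χ := Real.smoothTransition.contDiff.comp (by fun_prop)
  have hr2 : 0 < r ^ 2 := by positivity
  have hχ0 : ∀ v ≤ r ^ 2 / 4, χ v = 0 := fun v hv =>
    Real.smoothTransition.zero_of_nonpos (div_nonpos_of_nonpos_of_nonneg (by linarith) (by linarith))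
  have hχ1 : ∀ v, r ^ 2 ≤ v → χ v = 1 := fun v hv =>
    Real.smoothTransition.one_of_one_le ((one_le_div (by linarith)).2 (by linarith))
  have hd0 : ∀ v, v < r ^ 2 / 4 ∨ r ^ 2 < v → deriv χ v = 0 := by
    rintro v (hv | hv)
    · have : χ =ᶠ[𝓝 v] fun _ => 0 := by
        filter_upwards [Iio_mem_nhds hv] with t ht using hχ0 t (le_of_lt ht)
      rw [this.deriv_eq]; simp
    · have : χ =ᶠ[𝓝 v] fun _ => 1 := by
        filter_upwards [Ioi_mem_nhds hv] with t ht using hχ1 t (le_of_lt ht)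
      rw [this.deriv_eq]; simp
  set K : Set (ℝ × ℝ) := {q | sqLen q ≤ r ^ 2} ∩ {q | r ^ 2 / 4 ≤ sqLen q} with hK
  have hKc : IsCompact K := (isCompact_sqLen_le _).inter_right
    (isClosed_le continuous_const continuous_sqLen)
  have hKne : K.Nonempty := ⟨(r, 0), by simp [hK, sqLen]; nlinarith⟩
  set G₂ : ℝ × ℝ → ℝ := fun q => deriv χ (sqLen q) * (2 * q.1 * (f q).1 + 2 * q.2 * (f q).2) with hG₂
  have hG₂c : Continuous G₂ := by
    have := (hχs.continuous_deriv le_rfl).comp continuous_sqLen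
    simp only [Function.comp_def] at this
    fun_prop
  obtain ⟨q₀, hq₀, hmin⟩ := hKc.exists_isMinOn hKne (hG.mono fun q hq => hball q hq.1)
  obtain ⟨B, hB⟩ := hKc.exists_bound_of_continuousOn hG₂c.continuousOn
  have hm : 0 < G q₀ := hGpos q₀ (lt_of_lt_of_le (by linarith) hq₀.2) hq₀.1
  have hB0 : 0 ≤ B := (norm_nonneg _).trans (hB q₀ hq₀)
  -- With this `ε` the dissipation outweighs `ε` times the growth of the cutoff on the annulus, so
  -- `N - ε χ` is still nondecreasing. The summand 1 covers `B = 0`.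
  set ε := G q₀ / (B + 1) with hε
  have hεp : 0 < ε := by positivity
  have hcomp : ∀ q ∈ Ω, 0 ≤ G q - ε * G₂ q := by
    intro q hq
    by_cases hqK : q ∈ K
    · have h1 : G q₀ ≤ G q := hmin hqK
      have h2 : G₂ q ≤ B := (le_abs_self _).trans (hB q hqK)
      have h3 : ε * (B + 1) = G q₀ := by rw [hε]; field_simp
      nlinarith
    · have : deriv χ (sqLen q) = 0 := by
        apply hd0
        by_contra! hcon
        exact hqK ⟨hcon.2, hcon.1⟩
      simp only [hG₂, this]
      have := hG0 q hq
      linarith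
  obtain ⟨d, hd, hdN⟩ := Metric.continuousAt_iff.1 hN0 ε hεp
  -- The bound `r / 2` makes the cutoff vanish at the start; `d / 2` makes `N (w 0)` differ from `N
  -- 0` by less than `ε`.
  refine ⟨min (d / 2) (r / 2), by positivity, ?_⟩
  intro w hwc hw hNc hNd hΩ hlim h0 ξ hξ
  by_contra! hcon
  have hρ : ∀ ξ, 0 < ξ → HasDerivAt (fun ξ => sqLen (w ξ))
      (2 * (w ξ).1 * (f (w ξ)).1 + 2 * (w ξ).2 * (f (w ξ)).2) ξ := by
    intro ξ hξ
    have h1 : HasDerivAt (fun ξ => (w ξ).1) (f (w ξ)).1 ξ := (hw ξ hξ).fst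
    have h2 : HasDerivAt (fun ξ => (w ξ).2) (f (w ξ)).2 ξ := (hw ξ hξ).snd
    refine ((h1.fun_pow 2).fun_add (h2.fun_pow 2)).congr_deriv ?_
    simp
  have hmN : MonotoneOn (fun ξ => N (w ξ)) (Ici 0) :=
    monotoneOn_Ici_of_hasDerivAt_nonneg hNc hNd fun ξ hξ => hG0 _ (hΩ ξ hξ.le)
  have hmΨ : MonotoneOn (fun ξ => N (w ξ) - ε * χ (sqLen (w ξ))) (Ici 0) := by
    refine monotoneOn_Ici_of_hasDerivAt_nonneg (v' := fun ξ => G (w ξ) - ε * G₂ (w ξ)) ?_ ?_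
      fun ξ hξ => hcomp _ (hΩ ξ hξ.le)
    · exact hNc.sub (continuousOn_const.mul
        (hχs.continuous.comp_continuousOn (continuous_sqLen.comp_continuousOn hwc)))
    · intro ξ hξ
      have h1 : HasDerivAt χ (deriv χ (sqLen (w ξ))) (sqLen (w ξ)) :=
        (hχs.differentiable one_ne_zero).differentiableAt.hasDerivAt
      have h2 : HasDerivAt (fun ξ => χ (sqLen (w ξ))) (G₂ (w ξ)) ξ :=
        h1.comp_of_eq ξ (hρ ξ hξ) rfl
      exact (hNd ξ hξ).fun_sub (h2.const_mul ε)
  have hNlim : Tendsto (fun ξ => N (w ξ)) atTop (𝓝 (N 0)) := hN0.tendsto.comp hlim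
  -- Monotonicity gives `N (w ξ) ≤ N 0`, while an exit at `ξ` would give `N (w ξ) ≥ N (w 0) + ε > N
  -- 0`. No extremum of `N` at 0 is needed.
  have h1 := monotoneOn_le_of_tendsto hmN hNlim hξ
  have h2 := hmΨ self_mem_Ici hξ hξ
  have hδ1 : min (d / 2) (r / 2) ≤ r / 2 := min_le_right _ _
  have hδ2 : min (d / 2) (r / 2) ≤ d / 2 := min_le_left _ _
  have hδ0 : 0 < min (d / 2) (r / 2) := by positivity
  have h3 : χ (sqLen (w 0)) = 0 := hχ0 _ (by nlinarith)
  have h4 : χ (sqLen (w ξ)) = 1 := hχ1 _ hcon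
  simp only [h3, h4] at h2
  have h5 : dist (w 0) 0 < d := by
    rw [dist_zero_right]
    have := (norm_sq_le_sqLen (w 0)).trans h0
    have := abs_le_of_sq_le_sq' this hδ0.le
    linarith
  have h6 := hdN h5
  rw [Real.dist_eq] at h6
  have := (abs_lt.1 h6).1
  linarith

/-! ### Decaying orbits and the reduction to the plane -/

/-- `w` is a solution of `w' = f(w)` on `[0, ∞)` that tends to `0`. -/
structure IsDecayingOrbit (f : ℝ × ℝ → ℝ × ℝ) (w : ℝ → ℝ × ℝ) : Prop where
  cont : ContinuousOn w (Ici 0)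
  ode : ∀ ξ, 0 < ξ → HasDerivAt w (f (w ξ)) ξ
  lim : Tendsto w atTop (𝓝 0)

lemma IsDecayingOrbit.shift {f : ℝ × ℝ → ℝ × ℝ} {w : ℝ → ℝ × ℝ} (hw : IsDecayingOrbit f w) {s : ℝ}
    (hs : 0 ≤ s) : IsDecayingOrbit f (fun ξ => w (ξ + s)) where
  cont := hw.cont.comp (by fun_prop) fun ξ hξ => add_nonneg hξ hs
  ode ξ hξ := (hw.ode (ξ + s) (by linarith)).comp_add_const ξ s
  lim := hw.lim.comp (tendsto_atTop_add_const_right _ _ tendsto_id)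

section Gas

variable {g : Gas} {up θp vm um θm vp : ℝ}

lemma contDiff_pertField (g : Gas) (up θp : ℝ) : ContDiff ℝ ∞ (pertField g up θp) := by
  unfold pertField nonlin₁ nonlin₂
  fun_prop

lemma locallyLipschitz_pertField (g : Gas) (up θp : ℝ) : LocallyLipschitz (pertField g up θp) :=
  ((contDiff_pertField g up θp).of_le (by exact_mod_cast le_top)).locallyLipschitz

lemma pertField_zero (g : Gas) (up θp : ℝ) : pertField g up θp 0 = 0 := by
  simp [pertField, nonlin₁, nonlin₂]

lemma pertField_fst (q : ℝ × ℝ) : (pertField g up θp q).1 =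
    (up ^ 2 - g.R * θp) / (g.μ * up) * q.1 + g.R / g.μ * q.2 + 1 / g.μ * q.1 ^ 2 := by
  simp [pertField, nonlin₁, linPart]

lemma pertField_snd (q : ℝ × ℝ) : (pertField g up θp q).2 =
    g.R * θp / g.κ * q.1 + g.R * up / (g.κ * (g.γ - 1)) * q.2 +
    ((g.R * θp / (g.κ * up) - up / (2 * g.κ)) * q.1 ^ 2 + g.R / (g.κ * (g.γ - 1)) * q.1 * q.2
    - 1 / (2 * g.κ) * q.1 ^ 3) := by
  simp [pertField, nonlin₂, linPart]

lemma IsPertSolution.orbit {X Y : ℝ → ℝ} (h : IsPertSolution g vm um θm vp up θp X Y) :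
    IsDecayingOrbit (pertField g up θp) (fun ξ => (X ξ, Y ξ)) where
  cont := h.cont_X.prodMk h.cont_Y
  ode ξ hξ := (h.ode_X ξ hξ).prodMk (h.ode_Y ξ hξ)
  lim := h.X_lim.prodMk_nhds h.Y_lim

lemma IsDecayingOrbit.isPertSolution {w : ℝ → ℝ × ℝ} (h : IsDecayingOrbit (pertField g up θp) w)
    (hflux : um / vm = up / vp) (hU : ∀ ξ, 0 ≤ ξ → 0 < up + (w ξ).1)
    (hΘ : ∀ ξ, 0 ≤ ξ → 0 < θp + (w ξ).2) (h0 : w 0 = (um - up, θm - θp)) :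
    IsPertSolution g vm um θm vp up θp (fun ξ => (w ξ).1) (fun ξ => (w ξ).2) where
  flux := hflux
  U_pos := hU
  Θ_pos := hΘ
  cont_X := continuous_fst.comp_continuousOn h.cont
  cont_Y := continuous_snd.comp_continuousOn h.cont
  ode_X ξ hξ := (h.ode ξ hξ).fst
  ode_Y ξ hξ := (h.ode ξ hξ).snd
  X_zero := by rw [h0]
  Y_zero := by rw [h0]
  X_lim := (continuous_fst.tendsto _).comp h.lim
  Y_lim := (continuous_snd.tendsto _).comp h.lim

lemma IsBLSolution.flux {V U Θ : ℝ → ℝ} (h : IsBLSolution g vm um θm vp up θp V U Θ)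
    (hvm : 0 < vm) (hvp : 0 < vp) : um / vm = up / vp := by
  have := h.mass 0 le_rfl
  rw [h.V_zero, h.U_zero] at this
  field_simp at this ⊢
  linarith

/-- The flux relation turns the affine mass equation into a proportionality; this eliminates `V` and
leaves a planar system. -/
lemma IsBLSolution.V_eq {V U Θ : ℝ → ℝ} (h : IsBLSolution g vm um θm vp up θp V U Θ)
    (hvm : 0 < vm) (hvp : 0 < vp) (hup : 0 < up) {ξ : ℝ} (hξ : 0 ≤ ξ) :
    V ξ = vp / up * U ξ := by
  have := h.mass ξ hξ
  rw [neg_div, h.flux hvm hvp] at this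
  field_simp at this ⊢
  linarith

/-- This is the whole obstruction in the case `up ≤ 0`. -/
lemma up_pos_of_flux (hvm : 0 < vm) (hum : 0 < um) (hvp : 0 < vp) (h : um / vm = up / vp) :
    0 < up := by
  have h1 : 0 < up / vp := h ▸ div_pos hum hvm
  exact (div_pos_iff_of_pos_right hvp).1 h1

/-- Once `V` is eliminated, the two systems agree by algebra, and positivity of `V` becomes
positivity of the velocity. -/
lemma IsBLSolution.isPertSolution {V U Θ : ℝ → ℝ} (h : IsBLSolution g vm um θm vp up θp V U Θ)
    (hvm : 0 < vm) (hum : 0 < um) (hvp : 0 < vp) :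
    IsPertSolution g vm um θm vp up θp (fun ξ => U ξ - up) (fun ξ => Θ ξ - θp) := by
  have hfl := h.flux hvm hvp
  have hup : 0 < up := up_pos_of_flux hvm hum hvp hfl
  have hμ := g.μ_pos
  have hκ := g.κ_pos
  have hγ : 0 < g.γ - 1 := sub_pos.2 g.one_lt_γ
  have hσ : -um / vm = -(up / vp) := by rw [neg_div, hfl]
  refine ⟨hfl, ?_, ?_, h.cont_U.sub continuousOn_const, h.cont_Θ.sub continuousOn_const, ?_, ?_,
    by simp [h.U_zero], by simp [h.Θ_zero], by simpa using h.U_lim.sub_const up,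
    by simpa using h.Θ_lim.sub_const θp⟩
  · intro ξ hξ
    have h1 := h.V_pos ξ hξ
    rw [h.V_eq hvm hvp hup hξ] at h1
    have := (pos_iff_pos_of_mul_pos h1).1 (by positivity)
    linarith
  · intro ξ hξ
    have := h.Θ_pos ξ hξ
    linarith
  · intro ξ hξ
    refine ((h.momentum ξ hξ).sub_const up).congr_deriv ?_
    rw [pertField_fst, h.V_eq hvm hvp hup hξ.le, hσ]
    simp only
    field_simp
    ring
  · intro ξ hξ
    refine ((h.energy ξ hξ).sub_const θp).congr_deriv ?_
    rw [pertField_snd, h.V_eq hvm hvp hup hξ.le, hσ]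
    simp only
    field_simp
    ring

lemma IsPertSolution.isBLSolution {X Y : ℝ → ℝ} (h : IsPertSolution g vm um θm vp up θp X Y)
    (hvm : 0 < vm) (hum : 0 < um) (hvp : 0 < vp) :
    IsBLSolution g vm um θm vp up θp (fun ξ => vp / up * (up + X ξ)) (fun ξ => up + X ξ)
      (fun ξ => θp + Y ξ) := by
  have hfl := h.flux
  have hup : 0 < up := up_pos_of_flux hvm hum hvp hfl
  have hμ := g.μ_pos
  have hκ := g.κ_pos
  have hγ : 0 < g.γ - 1 := sub_pos.2 g.one_lt_γ
  have hσ : -um / vm = -(up / vp) := by rw [neg_div, hfl]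
  have hV0 : vp / up * um = vm := by
    field_simp at hfl ⊢
    linarith
  have hU0 : up + X 0 = um := by rw [h.X_zero]; ring
  have hUl : Tendsto (fun ξ => up + X ξ) atTop (𝓝 up) := by simpa using h.X_lim.const_add up
  refine ⟨fun ξ hξ => mul_pos (by positivity) (h.U_pos ξ hξ), h.Θ_pos,
    continuousOn_const.add h.cont_X, continuousOn_const.add h.cont_Y, ?_, ?_, ?_,
    by simp only [hU0, hV0], hU0, by rw [h.Y_zero]; ring, ?_, hUl,
    by simpa using h.Y_lim.const_add θp⟩
  · intro ξ hξ
    rw [neg_div, hfl]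
    field_simp
    ring
  · intro ξ hξ
    refine ((h.ode_X ξ hξ).const_add up).congr_deriv ?_
    rw [pertField_fst, hσ]
    simp only
    field_simp
    ring
  · intro ξ hξ
    refine ((h.ode_Y ξ hξ).const_add θp).congr_deriv ?_
    rw [pertField_snd, hσ]
    simp only
    field_simp
    ring
  · have := hUl.const_mul (vp / up)
    rwa [div_mul_cancel₀ _ hup.ne'] at this

lemma IsDecayingOrbit.eqOn {f : ℝ × ℝ → ℝ × ℝ} (hf : LocallyLipschitz f) {w w' : ℝ → ℝ × ℝ}
    (h : IsDecayingOrbit f w) (h' : IsDecayingOrbit f w') (h0 : w 0 = w' 0) :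
    EqOn w w' (Ici 0) :=
  eqOn_Ici_of_ode hf h.cont h.ode h'.cont h'.ode h0

lemma atMostOneSolution (hvm : 0 < vm) (hum : 0 < um) (hvp : 0 < vp) :
    AtMostOneSolution g vm um θm vp up θp := by
  have key : ∀ X Y X' Y' : ℝ → ℝ, IsPertSolution g vm um θm vp up θp X Y →
      IsPertSolution g vm um θm vp up θp X' Y' → EqOn X X' (Ici 0) ∧ EqOn Y Y' (Ici 0) := by
    intro X Y X' Y' h h'
    have := h.orbit.eqOn (locallyLipschitz_pertField g up θp) h'.orbit
      (by simp [h.X_zero, h.Y_zero, h'.X_zero, h'.Y_zero])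
    exact ⟨fun ξ hξ => congrArg Prod.fst (this hξ), fun ξ hξ => congrArg Prod.snd (this hξ)⟩
  refine ⟨?_, key⟩
  intro V U Θ V' U' Θ' h h'
  have hup : 0 < up := up_pos_of_flux hvm hum hvp (h.flux hvm hvp)
  obtain ⟨h1, h2⟩ := key _ _ _ _ (h.isPertSolution hvm hum hvp) (h'.isPertSolution hvm hum hvp)
  have hU : EqOn U U' (Ici 0) := fun ξ hξ => sub_left_injective (h1 hξ)
  refine ⟨fun ξ hξ => ?_, hU, fun ξ hξ => sub_left_injective (h2 hξ)⟩
  rw [h.V_eq hvm hvp hup hξ, h'.V_eq hvm hvp hup hξ, hU hξ]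

/-! ### Entropy as a Lyapunov function -/

/-- Entropy minus the conductive entropy flux. -/
noncomputable def gasLyapunov (g : Gas) (up θp : ℝ) (q : ℝ × ℝ) : ℝ :=
  g.R / (g.γ - 1) * Real.log (θp + q.2) + g.R * Real.log (up + q.1)
    - (g.R / (g.γ - 1) * q.2 + g.R * θp / up * q.1 - q.1 ^ 2 / 2) / (θp + q.2)

/-- Entropy production. -/
noncomputable def gasDissipation (g : Gas) (up θp : ℝ) (q : ℝ × ℝ) : ℝ :=
  g.μ * (pertField g up θp q).1 ^ 2 / ((up + q.1) * (θp + q.2))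
    + g.κ * (pertField g up θp q).2 ^ 2 / ((up + q.1) * (θp + q.2) ^ 2)

/-- The energy equation identifies the numerator in `gasLyapunov` with `κ Θ' / U`; written as a
function of the state, it can be differentiated without second derivatives of the solution. The heat
terms of first order in `Θ'` cancel, and squares of `U'` and `Θ'` remain. -/
lemma hasDerivAt_gasLyapunov (hup : 0 < up) {w : ℝ → ℝ × ℝ} {ξ : ℝ}
    (hw : HasDerivAt w (pertField g up θp (w ξ)) ξ) (hU : 0 < up + (w ξ).1)
    (hΘ : 0 < θp + (w ξ).2) :
    HasDerivAt (fun ξ => gasLyapunov g up θp (w ξ)) (gasDissipation g up θp (w ξ)) ξ := by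
  have h1 : HasDerivAt (fun ξ => (w ξ).1) (pertField g up θp (w ξ)).1 ξ := hw.fst
  have h2 : HasDerivAt (fun ξ => (w ξ).2) (pertField g up θp (w ξ)).2 ξ := hw.snd
  have hμ := g.μ_pos
  have hκ := g.κ_pos
  have hγ : 0 < g.γ - 1 := sub_pos.2 g.one_lt_γ
  have hd := ((((h2.const_add θp).log hΘ.ne').const_mul (g.R / (g.γ - 1))).fun_add
    (((h1.const_add up).log hU.ne').const_mul g.R)).fun_sub
    ((((h2.const_mul (g.R / (g.γ - 1))).fun_add (h1.const_mul (g.R * θp / up))).fun_sub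
      ((h1.fun_pow 2).div_const 2)).fun_div (h2.const_add θp) hΘ.ne')
  refine hd.congr_deriv ?_
  unfold gasDissipation
  have e1 := pertField_fst (g := g) (up := up) (θp := θp) (w ξ)
  have e2 := pertField_snd (g := g) (up := up) (θp := θp) (w ξ)
  generalize (pertField g up θp (w ξ)).1 = p₁ at *
  generalize (pertField g up θp (w ξ)).2 = p₂ at *
  generalize (w ξ).1 = x at *
  generalize (w ξ).2 = y at *
  have e1' : (up ^ 2 - g.R * θp) * x + g.R * up * y + up * x ^ 2 = g.μ * up * p₁ := by
    rw [e1]; field_simp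
  have e2' : g.R / (g.γ - 1) * y + g.R * θp / up * x - x ^ 2 / 2 = g.κ * p₂ / (up + x) := by
    rw [e2]; field_simp; ring
  rw [e2']
  -- The momentum equation makes the coefficient of `U'` itself a multiple of `U'`.
  have e3 : g.R / (up + x) - (g.R * θp / up - x) / (θp + y) =
      g.μ * p₁ / ((up + x) * (θp + y)) := by
    field_simp
    linear_combination e1'
  have : g.R * (p₁ / (up + x)) - ((g.R * θp / up) * p₁ - x * p₁) / (θp + y) =
      g.μ * p₁ ^ 2 / ((up + x) * (θp + y)) := by
    calc _ = (g.R / (up + x) - (g.R * θp / up - x) / (θp + y)) * p₁ := by ring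
      _ = _ := by rw [e3]; ring
  rw [← this]
  field_simp
  ring

/-- Trajectories in the physical quadrant that tend to the equilibrium and start near it stay near
it. -/
theorem exists_forall_stay (g : Gas) (hup : 0 < up) (hθp : 0 < θp) {r : ℝ} (hr : 0 < r) :
    ∃ δ, 0 < δ ∧ ∀ w, IsDecayingOrbit (pertField g up θp) w →
      (∀ ξ, 0 ≤ ξ → 0 < up + (w ξ).1) → (∀ ξ, 0 ≤ ξ → 0 < θp + (w ξ).2) →
      sqLen (w 0) ≤ δ ^ 2 → ∀ ξ, 0 ≤ ξ → sqLen (w ξ) < r ^ 2 := by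
  have hμ := g.μ_pos
  have hκ := g.κ_pos
  have hR := g.R_pos
  have hγ : 0 < g.γ - 1 := sub_pos.2 g.one_lt_γ
  -- the second root of the equation for the velocities of equilibria
  obtain ⟨r₀, hr₀, hr₀'⟩ : ∃ r₀, 0 < r₀ ∧ ∀ x : ℝ, |x| < r₀ →
      (g.R * θp / up * (g.γ - 1) - (up - g.R * θp / up) - (x + (g.γ - 1) / 2 * x)) = 0 → x = 0 := by
    set A := g.R * θp / up * (g.γ - 1) - (up - g.R * θp / up) with hA
    by_cases h : A = 0
    · refine ⟨1, one_pos, fun x _ hx => ?_⟩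
      rw [h] at hx
      have : (1 + (g.γ - 1) / 2) * x = 0 := by linarith
      exact (mul_eq_zero.1 this).resolve_left (by positivity)
    · refine ⟨|A| / (1 + (g.γ - 1) / 2), by positivity, fun x hx h0 => ?_⟩
      have h1 : A = (1 + (g.γ - 1) / 2) * x := by linarith
      rw [lt_div_iff₀ (by positivity), h1, abs_mul, abs_of_pos (show 0 < 1 + (g.γ - 1) / 2 by positivity),
        mul_comm] at hx
      exact absurd hx (lt_irrefl _)
  -- The disc of radius `ρ` lies in the physical quadrant and contains no equilibrium besides 0.
  set ρ := min r (min (r₀ / 2) (min (up / 2) (θp / 2))) with hρ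
  have hρ0 : 0 < ρ := by positivity
  have hρr : ρ ≤ r := min_le_left _ _
  have hρ1 : ρ ≤ r₀ / 2 := (min_le_right _ _).trans (min_le_left _ _)
  have hρ2 : ρ ≤ up / 2 := (min_le_right _ _).trans ((min_le_right _ _).trans (min_le_left _ _))
  have hρ3 : ρ ≤ θp / 2 := (min_le_right _ _).trans ((min_le_right _ _).trans (min_le_right _ _))
  have hsm : ∀ q : ℝ × ℝ, sqLen q ≤ ρ ^ 2 → |q.1| ≤ ρ ∧ |q.2| ≤ ρ := by
    intro q hq
    have := abs_le_of_sq_le_sq ((norm_sq_le_sqLen q).trans hq) hρ0.le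
    rw [abs_of_nonneg (norm_nonneg _)] at this
    exact ⟨(norm_fst_le q).trans this, (norm_snd_le q).trans this⟩
  set Ω : Set (ℝ × ℝ) := {q | 0 < up + q.1 ∧ 0 < θp + q.2} with hΩ
  have hpc := (contDiff_pertField g up θp).continuous
  have hNc : ContinuousOn (gasLyapunov g up θp) Ω := by
    unfold gasLyapunov
    have h1 : ContinuousOn (fun q : ℝ × ℝ => Real.log (θp + q.2)) Ω :=
      ContinuousOn.log (by fun_prop) fun q hq => hq.2.ne'
    have h2 : ContinuousOn (fun q : ℝ × ℝ => Real.log (up + q.1)) Ω :=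
      ContinuousOn.log (by fun_prop) fun q hq => hq.1.ne'
    refine ((continuousOn_const.mul h1).add (continuousOn_const.mul h2)).sub ?_
    exact ContinuousOn.div (by fun_prop) (by fun_prop) fun q hq => hq.2.ne'
  have hΩo : IsOpen Ω := by
    exact (isOpen_lt continuous_const (continuous_const.add continuous_fst)).inter
      (isOpen_lt continuous_const (continuous_const.add continuous_snd))
  obtain ⟨δ, hδ, H⟩ := exists_forall_stay_of_lyapunov (f := pertField g up θp) hpc (Ω := Ω)
    (N := gasLyapunov g up θp) (G := gasDissipation g up θp) (r := ρ)
    (hNc.continuousAt (hΩo.mem_nhds (by simp [hΩ, hup, hθp])))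
    (by
      unfold gasDissipation
      refine ContinuousOn.add 
        (ContinuousOn.div (continuous_const.mul (hpc.fst.pow 2)).continuousOn (by fun_prop)
          fun q hq => ?_)
        (ContinuousOn.div (continuous_const.mul (hpc.snd.pow 2)).continuousOn (by fun_prop)
          fun q hq => ?_)
      · exact (mul_pos hq.1 hq.2).ne'
      · exact (mul_pos hq.1 (pow_pos hq.2 2)).ne')
    (by
      rintro q ⟨h1, h2⟩
      unfold gasDissipation
      positivity)
    hρ0
    (by
      intro q hq
      obtain ⟨h1, h2⟩ := hsm q hq
      have := (abs_le.1 h1).1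
      have := (abs_le.1 h2).1
      exact ⟨by linarith, by linarith⟩)
    (by
      intro q hq0 hq
      obtain ⟨h1, h2⟩ := hsm q hq
      have h1' := (abs_le.1 h1).1
      have h2' := (abs_le.1 h2).1
      have hU : 0 < up + q.1 := by linarith
      have hΘ : 0 < θp + q.2 := by linarith
      -- Eliminating the temperature from the two equations for an equilibrium leaves the velocity
      -- times an affine factor. That factor vanishes within `r₀` at most at 0.
      have hne : ¬ ((pertField g up θp q).1 = 0 ∧ (pertField g up θp q).2 = 0) := by
        rintro ⟨e1, e2⟩
        rw [pertField_fst] at e1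
        rw [pertField_snd] at e2
        have hx : |q.1| < r₀ := by linarith
        have e3 : g.R / (g.γ - 1) * q.2 + g.R * θp / up * q.1 - q.1 ^ 2 / 2 = 0 := by
          have : (up + q.1) * (g.R / (g.γ - 1) * q.2 + g.R * θp / up * q.1 - q.1 ^ 2 / 2) =
              g.κ * 0 := by
            rw [← e2]; field_simp; ring
          rw [mul_zero] at this
          exact (mul_eq_zero.1 this).resolve_left hU.ne'
        have e4 : g.R * q.2 = -((up - g.R * θp / up) * q.1 + q.1 ^ 2) := by
          field_simp at e1 ⊢
          linarith
        have e5 : q.1 * (g.R * θp / up * (g.γ - 1) - (up - g.R * θp / up) -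
            (q.1 + (g.γ - 1) / 2 * q.1)) = 0 := by
          have : g.R * q.2 + (g.γ - 1) * (g.R * θp / up * q.1 - q.1 ^ 2 / 2) = 0 := by
            have h := congrArg (fun t => (g.γ - 1) * t) e3
            simp only [mul_zero] at h
            rw [← h]; field_simp; ring
          rw [e4] at this
          linear_combination this
        have hx0 : q.1 = 0 := by
          rcases mul_eq_zero.1 e5 with h | h
          · exact h
          · exact hr₀' _ hx h
        have hy0 : q.2 = 0 := by
          rw [hx0] at e4
          have : g.R * q.2 = 0 := by rw [e4]; ring
          exact (mul_eq_zero.1 this).resolve_left hR.ne'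
        simp [sqLen, hx0, hy0] at hq0
      unfold gasDissipation
      rcases not_and_or.1 hne with h | h
      · have := sq_pos_of_ne_zero h
        positivity
      · have := sq_pos_of_ne_zero h
        positivity)
  refine ⟨δ, hδ, fun w hw hU hΘ h0 ξ hξ => ?_⟩
  have hwΩ : ∀ ξ, 0 ≤ ξ → w ξ ∈ Ω := fun ξ hξ => ⟨hU ξ hξ, hΘ ξ hξ⟩
  have := H w hw.cont hw.ode (hNc.comp hw.cont hwΩ)
    (fun ξ hξ => hasDerivAt_gasLyapunov hup (hw.ode ξ hξ) (hU ξ hξ.le) (hΘ ξ hξ.le)) hwΩ hw.lim h0 ξ hξ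
  nlinarith

end Gas

/-! ### Comparison of decaying orbits by quadratic forms -/

/-- A quadratic form that increases strictly along the linearization is nonpositive on the
difference of any two orbits that decay inside a small ball. -/
theorem exists_quadForm_sub_nonpos {f : ℝ × ℝ → ℝ × ℝ} {J : ℝ × ℝ →L[ℝ] ℝ × ℝ}
    (hf : HasStrictFDerivAt f J 0) {α β ε m : ℝ} (hm : 0 < m)
    (hJ : ∀ v : ℝ × ℝ, m * sqLen v ≤
      α * v.1 * (J v).1 + β * (v.1 * (J v).2 + v.2 * (J v).1) + ε * v.2 * (J v).2) :
    ∃ r, 0 < r ∧ ∀ w w' : ℝ → ℝ × ℝ, IsDecayingOrbit f w → IsDecayingOrbit f w' →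
      (∀ ξ, 0 ≤ ξ → sqLen (w ξ) < r ^ 2) → (∀ ξ, 0 ≤ ξ → sqLen (w' ξ) < r ^ 2) →
      α * (w 0 - w' 0).1 ^ 2 + 2 * β * ((w 0 - w' 0).1 * (w 0 - w' 0).2)
        + ε * (w 0 - w' 0).2 ^ 2 ≤ 0 := by
  -- Strict differentiability makes `f (w) - f (w') - J (w - w')` at most `m / K` times the
  -- difference. Paired with the form, this error costs no more than the gain `m`; the summand 1
  -- keeps `K` positive.
  set K := |α| + 2 * |β| + |ε| + 1 with hK
  have hKpos : 0 < K := by positivity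
  have hlo := (hasStrictFDerivAt_iff_isLittleO.1 hf).bound (show 0 < m / K by positivity)
  rw [Metric.eventually_nhds_iff] at hlo
  obtain ⟨r, hr, hlo⟩ := hlo
  have hsm : ∀ q : ℝ × ℝ, sqLen q < r ^ 2 → ‖q‖ < r := fun q hq =>
    lt_of_pow_lt_pow_left₀ 2 hr.le ((norm_sq_le_sqLen q).trans_lt hq)
  refine ⟨r, hr, fun w w' hw hw' hwr hwr' => ?_⟩
  have hd1 : ∀ ξ, 0 < ξ → HasDerivAt (fun ξ => (w ξ - w' ξ).1) (f (w ξ) - f (w' ξ)).1 ξ :=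
    fun ξ hξ => ((hw.ode ξ hξ).sub (hw'.ode ξ hξ)).fst
  have hd2 : ∀ ξ, 0 < ξ → HasDerivAt (fun ξ => (w ξ - w' ξ).2) (f (w ξ) - f (w' ξ)).2 ξ :=
    fun ξ hξ => ((hw.ode ξ hξ).sub (hw'.ode ξ hξ)).snd
  have hc : ContinuousOn (fun ξ => w ξ - w' ξ) (Ici 0) := hw.cont.sub hw'.cont
  set Q : ℝ × ℝ → ℝ := fun v => α * v.1 ^ 2 + 2 * β * (v.1 * v.2) + ε * v.2 ^ 2 with hQ
  have hQc : Continuous Q := by fun_prop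
  have hmono : MonotoneOn (fun ξ => Q (w ξ - w' ξ)) (Ici 0) := by
    refine monotoneOn_Ici_of_hasDerivAt_nonneg (v' := fun ξ =>
      2 * (α * (w ξ - w' ξ).1 * (f (w ξ) - f (w' ξ)).1
      + β * ((w ξ - w' ξ).1 * (f (w ξ) - f (w' ξ)).2 + (w ξ - w' ξ).2 * (f (w ξ) - f (w' ξ)).1)
      + ε * (w ξ - w' ξ).2 * (f (w ξ) - f (w' ξ)).2)) (hQc.comp_continuousOn hc) ?_ ?_
    · intro ξ hξ
      have h1 := hd1 ξ hξ
      have h2 := hd2 ξ hξ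
      refine ((((h1.fun_pow 2).const_mul α).fun_add ((h1.fun_mul h2).const_mul (2 * β))).fun_add
        ((h2.fun_pow 2).const_mul ε)).congr_deriv ?_
      simp only [Nat.cast_ofNat, Nat.add_one_sub_one, pow_one]
      ring
    · intro ξ hξ
      have h := @hlo (w ξ, w' ξ) (by
        rw [Prod.dist_eq, max_lt_iff]
        exact ⟨by simpa using hsm _ (hwr ξ hξ.le), by simpa using hsm _ (hwr' ξ hξ.le)⟩)
      simp only at h
      set v := w ξ - w' ξ with hv
      set F := f (w ξ) - f (w' ξ) with hF
      have h1 := (norm_fst_le _).trans h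
      have h2 := (norm_snd_le _).trans h
      rw [Real.norm_eq_abs, Prod.fst_sub] at h1
      rw [Real.norm_eq_abs, Prod.snd_sub] at h2
      have hx : |v.1| ≤ ‖v‖ := norm_fst_le v
      have hy : |v.2| ≤ ‖v‖ := norm_snd_le v
      have hJv := hJ v
      have hn := norm_sq_le_sqLen v
      have e : α * v.1 * F.1 + β * (v.1 * F.2 + v.2 * F.1) + ε * v.2 * F.2 =
          (α * v.1 * (J v).1 + β * (v.1 * (J v).2 + v.2 * (J v).1) + ε * v.2 * (J v).2) +
          (α * v.1 * (F.1 - (J v).1) + β * (v.1 * (F.2 - (J v).2) + v.2 * (F.1 - (J v).1))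
            + ε * v.2 * (F.2 - (J v).2)) := by ring
      have hb : ∀ k a c : ℝ, |a| ≤ ‖v‖ → |c| ≤ m / K * ‖v‖ →
          |k * (a * c)| ≤ |k| * (m / K * ‖v‖ ^ 2) := by
        intro k a c ha hc
        rw [abs_mul, abs_mul]
        refine mul_le_mul_of_nonneg_left ?_ (abs_nonneg k)
        calc |a| * |c| ≤ ‖v‖ * (m / K * ‖v‖) := mul_le_mul ha hc (abs_nonneg _) (norm_nonneg _)
          _ = _ := by ring
      have b1 := (abs_le.1 (hb α _ _ hx h1)).1
      have b2 := (abs_le.1 (hb β _ _ hx h2)).1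
      have b3 := (abs_le.1 (hb β _ _ hy h1)).1
      have b4 := (abs_le.1 (hb ε _ _ hy h2)).1
      have hmK : K * (m / K * ‖v‖ ^ 2) = m * ‖v‖ ^ 2 := by field_simp
      have hpos : 0 ≤ m / K * ‖v‖ ^ 2 := by positivity
      have hmn : m * ‖v‖ ^ 2 ≤ m * sqLen v := mul_le_mul_of_nonneg_left hn hm.le
      rw [e]
      have hKe : K * (m / K * ‖v‖ ^ 2) = |α| * (m / K * ‖v‖ ^ 2) + 2 * (|β| * (m / K * ‖v‖ ^ 2))
        + |ε| * (m / K * ‖v‖ ^ 2) + m / K * ‖v‖ ^ 2 := by rw [hK]; ring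
      linarith
  have hlim : Tendsto (fun ξ => Q (w ξ - w' ξ)) atTop (𝓝 0) := by
    have h1 : Tendsto (fun ξ => w ξ - w' ξ) atTop (𝓝 (0 - 0)) := hw.lim.sub hw'.lim
    have h2 := (hQc.tendsto (0 - 0)).comp h1
    simpa [hQ, Function.comp_def] using h2
  exact monotoneOn_le_of_tendsto hmono hlim le_rfl

/-- A positive definite binary quadratic form dominates a multiple of the squared length. -/
lemma posDef_lower_bound {A B D : ℝ} (hA : 0 < A) (hdet : B ^ 2 < A * D) :
    ∃ m, 0 < m ∧ ∀ x y : ℝ, m * (x ^ 2 + y ^ 2) ≤ A * x ^ 2 + 2 * B * (x * y) + D * y ^ 2 := by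
  have hD : 0 < D := by
    by_contra! h
    nlinarith [sq_nonneg B]
  have hAD : 0 < A + D := by positivity
  refine ⟨(A * D - B ^ 2) / (A + D), div_pos (by linarith) hAD, fun x y => ?_⟩
  rw [div_mul_eq_mul_div, div_le_iff₀ hAD]
  nlinarith [sq_nonneg (A * x + B * y), sq_nonneg (B * x + D * y)]

/-- Backward uniqueness on the open half line, then continuity at 0. It carries information on the
late, small part of an orbit back to its initial point. -/
lemma IsDecayingOrbit.zero_of_eq_zero {f : ℝ × ℝ → ℝ × ℝ} (hf : LocallyLipschitz f) (hf0 : f 0 = 0)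
    {w : ℝ → ℝ × ℝ} (hw : IsDecayingOrbit f w) {t : ℝ} (ht : 0 ≤ t) (h0 : w t = 0) : w 0 = 0 := by
  rcases ht.eq_or_lt with rfl | ht
  · exact h0
  have h1 : EqOn w (fun _ => 0) (Ioi 0) :=
    eqOn_Ioi_of_ode hf ht hw.ode (fun ξ _ => by simpa [hf0] using hasDerivAt_const ξ (0 : ℝ × ℝ)) h0
  have h2 : Tendsto w (𝓝[>] 0) (𝓝 (w 0)) :=
    (hw.cont 0 self_mem_Ici).mono Ioi_subset_Ici_self
  refine tendsto_nhds_unique h2 (tendsto_const_nhds.congr' ?_)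
  filter_upwards [self_mem_nhdsWithin] with ξ hξ using (h1 hξ).symm

lemma IsDecayingOrbit.eventually_sqLen_lt {f : ℝ × ℝ → ℝ × ℝ} {w : ℝ → ℝ × ℝ}
    (hw : IsDecayingOrbit f w) {r : ℝ} (hr : 0 < r) :
    ∃ t, 0 ≤ t ∧ ∀ ξ, 0 ≤ ξ → sqLen (w (ξ + t)) < r ^ 2 := by
  have h1 : Tendsto (fun ξ => sqLen (w ξ)) atTop (𝓝 0) := by
    have := (continuous_sqLen.tendsto 0).comp hw.lim
    simpa [sqLen, Function.comp_def] using this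
  obtain ⟨t, ht⟩ := eventually_atTop.1 (h1.eventually_lt_const (show 0 < r ^ 2 by positivity))
  exact ⟨max t 0, le_max_right _ _, fun ξ hξ =>
    ht _ (by linarith [le_max_left t 0])⟩

/-! ### Linearization, and the supersonic case -/

section Gas

variable {g : Gas} {up θp : ℝ}

/-- The linear part of the perturbation field. -/
noncomputable def pertLin (g : Gas) (up θp : ℝ) : ℝ × ℝ →L[ℝ] ℝ × ℝ :=
  (((up ^ 2 - g.R * θp) / (g.μ * up)) • ContinuousLinearMap.fst ℝ ℝ ℝ
      + (g.R / g.μ) • ContinuousLinearMap.snd ℝ ℝ ℝ).prod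
    ((g.R * θp / g.κ) • ContinuousLinearMap.fst ℝ ℝ ℝ
      + (g.R * up / (g.κ * (g.γ - 1))) • ContinuousLinearMap.snd ℝ ℝ ℝ)

lemma pertLin_fst (v : ℝ × ℝ) : (pertLin g up θp v).1 =
    (up ^ 2 - g.R * θp) / (g.μ * up) * v.1 + g.R / g.μ * v.2 := rfl

lemma pertLin_snd (v : ℝ × ℝ) : (pertLin g up θp v).2 =
    g.R * θp / g.κ * v.1 + g.R * up / (g.κ * (g.γ - 1)) * v.2 := rfl

lemma hasStrictFDerivAt_pertField (g : Gas) (up θp : ℝ) :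
    HasStrictFDerivAt (pertField g up θp) (pertLin g up θp) 0 := by
  have h := (contDiff_pertField g up θp).contDiffAt.hasStrictFDerivAt (x := 0) (by simp)
  suffices fderiv ℝ (pertField g up θp) 0 = pertLin g up θp by rwa [this] at h
  refine HasFDerivAt.fderiv ?_
  have h1 : HasFDerivAt (fun q : ℝ × ℝ => q.1) (ContinuousLinearMap.fst ℝ ℝ ℝ) (0 : ℝ × ℝ) :=
    hasFDerivAt_fst
  have h2 : HasFDerivAt (fun q : ℝ × ℝ => q.2) (ContinuousLinearMap.snd ℝ ℝ ℝ) (0 : ℝ × ℝ) :=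
    hasFDerivAt_snd
  have hX := ((h1.const_mul ((up ^ 2 - g.R * θp) / (g.μ * up))).fun_add
    (h2.const_mul (g.R / g.μ))).fun_add ((HasFDerivAt.pow h1 2).const_mul (1 / g.μ))
  have hY := ((h1.const_mul (g.R * θp / g.κ)).fun_add
    (h2.const_mul (g.R * up / (g.κ * (g.γ - 1))))).fun_add
    ((((HasFDerivAt.pow h1 2).const_mul (g.R * θp / (g.κ * up) - up / (2 * g.κ))).fun_add
    ((h1.const_mul (g.R / (g.κ * (g.γ - 1)))).fun_mul h2)).fun_sub
    ((HasFDerivAt.pow h1 3).const_mul (1 / (2 * g.κ))))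
  have hXY := hX.prodMk hY
  refine (hXY.congr_of_eventuallyEq (.of_forall fun q => ?_)).congr_fderiv ?_
  · exact Prod.ext (pertField_fst q) (pertField_snd q)
  · unfold pertLin
    simp

lemma mach_sq (g : Gas) (hθp : 0 < θp) :
    mach g up θp ^ 2 = up ^ 2 / (g.R * g.γ * θp) := by
  have hR := g.R_pos
  have hγ : 0 < g.γ := one_pos.trans g.one_lt_γ
  rw [mach, div_pow, sq_abs, Real.sq_sqrt (by positivity)]

/-- Around a supersonic state only the constant orbit decays. -/
theorem IsDecayingOrbit.eq_zero_of_supersonic (hup : 0 < up) (hθp : 0 < θp)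
    (hM : 1 < mach g up θp) {w : ℝ → ℝ × ℝ} (hw : IsDecayingOrbit (pertField g up θp) w) :
    w 0 = 0 := by
  have hμ := g.μ_pos
  have hκ := g.κ_pos
  have hR := g.R_pos
  have hγ : 0 < g.γ - 1 := sub_pos.2 g.one_lt_γ
  have hγ' : 0 < g.γ := one_pos.trans g.one_lt_γ
  have hM2 : g.R * g.γ * θp < up ^ 2 := by
    have h1 : 1 < mach g up θp ^ 2 := by nlinarith
    rwa [mach_sq g hθp, one_lt_div (by positivity)] at h1
  have hM1 : 0 < up ^ 2 - g.R * θp := by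
    have : 0 < g.R * θp * (g.γ - 1) := by positivity
    linarith
  -- J is symmetric for the inner product whose weights are its two off-diagonal entries, in reverse
  -- order. The resulting form has positive diagonal, and its determinant is a positive multiple of
  -- `up² - R γ θp`.
  obtain ⟨m, hm, hmq⟩ := posDef_lower_bound
    (A := g.R * θp / g.κ * ((up ^ 2 - g.R * θp) / (g.μ * up)))
    (B := g.R / g.μ * (g.R * θp / g.κ)) (D := g.R / g.μ * (g.R * up / (g.κ * (g.γ - 1))))
    (by positivity) (by
      rw [← sub_pos]
      have : g.R * θp / g.κ * ((up ^ 2 - g.R * θp) / (g.μ * up)) *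
          (g.R / g.μ * (g.R * up / (g.κ * (g.γ - 1)))) - (g.R / g.μ * (g.R * θp / g.κ)) ^ 2 =
          g.R ^ 3 * θp / (g.κ ^ 2 * g.μ ^ 2 * (g.γ - 1)) * (up ^ 2 - g.R * g.γ * θp) := by
        field_simp
        ring
      rw [this]
      have := sub_pos.2 hM2
      positivity)
  obtain ⟨r, hr, H⟩ := exists_quadForm_sub_nonpos (hasStrictFDerivAt_pertField g up θp)
    (α := g.R * θp / g.κ) (β := 0) (ε := g.R / g.μ) hm (fun v => by
      have := hmq v.1 v.2
      rw [pertLin_fst, pertLin_snd]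
      unfold sqLen
      linarith)
  -- Only the late part of the orbit has to be small; it is compared with the constant orbit. Hence
  -- no smallness of the data enters.
  obtain ⟨t, ht, htr⟩ := hw.eventually_sqLen_lt hr
  have hz : IsDecayingOrbit (pertField g up θp) (fun _ => 0) :=
    ⟨continuousOn_const, fun ξ _ => by rw [pertField_zero]; exact hasDerivAt_const ξ _, tendsto_const_nhds⟩
  have := H _ _ (hw.shift ht) hz htr (fun ξ _ => by simp [sqLen]; positivity)
  simp only [zero_add, sub_zero, mul_zero, zero_mul, add_zero] at this
  refine hw.zero_of_eq_zero (locallyLipschitz_pertField g up θp) (pertField_zero g up θp) ht ?_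
  have hb : 0 < g.R / g.μ := by positivity
  have hc : 0 < g.R * θp / g.κ := by positivity
  have h1 : 0 ≤ g.R * θp / g.κ * (w t).1 ^ 2 := by positivity
  have h2 : 0 ≤ g.R / g.μ * (w t).2 ^ 2 := by positivity
  have h3 : g.R * θp / g.κ * (w t).1 ^ 2 = 0 := by linarith
  have h4 : g.R / g.μ * (w t).2 ^ 2 = 0 := by linarith
  exact Prod.ext (by simpa [hc.ne'] using h3) (by simpa [hb.ne'] using h4)

/-- Absence of solutions follows from absence of orbits. -/
lemma noSolution_of_orbit {vm um θm vp : ℝ} (hvm : 0 < vm) (hum : 0 < um) (hvp : 0 < vp)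
    (H : um / vm = up / vp → ¬ ∃ w, IsDecayingOrbit (pertField g up θp) w ∧
      w 0 = (um - up, θm - θp)) : NoSolution g vm um θm vp up θp := by
  have key : ¬ ∃ X Y : ℝ → ℝ, IsPertSolution g vm um θm vp up θp X Y := by
    rintro ⟨X, Y, h⟩
    exact H h.flux ⟨_, h.orbit, by simp [h.X_zero, h.Y_zero]⟩
  refine ⟨?_, key⟩
  rintro ⟨V, U, Θ, h⟩
  exact key ⟨_, _, h.isPertSolution hvm hum hvp⟩

end Gas

/-! ### Convolution estimates and convergence of power series -/

section PowerSeries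

/-- Convolution of sequences. -/
def seqConv (u v : ℕ → ℝ) (n : ℕ) : ℝ := ∑ ij ∈ Finset.HasAntidiagonal.antidiagonal n, u ij.1 * v ij.2

/-- A term with one index equal to `n` has the other equal to 0 and vanishes, so only lower
coefficients enter. This makes the recursion for the invariant curve explicit. -/
lemma seqConv_congr {u u' v v' : ℕ → ℝ} {n : ℕ} (hu : ∀ i < n, u i = u' i)
    (hv : ∀ i < n, v i = v' i) (hu0 : u 0 = 0) (hu0' : u' 0 = 0) (hv0 : v 0 = 0)
    (hv0' : v' 0 = 0) : seqConv u v n = seqConv u' v' n := by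
  refine Finset.sum_congr rfl fun ij hij => ?_
  have h := Finset.HasAntidiagonal.mem_antidiagonal.1 hij
  rcases Nat.eq_zero_or_pos ij.1 with h1 | h1
  · rw [h1, hu0, hu0', zero_mul, zero_mul]
  · rcases Nat.eq_zero_or_pos ij.2 with h2 | h2
    · rw [h2, hv0, hv0', mul_zero, mul_zero]
    · rw [hu _ (by omega), hv _ (by omega)]

lemma seqConv_zero {u v : ℕ → ℝ} (hu0 : u 0 = 0) : seqConv u v 0 = 0 := by
  simp [seqConv, hu0]

lemma seqConv_one {u v : ℕ → ℝ} (hu0 : u 0 = 0) (hv0 : v 0 = 0) : seqConv u v 1 = 0 := by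
  simp [seqConv, Finset.Nat.antidiagonal_succ, hu0, hv0]

lemma sum_range_inv_sq_le (n : ℕ) :
    ∑ i ∈ Finset.range (n + 1), (1 : ℝ) / ((i : ℝ) + 1) ^ 2 ≤ 2 := by
  have : ∑ i ∈ Finset.range (n + 1), (1 : ℝ) / ((i : ℝ) + 1) ^ 2 ≤ 2 - 1 / ((n : ℝ) + 1) := by
    induction n with
    | zero => norm_num
    | succ n ih =>
      rw [Finset.sum_range_succ]
      push_cast
      have h : (1 : ℝ) / ((n : ℝ) + 1 + 1) ^ 2 ≤ 1 / ((n : ℝ) + 1) - 1 / ((n : ℝ) + 1 + 1) := by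
        rw [div_sub_div _ _ (by positivity) (by positivity), div_le_div_iff₀ (by positivity) (by positivity)]
        nlinarith [(Nat.cast_nonneg n : (0 : ℝ) ≤ n)]
      linarith
  have h2 : (0 : ℝ) < 1 / ((n : ℝ) + 1) := by positivity
  linarith

/-- Since `n + 1 ≤ (i + 1) + (j + 1)`, each product is at most `2 / (n + 1)²` times the sum of its
two factors, and each factor sums to at most 2. The weight `1 / (n + 1)²` thus reproduces itself
under convolution, which the plain geometric weight does not. -/
lemma seqConv_inv_sq_le (n : ℕ) :
    ∑ ij ∈ Finset.HasAntidiagonal.antidiagonal n, (1 : ℝ) / ((ij.1 : ℝ) + 1) ^ 2 * (1 / ((ij.2 : ℝ) + 1) ^ 2) ≤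
      8 / ((n : ℝ) + 1) ^ 2 := by
  have h1 : ∀ ij ∈ Finset.HasAntidiagonal.antidiagonal n, (1 : ℝ) / ((ij.1 : ℝ) + 1) ^ 2 * (1 / ((ij.2 : ℝ) + 1) ^ 2)
      ≤ 2 / ((n : ℝ) + 1) ^ 2 * (1 / ((ij.1 : ℝ) + 1) ^ 2 + 1 / ((ij.2 : ℝ) + 1) ^ 2) := by
    intro ij hij
    have h : (ij.1 : ℝ) + ij.2 = n := by exact_mod_cast Finset.HasAntidiagonal.mem_antidiagonal.1 hij
    rw [← h]
    have hi : (0 : ℝ) ≤ ij.1 := Nat.cast_nonneg _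
    have hj : (0 : ℝ) ≤ ij.2 := Nat.cast_nonneg _
    generalize (ij.1 : ℝ) = i at *
    generalize (ij.2 : ℝ) = j at *
    rw [div_add_div _ _ (by positivity) (by positivity), div_mul_div_comm, div_mul_div_comm,
      div_le_div_iff₀ (by positivity) (by positivity)]
    have : (i + j + 1) ^ 2 ≤ 2 * ((j + 1) ^ 2 + (i + 1) ^ 2) := by nlinarith [sq_nonneg (i - j)]
    have hp : 0 ≤ (i + 1) ^ 2 * (j + 1) ^ 2 := by positivity
    nlinarith [mul_le_mul_of_nonneg_left this hp]
  refine (Finset.sum_le_sum h1).trans ?_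
  rw [← Finset.mul_sum, Finset.sum_add_distrib,
    Finset.Nat.sum_antidiagonal_eq_sum_range_succ (fun i _ => (1 : ℝ) / ((i : ℝ) + 1) ^ 2),
    ← Finset.Nat.sum_antidiagonal_swap,
    show (∑ p ∈ Finset.HasAntidiagonal.antidiagonal n, (1 : ℝ) / ((p.swap.2 : ℝ) + 1) ^ 2) =
      ∑ p ∈ Finset.HasAntidiagonal.antidiagonal n, (1 : ℝ) / ((p.1 : ℝ) + 1) ^ 2 from rfl,
    Finset.Nat.sum_antidiagonal_eq_sum_range_succ (fun i _ => (1 : ℝ) / ((i : ℝ) + 1) ^ 2)]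
  have := sum_range_inv_sq_le n
  calc _ ≤ 2 / ((n : ℝ) + 1) ^ 2 * (2 + 2) := by gcongr
    _ = _ := by ring

lemma abs_seqConv_le {u v : ℕ → ℝ} {A B ρ : ℝ} (hA : 0 ≤ A) (hρ : 0 ≤ ρ) {n : ℕ}
    (hu : ∀ i ≤ n, |u i| ≤ A * (ρ ^ i / ((i : ℝ) + 1) ^ 2))
    (hv : ∀ i ≤ n, |v i| ≤ B * (ρ ^ i / ((i : ℝ) + 1) ^ 2)) :
    |seqConv u v n| ≤ 8 * A * B * (ρ ^ n / ((n : ℝ) + 1) ^ 2) := by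
  have hB : 0 ≤ B := by
    have := (abs_nonneg _).trans (hv 0 (Nat.zero_le _))
    simpa using this
  calc |seqConv u v n|
      ≤ ∑ ij ∈ Finset.HasAntidiagonal.antidiagonal n, A * B * ρ ^ n *
          ((1 : ℝ) / ((ij.1 : ℝ) + 1) ^ 2 * (1 / ((ij.2 : ℝ) + 1) ^ 2)) := by
        refine (Finset.abs_sum_le_sum_abs _ _).trans (Finset.sum_le_sum fun ij hij => ?_)
        have h := Finset.HasAntidiagonal.mem_antidiagonal.1 hij
        rw [abs_mul]
        calc |u ij.1| * |v ij.2| ≤ (A * (ρ ^ ij.1 / ((ij.1 : ℝ) + 1) ^ 2)) *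
              (B * (ρ ^ ij.2 / ((ij.2 : ℝ) + 1) ^ 2)) :=
              mul_le_mul (hu _ (by omega)) (hv _ (by omega)) (abs_nonneg _) (by positivity)
          _ = _ := by rw [← h, pow_add]; ring
    _ = A * B * ρ ^ n * ∑ ij ∈ Finset.HasAntidiagonal.antidiagonal n,
          ((1 : ℝ) / ((ij.1 : ℝ) + 1) ^ 2 * (1 / ((ij.2 : ℝ) + 1) ^ 2)) := by rw [Finset.mul_sum]
    _ ≤ A * B * ρ ^ n * (8 / ((n : ℝ) + 1) ^ 2) := by
        gcongr
        exact seqConv_inv_sq_le n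
    _ = _ := by ring

lemma powerSeries_contDiffOn {w : ℕ → ℝ} {A r : ℝ} (hr : 0 < r) (hw : ∀ n, |w n| * r ^ n ≤ A) :
    ContDiffOn ℝ ∞ (fun z => ∑' n, w n * z ^ n) (Ioo (-r) r) := by
  set p := FormalMultilinearSeries.ofScalars ℝ w with hp
  have hrad : (r.toNNReal : ENNReal) ≤ p.radius := by
    refine p.le_radius_of_bound A fun n => ?_
    rw [hp, FormalMultilinearSeries.ofScalars_norm, Real.norm_eq_abs, Real.coe_toNNReal _ hr.le]
    exact hw n
  have hrp : 0 < p.radius := lt_of_lt_of_le (by simpa using hr) hrad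
  have h1 := (p.hasFPowerSeriesOnBall hrp).analyticOnNhd
  have h2 : ContDiffOn ℝ ∞ p.sum (Ioo (-r) r) := by
    intro z hz
    refine (h1 z ?_).contDiffAt.contDiffWithinAt
    rw [Metric.mem_eball, edist_zero_right]
    refine lt_of_lt_of_le ?_ hrad
    rw [← ofReal_norm, ENNReal.ofReal]
    exact_mod_cast (Real.toNNReal_lt_toNNReal_iff hr).2 (abs_lt.2 hz)
  refine h2.congr fun z _ => ?_
  have := FormalMultilinearSeries.ofScalars_sum_eq w z
  simp only [smul_eq_mul] at this
  exact this.symm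

/-- On this interval, half of what the bound guarantees, the series and its termwise derivative are
dominated by series of ratio `1 / 2`. -/
lemma powerSeries_regular {w : ℕ → ℝ} {A ρ : ℝ} (hρ : 0 < ρ) (hw : ∀ n, |w n| ≤ A * ρ ^ n) :
    ContDiffOn ℝ ∞ (fun z => ∑' n, w n * z ^ n) (Ioo (-(1 / (2 * ρ))) (1 / (2 * ρ))) ∧
    ∀ z ∈ Ioo (-(1 / (2 * ρ))) (1 / (2 * ρ)),
      HasDerivAt (fun z => ∑' n, w n * z ^ n) (∑' n, w n * (n * z ^ (n - 1))) z ∧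
      Summable (fun n => ‖w n * z ^ n‖) ∧ Summable (fun n => w n * (n * z ^ (n - 1))) := by
  have hA : 0 ≤ A := by simpa using (abs_nonneg _).trans (hw 0)
  set r := 1 / (2 * ρ) with hr
  have hr0 : 0 < r := by positivity
  have hρr : ρ * r = 1 / 2 := by rw [hr]; field_simp
  have habs : ∀ z ∈ Ioo (-r) r, |z| ≤ r := fun z hz => (abs_lt.2 hz).le
  have hsum : ∀ z ∈ Ioo (-r) r, Summable (fun n => ‖w n * z ^ n‖) := by
    intro z hz
    refine Summable.of_nonneg_of_le (fun _ => norm_nonneg _) (fun n => ?_)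
      ((summable_geometric_of_lt_one (r := 1 / 2) (by norm_num) (by norm_num)).mul_left A)
    rw [norm_mul, norm_pow, Real.norm_eq_abs, Real.norm_eq_abs]
    calc |w n| * |z| ^ n ≤ (A * ρ ^ n) * r ^ n := by
          gcongr
          · exact hw n
          · exact habs z hz
      _ = A * (1 / 2) ^ n := by rw [mul_assoc, ← mul_pow, hρr]
  have hbd : ∀ n, ∀ z ∈ Ioo (-r) r,
      ‖w n * (n * z ^ (n - 1))‖ ≤ A * 2 * ρ * ((n : ℝ) ^ 1 * (1 / 2) ^ n) := by
    intro n z hz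
    rw [norm_mul, norm_mul, norm_pow, Real.norm_eq_abs, Real.norm_eq_abs, Real.norm_eq_abs,
      Nat.abs_cast]
    rcases n with _ | n
    · simp
    · rw [Nat.add_sub_cancel]
      calc |w (n + 1)| * (((n + 1 : ℕ) : ℝ) * |z| ^ n)
          ≤ (A * ρ ^ (n + 1)) * (((n + 1 : ℕ) : ℝ) * r ^ n) := by
            gcongr
            · exact hw _
            · exact habs z hz
        _ = A * ρ * ((n + 1 : ℕ) : ℝ) * (ρ * r) ^ n := by rw [mul_pow]; ring
        _ = _ := by rw [hρr]; ring
  have hgeo : Summable fun n : ℕ => (n : ℝ) ^ 1 * (1 / 2 : ℝ) ^ n :=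
    summable_pow_mul_geometric_of_norm_lt_one (R := ℝ) 1 (r := 1 / 2) (by norm_num)
  have hU : Summable fun n : ℕ => A * 2 * ρ * ((n : ℝ) ^ 1 * (1 / 2) ^ n) :=
    hgeo.mul_left _
  refine ⟨?_, fun z hz => ⟨?_, hsum z hz, ?_⟩⟩
  · refine powerSeries_contDiffOn (A := A) hr0 fun n => ?_
    calc |w n| * r ^ n ≤ (A * ρ ^ n) * r ^ n := by gcongr; exact hw n
      _ = A * (1 / 2) ^ n := by rw [mul_assoc, ← mul_pow, hρr]
      _ ≤ A * 1 := by gcongr; exact pow_le_one₀ (by norm_num) (by norm_num)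
      _ = A := mul_one A
  · exact hasDerivAt_tsum_of_isPreconnected hU isOpen_Ioo isPreconnected_Ioo
      (fun n y _ => (hasDerivAt_pow n y).const_mul (w n)) hbd (y₀ := z) hz (hsum z hz).of_norm hz
  · exact Summable.of_norm_bounded hU fun n => hbd n z hz

end PowerSeries

/-! ### The analytic invariant curve -/

section PowerSeries

/-- A strongly causal map on sequences has a fixed point. -/
lemma exists_fixedPoint_of_causal {α : Type*} [Zero α] (Φ : (ℕ → α) → ℕ → α)
    (hΦ : ∀ u v : ℕ → α, ∀ n, (∀ i < n, u i = v i) → Φ u n = Φ v n) :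
    ∃ w : ℕ → α, ∀ n, w n = Φ w n := by
  let F : ∀ n : ℕ, (∀ i, i < n → α) → α := fun n rec => Φ (fun i => if h : i < n then rec i h else 0) n
  let w : ℕ → α := fun n => WellFounded.fix (C := fun _ => α) Nat.lt_wfRel.wf F n
  refine ⟨w, fun n => ?_⟩
  have h : w n = F n (fun i _ => w i) := WellFounded.fix_eq _ _ _
  rw [h]
  exact hΦ _ _ _ fun i hi => by simp [hi]

/-- The stable curve of a planar polynomial vector field, parametrized so that the motion along it
is `z' = l z`. The nonresonance condition is on the determinants of `n l - J`, `n ≥ 2`. -/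
theorem exists_invariant_curve {a b c d p α β η l K e₁ e₂ : ℝ} (hK : 0 < K)
    (hD : ∀ n : ℕ, 2 ≤ n → (n * l - a) * (n * l - d) - b * c ≠ 0 ∧
      |n * l - a| + |b| + |c| + |n * l - d| ≤ K * |(n * l - a) * (n * l - d) - b * c|)
    (he₁ : a * e₁ + b * e₂ = l * e₁) (he₂ : c * e₁ + d * e₂ = l * e₂) :
    ∃ (r : ℝ) (X Y X' Y' : ℝ → ℝ), 0 < r ∧ ContDiffOn ℝ ∞ X (Ioo (-r) r) ∧
      ContDiffOn ℝ ∞ Y (Ioo (-r) r) ∧ X 0 = 0 ∧ Y 0 = 0 ∧ X' 0 = e₁ ∧ Y' 0 = e₂ ∧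
      ∀ z ∈ Ioo (-r) r, HasDerivAt X (X' z) z ∧ HasDerivAt Y (Y' z) z ∧
        l * z * X' z = a * X z + b * Y z + p * X z ^ 2 ∧
        l * z * Y' z = c * X z + d * Y z + (α * X z ^ 2 + β * X z * Y z + η * X z ^ 3) := by
  let N₁ : (ℕ → ℝ × ℝ) → ℕ → ℝ := fun w n =>
    p * seqConv (fun i => (w i).1) (fun i => (w i).1) n
  let N₂ : (ℕ → ℝ × ℝ) → ℕ → ℝ := fun w n =>
    α * seqConv (fun i => (w i).1) (fun i => (w i).1) n
    + β * seqConv (fun i => (w i).1) (fun i => (w i).2) n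
    + η * seqConv (seqConv (fun i => (w i).1) (fun i => (w i).1)) (fun i => (w i).1) n
  let D : ℕ → ℝ := fun n => (n * l - a) * (n * l - d) - b * c
  let tr : ℕ → (ℕ → ℝ × ℝ) → ℕ → ℝ × ℝ := fun n w i => if i < n ∧ i ≠ 0 then w i else 0
  -- Comparing coefficients in `l z W' = f(W)` gives `(n l - J) wₙ` as a polynomial in lower
  -- coefficients, solved here by Cramer's rule. At `n = 1` this system is singular in the
  -- nontrivial case, and the eigenvector is prescribed instead. The truncation `tr` makes the
  -- dependence on lower indices literal.
  let Φ : (ℕ → ℝ × ℝ) → ℕ → ℝ × ℝ := fun w n =>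
    if n = 0 then 0 else if n = 1 then (e₁, e₂) else
      (((n * l - d) * N₁ (tr n w) n + b * N₂ (tr n w) n) / D n,
       (c * N₁ (tr n w) n + (n * l - a) * N₂ (tr n w) n) / D n)
  obtain ⟨w, hw⟩ := exists_fixedPoint_of_causal Φ (by
    intro u v n h
    have : tr n u = tr n v := by
      funext i
      simp only [tr]
      split_ifs with hi
      · exact h i hi.1
      · rfl
    simp only [Φ, this])
  have hw0 : w 0 = 0 := by rw [hw]; simp [Φ]
  have hw1 : w 1 = (e₁, e₂) := by rw [hw]; simp [Φ]
  have htr : ∀ n i, i < n → tr n w i = w i := by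
    intro n i hi
    simp only [tr]
    split_ifs with h
    · rfl
    · have : i = 0 := by by_contra h0; exact h ⟨hi, h0⟩
      rw [this, hw0]
  have htr0 : ∀ n, tr n w 0 = 0 := fun n => by simp [tr]
  have htrn : ∀ n i, n ≤ i → tr n w i = 0 := fun n i h => by
    simp only [tr]
    rw [if_neg (by omega)]
  have hN₁ : ∀ n, N₁ (tr n w) n = N₁ w n := fun n => by
    simp only [N₁]
    rw [seqConv_congr (fun i hi => by rw [htr n i hi]) (fun i hi => by rw [htr n i hi])
      (by simp [htr0]) (by simp [hw0]) (by simp [htr0]) (by simp [hw0])]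
  have hN₂ : ∀ n, N₂ (tr n w) n = N₂ w n := fun n => by
    simp only [N₂]
    rw [seqConv_congr (u := fun i => (tr n w i).1) (v := fun i => (tr n w i).1)
        (u' := fun i => (w i).1) (v' := fun i => (w i).1)
        (fun i hi => by rw [htr n i hi]) (fun i hi => by rw [htr n i hi])
        (by simp [htr0]) (by simp [hw0]) (by simp [htr0]) (by simp [hw0]),
      seqConv_congr (u := fun i => (tr n w i).1) (v := fun i => (tr n w i).2)
        (u' := fun i => (w i).1) (v' := fun i => (w i).2)
        (fun i hi => by rw [htr n i hi]) (fun i hi => by rw [htr n i hi])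
        (by simp [htr0]) (by simp [hw0]) (by simp [htr0]) (by simp [hw0]),
      seqConv_congr (u := seqConv (fun i => (tr n w i).1) (fun i => (tr n w i).1))
        (u' := seqConv (fun i => (w i).1) (fun i => (w i).1))
        (v := fun i => (tr n w i).1) (v' := fun i => (w i).1)
        (fun i hi => seqConv_congr (fun j hj => by rw [htr n j (hj.trans hi)])
          (fun j hj => by rw [htr n j (hj.trans hi)])
          (by simp [htr0]) (by simp [hw0]) (by simp [htr0]) (by simp [hw0]))
        (fun i hi => by rw [htr n i hi])
        (seqConv_zero (by simp [htr0])) (seqConv_zero (by simp [hw0])) (by simp [htr0])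
        (by simp [hw0])]
  -- the recursion, in implicit form
  have hrec : ∀ n : ℕ, n * l * (w n).1 = a * (w n).1 + b * (w n).2 + N₁ w n ∧
      n * l * (w n).2 = c * (w n).1 + d * (w n).2 + N₂ w n := by
    intro n
    rcases n with _ | _ | n
    · simp [hw0, N₁, N₂, seqConv_zero]
    · have h1 : N₁ w 1 = 0 := by simp [N₁, seqConv_one, hw0]
      have h2 : N₂ w 1 = 0 := by simp [N₂, seqConv_one, seqConv_zero, hw0]
      rw [zero_add, h1, h2, hw1]
      constructor <;> push_cast <;> linarith
    · have hD0 : D (n + 2) ≠ 0 := (hD (n + 2) (by omega)).1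
      have h := hw (n + 2)
      simp only [Φ, hN₁, hN₂] at h
      rw [if_neg (by omega), if_neg (by omega)] at h
      have e1 : (w (n + 2)).1 * D (n + 2) =
          ((n + 2 : ℕ) * l - d) * N₁ w (n + 2) + b * N₂ w (n + 2) := by
        rw [h]; field_simp
      have e2 : (w (n + 2)).2 * D (n + 2) =
          c * N₁ w (n + 2) + ((n + 2 : ℕ) * l - a) * N₂ w (n + 2) := by
        rw [h]; field_simp
      rw [show n + 1 + 1 = n + 2 from rfl]
      generalize (w (n + 2)).1 = x at *
      generalize (w (n + 2)).2 = y at *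
      generalize hm : ((n + 2 : ℕ) : ℝ) = m at *
      have hDm : D (n + 2) = (m * l - a) * (m * l - d) - b * c := by simp only [D]; rw [hm]
      constructor
      · refine mul_right_cancel₀ hD0 ?_
        linear_combination (m * l - a) * e1 - b * e2 + N₁ w (n + 2) * (-hDm)
      · refine mul_right_cancel₀ hD0 ?_
        linear_combination (m * l - d) * e2 - c * e1 + N₂ w (n + 2) * (-hDm)
  -- the majorant
  set T := 8 * |p| + (8 * |α| + 8 * |β| + 64 * |η|) with hT
  have hT0 : 0 ≤ T := by positivity
  -- The nonlinear terms carry `A²` (the cubic one after `A ≤ 1`), and solving for the coefficient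
  -- costs `K`. So `K T A ≤ 1` returns the bound with constant `A` at the next order.
  set A := 1 / (K * T + 1) with hA
  have hA0 : 0 < A := by positivity
  have hA1 : A ≤ 1 := by rw [hA, div_le_one (by positivity)]; nlinarith [mul_nonneg hK.le hT0]
  have hKTA : K * T * A ≤ 1 := by
    rw [hA, mul_one_div, div_le_one (by positivity)]; linarith
  -- Chosen so that the majorant at `n = 1`, which is `A ρ / 4`, equals `|e₁| + |e₂| + 1`.
  set ρ := 4 * (|e₁| + |e₂| + 1) / A with hρ
  have hρ0 : 0 < ρ := by positivity
  have hbound : ∀ n, |(w n).1| ≤ A * (ρ ^ n / ((n : ℝ) + 1) ^ 2) ∧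
      |(w n).2| ≤ A * (ρ ^ n / ((n : ℝ) + 1) ^ 2) := by
    intro n
    induction n using Nat.strong_induction_on with
    | _ n ih =>
    rcases n with _ | _ | n
    · simp [hw0, hA0.le]
    · have : A * (ρ ^ (0 + 1) / (((0 + 1 : ℕ) : ℝ) + 1) ^ 2) = |e₁| + |e₂| + 1 := by
        rw [hρ]; push_cast; rw [pow_one]; field_simp; norm_num
      rw [this, zero_add, hw1]
      have h1 := abs_nonneg e₁
      have h2 := abs_nonneg e₂
      constructor <;> simp only <;> linarith
    · set m := n + 1 + 1 with hm
      have hX : ∀ i, |(tr m w i).1| ≤ A * (ρ ^ i / ((i : ℝ) + 1) ^ 2) := by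
        intro i
        rcases lt_or_ge i m with h | h
        · rw [htr m i h]; exact (ih i h).1
        · rw [htrn m i h]; simp; positivity
      have hY : ∀ i, |(tr m w i).2| ≤ A * (ρ ^ i / ((i : ℝ) + 1) ^ 2) := by
        intro i
        rcases lt_or_ge i m with h | h
        · rw [htr m i h]; exact (ih i h).2
        · rw [htrn m i h]; simp; positivity
      set Q := ρ ^ m / ((m : ℝ) + 1) ^ 2 with hQ
      have hQ0 : 0 < Q := by positivity
      have b1 := abs_seqConv_le (n := m) hA0.le hρ0.le (fun i _ => hX i) (fun i _ => hX i)
      have b2 := abs_seqConv_le (n := m) hA0.le hρ0.le (fun i _ => hX i) (fun i _ => hY i)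
      have b3 := abs_seqConv_le (n := m) (A := 8 * A * A) (by positivity) hρ0.le
        (fun i _ => abs_seqConv_le (n := i) hA0.le hρ0.le (fun j _ => hX j) (fun j _ => hX j))
        (fun i _ => hX i)
      rw [← hQ] at b1 b2 b3
      have hA2 : 0 < A ^ 2 := by positivity
      have c3 : 8 * (8 * A * A) * A * Q ≤ 64 * (A ^ 2 * Q) := by
        have : A * (A ^ 2 * Q) ≤ 1 * (A ^ 2 * Q) := by gcongr
        nlinarith
      have n1 : |N₁ (tr m w) m| ≤ 8 * |p| * (A ^ 2 * Q) := by
        simp only [N₁]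
        rw [abs_mul]
        nlinarith [mul_le_mul_of_nonneg_left b1 (abs_nonneg p)]
      have n2 : |N₂ (tr m w) m| ≤ (8 * |α| + 8 * |β| + 64 * |η|) * (A ^ 2 * Q) := by
        simp only [N₂]
        refine (abs_add_le _ _).trans ?_
        refine (add_le_add (abs_add_le _ _) le_rfl).trans ?_
        rw [abs_mul, abs_mul, abs_mul]
        nlinarith [mul_le_mul_of_nonneg_left b1 (abs_nonneg α),
          mul_le_mul_of_nonneg_left b2 (abs_nonneg β),
          mul_le_mul_of_nonneg_left (b3.trans c3) (abs_nonneg η)]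
      obtain ⟨hD0, hDK⟩ := hD m (by omega)
      have hDpos : 0 < |D m| := abs_pos.2 hD0
      have hfin : ∀ s t : ℝ, |s| + |t| ≤ K * |D m| →
          |(s * N₁ (tr m w) m + t * N₂ (tr m w) m) / D m| ≤ A * Q := by
        intro s t hst
        have hs := abs_nonneg s
        have ht := abs_nonneg t
        rw [abs_div, div_le_iff₀ hDpos]
        have hAQ : 0 < A ^ 2 * Q := by positivity
        have hn1 := abs_nonneg (N₁ (tr m w) m)
        have hn2 := abs_nonneg (N₂ (tr m w) m)
        have s1 : |s| ≤ K * |D m| := by linarith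
        have s2 : |t| ≤ K * |D m| := by linarith
        calc |s * N₁ (tr m w) m + t * N₂ (tr m w) m|
            ≤ |s| * |N₁ (tr m w) m| + |t| * |N₂ (tr m w) m| := by
              rw [← abs_mul, ← abs_mul]; exact abs_add_le _ _
          _ ≤ K * |D m| * (8 * |p| * (A ^ 2 * Q)) +
              K * |D m| * ((8 * |α| + 8 * |β| + 64 * |η|) * (A ^ 2 * Q)) := by gcongr
          _ = (K * T * A) * (A * Q * |D m|) := by rw [hT]; ring
          _ ≤ 1 * (A * Q * |D m|) := by gcongr
          _ = _ := one_mul _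
      have hb := abs_nonneg b
      have hc := abs_nonneg c
      have hma := abs_nonneg (m * l - a)
      have hmd := abs_nonneg (m * l - d)
      have h := hw m
      simp only [Φ] at h
      rw [if_neg (by omega), if_neg (by omega)] at h
      rw [h]
      exact ⟨hfin _ _ (by linarith), hfin _ _ (by linarith)⟩
  have hdrop : ∀ n : ℕ, A * (ρ ^ n / ((n : ℝ) + 1) ^ 2) ≤ A * ρ ^ n := by
    intro n
    gcongr
    refine div_le_self (by positivity) ?_
    exact one_le_pow₀ (by linarith [(Nat.cast_nonneg n : (0 : ℝ) ≤ n)])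
  obtain ⟨hXs, hXd⟩ := powerSeries_regular hρ0 fun n => (hbound n).1.trans (hdrop n)
  obtain ⟨hYs, hYd⟩ := powerSeries_regular hρ0 fun n => (hbound n).2.trans (hdrop n)
  refine ⟨1 / (2 * ρ), _, _, _, _, by positivity, hXs, hYs, ?_, ?_, ?_, ?_, fun z hz =>
    ⟨(hXd z hz).1, (hYd z hz).1, ?_, ?_⟩⟩
  · rw [tsum_eq_single 0 (fun n hn => by simp [hn])]; simp [hw0]
  · rw [tsum_eq_single 0 (fun n hn => by simp [hn])]; simp [hw0]
  · rw [tsum_eq_single 1 (fun n hn => ?_)]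
    · simp [hw1]
    · rcases n with _ | _ | n
      · simp
      · exact absurd rfl hn
      · simp
  · rw [tsum_eq_single 1 (fun n hn => ?_)]
    · simp [hw1]
    · rcases n with _ | _ | n
      · simp
      · exact absurd rfl hn
      · simp
  -- Products of the absolutely convergent series are Cauchy products, so both equations reduce to
  -- `hrec`, coefficient by coefficient.
  all_goals
    have sX := (hXd z hz).2.1
    have sY := (hYd z hz).2.1
    have hconv : ∀ u v : ℕ → ℝ, Summable (fun n => ‖u n * z ^ n‖) → Summable (fun n => ‖v n * z ^ n‖) →
        Summable (fun n => ‖seqConv u v n * z ^ n‖) ∧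
        (∑' n, u n * z ^ n) * (∑' n, v n * z ^ n) = ∑' n, seqConv u v n * z ^ n := by
      intro u v hu hv
      have e : ∀ n, ∑ kl ∈ Finset.HasAntidiagonal.antidiagonal n, u kl.1 * z ^ kl.1 * (v kl.2 * z ^ kl.2) =
          seqConv u v n * z ^ n := by
        intro n
        rw [seqConv, Finset.sum_mul]
        refine Finset.sum_congr rfl fun kl hkl => ?_
        rw [← Finset.HasAntidiagonal.mem_antidiagonal.1 hkl, pow_add]
        ring
      constructor
      · have := summable_norm_sum_mul_antidiagonal_of_summable_norm hu hv
        simpa only [e] using this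
      · rw [tsum_mul_tsum_eq_tsum_sum_antidiagonal_of_summable_norm hu hv]
        simp only [e]
    obtain ⟨sXX, eXX⟩ := hconv _ _ sX sX
    obtain ⟨sXY, eXY⟩ := hconv _ _ sX sY
    obtain ⟨sXXX, eXXX⟩ := hconv _ _ sXX sX
    have hz1 : ∀ n : ℕ, z * (n * z ^ (n - 1)) = n * z ^ n := by
      intro n
      rcases n with _ | n
      · simp
      · rw [Nat.add_sub_cancel, pow_succ]; ring
  · have e2 : ∀ t : ℝ, t ^ 2 = t * t := fun t => sq t
    rw [e2, eXX, ← tsum_mul_left, ← tsum_mul_left, ← tsum_mul_left, ← tsum_mul_left,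
      ← (sX.of_norm.mul_left a).tsum_add (sY.of_norm.mul_left b),
      ← ((sX.of_norm.mul_left a).add (sY.of_norm.mul_left b)).tsum_add (sXX.of_norm.mul_left p)]
    refine tsum_congr fun n => ?_
    have h := (hrec n).1
    simp only [N₁] at h
    linear_combination l * (w n).1 * hz1 n + z ^ n * h
  · have e2 : ∀ t : ℝ, t ^ 2 = t * t := fun t => sq t
    have e3 : ∀ t : ℝ, t ^ 3 = t * t * t := fun t => by ring
    rw [e2, e3, mul_assoc β, eXY, eXX, eXXX, ← tsum_mul_left, ← tsum_mul_left, ← tsum_mul_left,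
      ← tsum_mul_left, ← tsum_mul_left, ← tsum_mul_left,
      ← (sX.of_norm.mul_left c).tsum_add (sY.of_norm.mul_left d),
      ← (sXX.of_norm.mul_left α).tsum_add (sXY.of_norm.mul_left β),
      ← ((sXX.of_norm.mul_left α).add (sXY.of_norm.mul_left β)).tsum_add (sXXX.of_norm.mul_left η),
      ← ((sX.of_norm.mul_left c).add (sY.of_norm.mul_left d)).tsum_add
        (((sXX.of_norm.mul_left α).add (sXY.of_norm.mul_left β)).add (sXXX.of_norm.mul_left η))]
    refine tsum_congr fun n => ?_
    have h := (hrec n).2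
    simp only [N₂] at h
    linear_combination l * (w n).2 * hz1 n + z ^ n * h

end PowerSeries

/-! ### Regularity of orbits and solvability in terms of orbits -/

section Gas

variable {g : Gas} {up θp : ℝ}

lemma len_le (a b : ℝ) : len a b ≤ |a| + |b| := by
  unfold len
  rw [← sq_abs a, ← sq_abs b]
  refine Real.sqrt_le_iff.2 ⟨by positivity, ?_⟩
  nlinarith [abs_nonneg a, abs_nonneg b]

lemma len_sub_eq (um θm : ℝ) : len (up - um) (θp - θm) = √(sqLen (um - up, θm - θp)) := by
  unfold len sqLen
  congr 1
  ring

lemma norm_le_sqrt_sqLen (q : ℝ × ℝ) : ‖q‖ ≤ √(sqLen q) :=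
  Real.le_sqrt_of_sq_le (norm_sq_le_sqLen q)

/-- Derivatives of a solution that is a time shift of a smooth curve. -/
lemma regularity_of_shift {U Θ : ℝ → ℝ} {v : ℝ → ℝ × ℝ} {s : ℝ} (hs : 0 < s)
    (hv : ContDiffOn ℝ ∞ v (Ioi 0))
    (h : ∀ ξ, 0 ≤ ξ → (U ξ - up, Θ ξ - θp) = v (ξ + s)) :
    ContDiffOn ℝ ∞ U (Ici 0) ∧ ContDiffOn ℝ ∞ Θ (Ici 0) ∧
    ∀ n ξ, 0 ≤ ξ → derivLen n up θp U Θ ξ ≤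
      |iteratedDeriv n (fun ξ => (v ξ).1) (ξ + s)| + |iteratedDeriv n (fun ξ => (v ξ).2) (ξ + s)| := by
  have key : ∀ (f F : ℝ → ℝ) (c : ℝ), ContDiffOn ℝ ∞ f (Ioi 0) →
      (∀ ξ, 0 ≤ ξ → F ξ - c = f (ξ + s)) → ContDiffOn ℝ ∞ F (Ici 0) ∧
      ∀ n ξ, 0 ≤ ξ → iteratedDerivWithin n (fun x => F x - c) (Ici 0) ξ =
        iteratedDeriv n f (ξ + s) := by
    intro f F c hf hF
    -- Because `s > 0`, the shifted curve is smooth on both sides of 0, so derivatives within the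
    -- half line are ordinary derivatives even at 0.
    have hat : ∀ ξ, 0 ≤ ξ → ContDiffAt ℝ ∞ (fun ξ => f (ξ + s)) ξ := by
      intro ξ hξ
      have h1 : ContDiffAt ℝ ∞ f (ξ + s) := hf.contDiffAt (Ioi_mem_nhds (by linarith))
      exact h1.comp ξ (contDiffAt_id.add contDiffAt_const)
    constructor
    · have : ContDiffOn ℝ ∞ (fun ξ => f (ξ + s) + c) (Ici 0) := fun ξ hξ =>
        ((hat ξ hξ).add contDiffAt_const).contDiffWithinAt
      refine this.congr fun ξ hξ => ?_
      rw [← hF ξ hξ]; ring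
    · intro n ξ hξ
      rw [iteratedDerivWithin_congr (g := fun ξ => f (ξ + s)) (fun ξ (hξ : ξ ∈ Ici (0 : ℝ)) => hF ξ hξ) hξ,
        iteratedDerivWithin_eq_iteratedDeriv (uniqueDiffOn_Ici 0)
          ((hat ξ hξ).of_le (by exact_mod_cast le_top)) hξ, iteratedDeriv_comp_add_const]
  obtain ⟨h1, h1'⟩ := key (fun ξ => (v ξ).1) U up (contDiff_fst.comp_contDiffOn hv)
    (fun ξ hξ => congrArg Prod.fst (h ξ hξ))
  obtain ⟨h2, h2'⟩ := key (fun ξ => (v ξ).2) Θ θp (contDiff_snd.comp_contDiffOn hv)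
    (fun ξ hξ => congrArg Prod.snd (h ξ hξ))
  refine ⟨h1, h2, fun n ξ hξ => ?_⟩
  unfold derivLen
  rw [h1' n ξ hξ, h2' n ξ hξ]
  exact len_le _ _

/-- All derivatives of an orbit decay at least as fast as the orbit. -/
lemma derivBound_orbit {v : ℝ → ℝ × ℝ} {x : ℝ → ℝ}
    (hv : ∀ ξ, 0 < ξ → HasDerivAt v (pertField g up θp (v ξ)) ξ)
    (hx0 : ∀ ξ, 0 < ξ → 0 ≤ x ξ) (hx1 : ∀ ξ, 0 < ξ → x ξ ≤ 1) {C : ℝ} (hC : 0 < C)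
    (hvx : ∀ ξ, 0 < ξ → ‖v ξ‖ ≤ C * x ξ) (N : ℕ) :
    DerivBound x 1 1 N (fun ξ => (v ξ).1) ∧ DerivBound x 1 1 N (fun ξ => (v ξ).2) := by
  have hsm : ContDiffOn ℝ ∞ v (Ioi 0) :=
    contDiffOn_of_ode (contDiff_pertField g up θp) isOpen_Ioi hv
  have h1s : ContDiffOn ℝ ∞ (fun ξ => (v ξ).1) (Ioi 0) := contDiff_fst.comp_contDiffOn hsm
  have h2s : ContDiffOn ℝ ∞ (fun ξ => (v ξ).2) (Ioi 0) := contDiff_snd.comp_contDiffOn hsm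
  have h1d : ∀ ξ, 0 < ξ → HasDerivAt (fun ξ => (v ξ).1) (pertField g up θp (v ξ)).1 ξ :=
    fun ξ hξ => (hv ξ hξ).fst
  have h2d : ∀ ξ, 0 < ξ → HasDerivAt (fun ξ => (v ξ).2) (pertField g up θp (v ξ)).2 ξ :=
    fun ξ hξ => (hv ξ hξ).snd
  have hy : ∀ ξ : ℝ, 0 < ξ → 0 ≤ (1 : ℝ → ℝ) ξ := fun _ _ => zero_le_one
  induction N with
  | zero =>
    constructor
    · refine ⟨C, hC, fun j hj ξ hξ => ?_⟩
      rw [Nat.le_zero.1 hj]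
      simpa using (norm_fst_le _).trans (hvx ξ hξ)
    · refine ⟨C, hC, fun j hj ξ hξ => ?_⟩
      rw [Nat.le_zero.1 hj]
      simpa using (norm_snd_le _).trans (hvx ξ hξ)
  | succ N ih =>
    obtain ⟨i1, i2⟩ := ih
    -- Products decay like `x²` or faster, but the linear part of the field only gives `x`; all
    -- bounds are relaxed to that common order.
    have q11 := (i1.mul hx0 hy i1 h1s h1s).mono_exp hx0 hx1 hy (show 1 ≤ 1 + 1 by omega)
    have q12 := (i1.mul hx0 hy i2 h1s h2s).mono_exp hx0 hx1 hy (show 1 ≤ 1 + 1 by omega)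
    have q111 := (q11.mul hx0 hy i1 (h1s.mul h1s) h1s).mono_exp hx0 hx1 hy
      (show 1 ≤ 1 + 1 by omega)
    constructor
    · have hb := (((i1.const_mul hx0 hy ((up ^ 2 - g.R * θp) / (g.μ * up))).add
        (i2.const_mul hx0 hy (g.R / g.μ)) (contDiffOn_const.mul h1s)
        (contDiffOn_const.mul h2s))).add (q11.const_mul hx0 hy (1 / g.μ))
        ((contDiffOn_const.mul h1s).add (contDiffOn_const.mul h2s))
        (contDiffOn_const.mul (h1s.mul h1s))
      obtain ⟨D, hD, hb⟩ := hb
      refine DerivBound.succ hx0 hy i1 (fun ξ hξ => (h1d ξ hξ).congr_deriv ?_)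
        ⟨D, hD, fun ξ hξ => by simpa using hb N le_rfl ξ hξ⟩
      rw [pertField_fst]
      ring
    · have hb := (((i1.const_mul hx0 hy (g.R * θp / g.κ)).add
        (i2.const_mul hx0 hy (g.R * up / (g.κ * (g.γ - 1)))) (contDiffOn_const.mul h1s)
        (contDiffOn_const.mul h2s))).add
        (((q11.const_mul hx0 hy (g.R * θp / (g.κ * up) - up / (2 * g.κ))).add
          (q12.const_mul hx0 hy (g.R / (g.κ * (g.γ - 1)))) (contDiffOn_const.mul (h1s.mul h1s))
          (contDiffOn_const.mul (h1s.mul h2s))).add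
          (q111.const_mul hx0 hy (-(1 / (2 * g.κ))))
          ((contDiffOn_const.mul (h1s.mul h1s)).add (contDiffOn_const.mul (h1s.mul h2s)))
          (contDiffOn_const.mul ((h1s.mul h1s).mul h1s)))
        ((contDiffOn_const.mul h1s).add (contDiffOn_const.mul h2s))
        (((contDiffOn_const.mul (h1s.mul h1s)).add (contDiffOn_const.mul (h1s.mul h2s))).add
          (contDiffOn_const.mul ((h1s.mul h1s).mul h1s)))
      obtain ⟨D, hD, hb⟩ := hb
      refine DerivBound.succ hx0 hy i2 (fun ξ hξ => (h2d ξ hξ).congr_deriv ?_)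
        ⟨D, hD, fun ξ hξ => by simpa using hb N le_rfl ξ hξ⟩
      rw [pertField_snd]
      ring

/-- Solvability for data in terms of the orbits of the perturbation field. -/
lemma solvableIff_of_orbit {vm um θm vp : ℝ} (hvm : 0 < vm) (hum : 0 < um) (hvp : 0 < vp)
    {S : Set (ℝ × ℝ)}
    (h1 : ∀ w, IsDecayingOrbit (pertField g up θp) w → (∀ ξ, 0 ≤ ξ → 0 < up + (w ξ).1) →
      (∀ ξ, 0 ≤ ξ → 0 < θp + (w ξ).2) → w 0 = (um - up, θm - θp) → (um, θm) ∈ S)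
    (h2 : (um, θm) ∈ S → ∃ w, IsDecayingOrbit (pertField g up θp) w ∧
      (∀ ξ, 0 ≤ ξ → 0 < up + (w ξ).1) ∧ (∀ ξ, 0 ≤ ξ → 0 < θp + (w ξ).2) ∧
      w 0 = (um - up, θm - θp)) :
    SolvableIff g vm um θm vp up θp S := by
  have k1 : ∀ X Y : ℝ → ℝ, IsPertSolution g vm um θm vp up θp X Y →
      um / vm = up / vp ∧ (um, θm) ∈ S := fun X Y h =>
    ⟨h.flux, h1 _ h.orbit h.U_pos h.Θ_pos (by simp [h.X_zero, h.Y_zero])⟩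
  have k2 : um / vm = up / vp ∧ (um, θm) ∈ S → ∃ X Y : ℝ → ℝ,
      IsPertSolution g vm um θm vp up θp X Y := by
    rintro ⟨hfl, hS⟩
    obtain ⟨w, hw, hU, hΘ, h0⟩ := h2 hS
    exact ⟨_, _, hw.isPertSolution hfl hU hΘ h0⟩
  refine ⟨⟨?_, ?_⟩, ⟨?_, k2⟩⟩
  · rintro ⟨V, U, Θ, h⟩
    exact k1 _ _ (h.isPertSolution hvm hum hvp)
  · intro h
    obtain ⟨X, Y, hXY⟩ := k2 h
    exact ⟨_, _, _, hXY.isBLSolution hvm hum hvp⟩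
  · rintro ⟨X, Y, h⟩
    exact k1 X Y h

lemma blField_add (q : ℝ × ℝ) : blField g up θp ((up, θp) + q) = pertField g up θp q := by
  unfold blField
  rw [add_sub_cancel_left]

lemma hasFDerivAt_blField (g : Gas) (up θp : ℝ) :
    HasFDerivAt (blField g up θp) (pertLin g up θp) (up, θp) := by
  have h := (hasStrictFDerivAt_pertField g up θp).hasFDerivAt
  rw [← sub_self (up, θp)] at h
  exact HasFDerivAt.comp (f := fun q : ℝ × ℝ => q - (up, θp)) (up, θp) h
    ((hasFDerivAt_id (up, θp)).sub_const (up, θp))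

lemma blField_equilibrium (g : Gas) (up θp : ℝ) : blField g up θp (up, θp) = 0 := by
  unfold blField
  rw [sub_self, pertField_zero]

lemma hasEigenvalue_of_apply_eq {L : ℝ × ℝ →L[ℝ] ℝ × ℝ} {l : ℝ} {v : ℝ × ℝ} (hv : v ≠ 0)
    (h : L v = l • v) : Module.End.HasEigenvalue (L : ℝ × ℝ →ₗ[ℝ] ℝ × ℝ) l :=
  Module.End.hasEigenvalue_of_hasEigenvector
    (Module.End.hasEigenvector_iff.2 ⟨Module.End.mem_eigenspace_iff.2 h, hv⟩)

end Gas

/-! ### Smooth inverses on the line -/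

/-- A smooth function with positive derivative has a smooth inverse. -/
lemma exists_smooth_inverse {S : ℝ → ℝ} {z₀ z₁ : ℝ} (hz : z₁ < z₀) (hz1 : 0 < z₁)
    (hS : ContDiffOn ℝ ∞ S (Ioo (-z₀) z₀)) (hS' : ∀ z ∈ Ioo (-z₀) z₀, 0 < deriv S z) :
    StrictMonoOn S (Ioo (-z₀) z₀) ∧ ∃ k : ℝ → ℝ, ContDiffOn ℝ ∞ k (Ioo (S (-z₁)) (S z₁)) ∧
      (∀ z ∈ Ioo (-z₁) z₁, S z ∈ Ioo (S (-z₁)) (S z₁) ∧ k (S z) = z) ∧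
      ∀ y ∈ Ioo (S (-z₁)) (S z₁), k y ∈ Ioo (-z₁) z₁ ∧ S (k y) = y := by
  have hmono : StrictMonoOn S (Ioo (-z₀) z₀) := by
    refine strictMonoOn_of_deriv_pos (convex_Ioo _ _) hS.continuousOn ?_
    rwa [interior_Ioo]
  have hm1 : -z₁ ∈ Ioo (-z₀) z₀ := ⟨by linarith, by linarith⟩
  have hm2 : z₁ ∈ Ioo (-z₀) z₀ := ⟨by linarith, hz⟩
  have hsub : Ioo (-z₁) z₁ ⊆ Ioo (-z₀) z₀ := Ioo_subset_Ioo (by linarith) hz.le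
  have himg : ∀ y ∈ Ioo (S (-z₁)) (S z₁), ∃ z ∈ Ioo (-z₁) z₁, S z = y := fun y hy =>
    intermediate_value_Ioo (by linarith)
      (hS.continuousOn.mono (Icc_subset_Ioo (by linarith) hz)) hy
  set k := Function.invFunOn S (Ioo (-z₁) z₁) with hk
  have hk1 : ∀ y ∈ Ioo (S (-z₁)) (S z₁), k y ∈ Ioo (-z₁) z₁ ∧ S (k y) = y := fun y hy =>
    ⟨Function.invFunOn_mem (himg y hy), Function.invFunOn_eq (himg y hy)⟩
  have hk2 : ∀ z ∈ Ioo (-z₁) z₁, S z ∈ Ioo (S (-z₁)) (S z₁) ∧ k (S z) = z := by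
    intro z hz'
    have h1 : S z ∈ Ioo (S (-z₁)) (S z₁) :=
      ⟨hmono hm1 (hsub hz') hz'.1, hmono (hsub hz') hm2 hz'.2⟩
    exact ⟨h1, hmono.injOn (hsub (hk1 _ h1).1) (hsub hz') (hk1 _ h1).2⟩
  refine ⟨hmono, k, fun y hy => ?_, hk2, hk1⟩
  obtain ⟨hz', hSy⟩ := hk1 y hy
  have hat : ContDiffAt ℝ ∞ S (k y) := hS.contDiffAt (Ioo_mem_nhds (hsub hz').1 (hsub hz').2)
  have hd : HasDerivAt S (deriv S (k y)) (k y) :=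
    (hat.differentiableAt (by simp)).hasDerivAt
  have hd' : HasFDerivAt S ((ContinuousLinearEquiv.unitsEquivAut ℝ (Units.mk0 _ (hS' _ (hsub hz')).ne') : ℝ ≃L[ℝ] ℝ) : ℝ →L[ℝ] ℝ) (k y) := by
    refine hd.hasFDerivAt.congr_fderiv ?_
    ext
    simp
  set Φ := hat.toOpenPartialHomeomorph S hd' (by simp) with hΦ
  have hΦS : ∀ z, Φ z = S z := fun z => by
    rw [hΦ, ContDiffAt.toOpenPartialHomeomorph_coe]
  have hinv : ContDiffAt ℝ ∞ Φ.symm (S (k y)) := hat.to_localInverse hd' (by simp)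
  have hmem : k y ∈ Φ.source := hat.mem_toOpenPartialHomeomorph_source hd' (by simp)
  have htgt : S (k y) ∈ Φ.target := by rw [← hΦS]; exact Φ.map_source hmem
  have hsymm : Φ.symm (S (k y)) = k y := by rw [← hΦS]; exact Φ.left_inv hmem
  rw [hSy] at hinv htgt hsymm
  -- By injectivity of `S`, the global inverse agrees near `y` with the local inverse from the
  -- inverse function theorem.
  refine ContDiffAt.contDiffWithinAt (hinv.congr_of_eventuallyEq ?_)
  have h1 : ∀ᶠ y' in 𝓝 y, Φ.symm y' ∈ Ioo (-z₁) z₁ := by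
    refine hinv.continuousAt.eventually_mem ?_
    rw [hsymm]
    exact Ioo_mem_nhds hz'.1 hz'.2
  filter_upwards [h1, Φ.open_target.mem_nhds htgt, Ioo_mem_nhds hy.1 hy.2] with y' h2 h3 h4
  have h5 : S (Φ.symm y') = y' := by rw [← hΦS]; exact Φ.right_inv h3
  exact hmono.injOn (hsub (hk1 y' h4).1) (hsub h2) ((hk1 y' h4).2.trans h5.symm)

/-! ### Spectrum at a subsonic state and the curve it generates -/

section Gas

variable {g : Gas} {up θp : ℝ}

lemma hasEigenvalue_linPart {l : ℝ} {v : ℝ × ℝ} (hv : v ≠ 0) (h : pertLin g up θp v = l • v) :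
    Module.End.HasEigenvalue (Matrix.toLin' (linPart g up θp)) l := by
  refine Module.End.hasEigenvalue_of_hasEigenvector (x := ![v.1, v.2])
    (Module.End.hasEigenvector_iff.2 ⟨Module.End.mem_eigenspace_iff.2 ?_, ?_⟩)
  · have h1 := congrArg Prod.fst h
    have h2 := congrArg Prod.snd h
    rw [pertLin_fst] at h1
    rw [pertLin_snd] at h2
    rw [Matrix.toLin'_apply]
    ext i
    fin_cases i
    · simpa [linPart, Matrix.mulVec, dotProduct, Fin.sum_univ_two] using h1
    · simpa [linPart, Matrix.mulVec, dotProduct, Fin.sum_univ_two] using h2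
  · intro h0
    exact hv (Prod.ext (by simpa using congrFun h0 0) (by simpa using congrFun h0 1))

/-- Eigenvalues and eigenvectors of the linear part at a subsonic state. -/
lemma exists_subsonic_spectrum (g : Gas) (hup : 0 < up) (hθp : 0 < θp) (hM : mach g up θp < 1) :
    ∃ c₂ l₁ l₂ a₂ : ℝ, 0 < c₂ ∧
      c₂ ^ 2 + ((mach g up θp ^ 2 * g.γ - 1) / (mach g up θp ^ 2 * g.R * g.γ)
          - g.μ / (g.κ * (g.γ - 1))) * c₂ - g.μ / (mach g up θp ^ 2 * g.R * g.γ * g.κ) = 0 ∧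
      0 < l₁ ∧ l₂ < 0 ∧ a₂ = -(g.R / (g.μ * (l₁ - l₂))) ∧
      pertLin g up θp (a₂, 1 + a₂ * c₂ * up) = l₂ • (a₂, 1 + a₂ * c₂ * up) ∧
      pertLin g up θp (1, c₂ * up) = l₁ • (1, c₂ * up) ∧
      ∀ x : ℝ, (x - (up ^ 2 - g.R * θp) / (g.μ * up)) * (x - g.R * up / (g.κ * (g.γ - 1)))
        - g.R / g.μ * (g.R * θp / g.κ) = (x - l₁) * (x - l₂) := by
  have hμ := g.μ_pos
  have hκ := g.κ_pos
  have hR := g.R_pos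
  have hγ : 0 < g.γ - 1 := sub_pos.2 g.one_lt_γ
  have hγ' : 0 < g.γ := one_pos.trans g.one_lt_γ
  have hM2 : up ^ 2 < g.R * g.γ * θp := by
    have h0 : 0 ≤ mach g up θp := by unfold mach; positivity
    have h1 : mach g up θp ^ 2 < 1 := by nlinarith
    rwa [mach_sq g hθp, div_lt_one (by positivity)] at h1
  obtain ⟨a, ha⟩ : ∃ a, a = (up ^ 2 - g.R * θp) / (g.μ * up) := ⟨_, rfl⟩
  obtain ⟨b, hb⟩ : ∃ b, b = g.R / g.μ := ⟨_, rfl⟩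
  obtain ⟨c, hc⟩ : ∃ c, c = g.R * θp / g.κ := ⟨_, rfl⟩
  obtain ⟨d, hd⟩ : ∃ d, d = g.R * up / (g.κ * (g.γ - 1)) := ⟨_, rfl⟩
  rw [← ha, ← hb, ← hc, ← hd]
  have hb0 : 0 < b := by rw [hb]; positivity
  have hc0 : 0 < c := by rw [hc]; positivity
  have hdet : a * d - b * c < 0 := by
    have : a * d - b * c = g.R / (g.μ * g.κ * (g.γ - 1)) * (up ^ 2 - g.R * g.γ * θp) := by
      rw [ha, hb, hc, hd]; field_simp; ring
    rw [this]
    have h1 : 0 < g.R / (g.μ * g.κ * (g.γ - 1)) := by positivity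
    nlinarith
  obtain ⟨s, hs⟩ : ∃ s, s = √((a - d) ^ 2 + 4 * (b * c)) := ⟨_, rfl⟩
  have hs2 : s ^ 2 = (a - d) ^ 2 + 4 * (b * c) := by
    rw [hs]; exact Real.sq_sqrt (by positivity)
  have hs0 : 0 ≤ s := by rw [hs]; exact Real.sqrt_nonneg _
  have hbc : 0 < b * c := by positivity
  -- The negative determinant gives eigenvalues of opposite signs; the positive product `b c` gives
  -- `l₁ > a`, hence `c₂ > 0`.
  have hs1 : |a + d| < s := by
    refine abs_lt_of_sq_lt_sq ?_ hs0
    nlinarith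
  have hs3 : |a - d| < s := by
    refine abs_lt_of_sq_lt_sq ?_ hs0
    nlinarith
  obtain ⟨h1, h2⟩ := abs_lt.1 hs1
  obtain ⟨h3, h4⟩ := abs_lt.1 hs3
  have hspos : 0 < s := (abs_nonneg _).trans_lt hs1
  obtain ⟨l₁, hl₁⟩ : ∃ l₁, l₁ = (a + d + s) / 2 := ⟨_, rfl⟩
  obtain ⟨l₂, hl₂⟩ : ∃ l₂, l₂ = (a + d - s) / 2 := ⟨_, rfl⟩
  have hsub : l₁ - l₂ = s := by rw [hl₁, hl₂]; ring
  have hchar : ∀ x : ℝ, (x - a) * (x - d) - b * c = (x - l₁) * (x - l₂) := by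
    intro x
    rw [hl₁, hl₂]
    linear_combination (1 / 4 : ℝ) * hs2
  have hq1 : (l₁ - a) * (l₁ - d) = b * c := by linear_combination hchar l₁
  have hsum : l₁ + l₂ = a + d := by rw [hl₁, hl₂]; ring
  have hla : 0 < l₁ - a := by rw [hl₁]; linarith
  -- The slope of the eigenvector for `l₁` is `c₂ up`, and the quadratic equation for `c₂` is the
  -- equation for slopes of invariant directions. The value of `a₂` makes `(a₂, 1 + a₂ c₂ up)` an
  -- eigenvector for `l₂`.
  obtain ⟨c₂, hc₂⟩ : ∃ c₂, c₂ = (l₁ - a) / (b * up) := ⟨_, rfl⟩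
  obtain ⟨a₂, ha₂⟩ : ∃ a₂, a₂ = -(g.R / (g.μ * (l₁ - l₂))) := ⟨_, rfl⟩
  have hcu : b * (c₂ * up) = l₁ - a := by rw [hc₂]; field_simp
  have hau : a₂ * (l₁ - l₂) = -b := by
    rw [ha₂, hb, hsub]; field_simp
  have hcd : c = (l₁ - d) * (c₂ * up) := by
    refine mul_left_cancel₀ hb0.ne' ?_
    rw [← hq1]
    linear_combination -(l₁ - d) * hcu
  refine ⟨c₂, l₁, l₂, a₂, by rw [hc₂]; positivity, ?_, by rw [hl₁]; linarith, by rw [hl₂]; linarith, ha₂,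
    ?_, ?_, hchar⟩
  · have hm := mach_sq g (up := up) hθp
    have e1 : (mach g up θp ^ 2 * g.γ - 1) / (mach g up θp ^ 2 * g.R * g.γ)
          - g.μ / (g.κ * (g.γ - 1)) = (a - d) / (b * up) := by
      rw [hm, ha, hb, hd]; field_simp
    have e2 : g.μ / (mach g up θp ^ 2 * g.R * g.γ * g.κ) = c / (b * up ^ 2) := by
      rw [hm, hc, hb]; field_simp
    rw [e1, e2, hc₂]
    field_simp
    linear_combination hq1
  · refine Prod.ext ?_ ?_
    · rw [pertLin_fst, ← ha, ← hb]
      simp only [Prod.smul_fst, smul_eq_mul]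
      linear_combination a₂ * hcu + hau
    · rw [pertLin_snd, ← hc, ← hd]
      simp only [Prod.smul_snd, smul_eq_mul]
      rw [hcd]
      linear_combination c₂ * up * hau - hcu - hsum
  · refine Prod.ext ?_ ?_
    · rw [pertLin_fst, ← ha, ← hb]
      simp only [Prod.smul_fst, smul_eq_mul]
      linear_combination hcu
    · rw [pertLin_snd, ← hc, ← hd]
      simp only [Prod.smul_snd, smul_eq_mul]
      linear_combination hcd

/-- The curve tangent to the eigenvector of a negative eigenvalue that consists of decaying orbits. -/
lemma exists_pertField_curve {l₁ l₂ : ℝ} {e : ℝ × ℝ} (hl₁ : 0 < l₁) (hl₂ : l₂ < 0)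
    (hchar : ∀ x : ℝ, (x - (up ^ 2 - g.R * θp) / (g.μ * up)) * (x - g.R * up / (g.κ * (g.γ - 1)))
        - g.R / g.μ * (g.R * θp / g.κ) = (x - l₁) * (x - l₂))
    (he : pertLin g up θp e = l₂ • e) :
    ∃ (r : ℝ) (W W' : ℝ → ℝ × ℝ), 0 < r ∧ ContDiffOn ℝ ∞ W (Ioo (-r) r) ∧ W 0 = 0 ∧ W' 0 = e ∧
      ∀ z ∈ Ioo (-r) r, HasDerivAt W (W' z) z ∧ pertField g up θp (W z) = (l₂ * z) • W' z := by
  obtain ⟨a, ha⟩ : ∃ a, a = (up ^ 2 - g.R * θp) / (g.μ * up) := ⟨_, rfl⟩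
  obtain ⟨b, hb⟩ : ∃ b, b = g.R / g.μ := ⟨_, rfl⟩
  obtain ⟨c, hc⟩ : ∃ c, c = g.R * θp / g.κ := ⟨_, rfl⟩
  obtain ⟨d, hd⟩ : ∃ d, d = g.R * up / (g.κ * (g.γ - 1)) := ⟨_, rfl⟩
  have he1 := congrArg Prod.fst he
  have he2 := congrArg Prod.snd he
  rw [pertLin_fst, ← ha, ← hb] at he1
  rw [pertLin_snd, ← hc, ← hd] at he2
  rw [← ha, ← hb, ← hc, ← hd] at hchar
  set S := |a| + |b| + |c| + |d| with hS
  have hS0 : 0 ≤ S := by positivity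
  set K := (2 * |l₂| + S) / l₂ ^ 2 with hK
  have hl₂' : 0 < |l₂| := abs_pos.2 hl₂.ne
  have hl₂2 : 0 < l₂ ^ 2 := by nlinarith
  have hK0 : 0 < K := div_pos (by positivity) hl₂2
  obtain ⟨r, X, Y, X', Y', hr, hX, hY, hX0, hY0, hX'0, hY'0, h⟩ :=
    exists_invariant_curve (a := a) (b := b) (c := c) (d := d) (l := l₂) (K := K)
      (e₁ := e.1) (e₂ := e.2) (p := 1 / g.μ)
      (α := g.R * θp / (g.κ * up) - up / (2 * g.κ)) (β := g.R / (g.κ * (g.γ - 1)))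
      (η := -(1 / (2 * g.κ))) hK0 (by
        intro n hn
        have hn2 : (2 : ℝ) ≤ n := by exact_mod_cast hn
        rw [hchar]
        -- No resonance: for `n ≥ 2` the multiple `n l₂` lies below both eigenvalues. The
        -- determinant is at least `n l₂²`, while the cofactors grow linearly in `n`, so one `K`
        -- serves all `n`.
        have h1 : n * l₂ ^ 2 ≤ (n * l₂ - l₁) * (n * l₂ - l₂) := by
          have p1 : 0 < l₁ * (-l₂) * (n - 1) := by
            have := neg_pos.2 hl₂
            have : (0 : ℝ) < n - 1 := by linarith
            positivity
          nlinarith [mul_nonneg (mul_nonneg (show (0 : ℝ) ≤ n by linarith)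
            (show (0 : ℝ) ≤ n - 2 by linarith)) hl₂2.le]
        have h2 : 0 < n * l₂ ^ 2 := by positivity
        refine ⟨(h2.trans_le h1).ne', ?_⟩
        rw [abs_of_pos (h2.trans_le h1)]
        have h3 : |n * l₂ - a| ≤ n * |l₂| + |a| := by
          refine (abs_sub _ _).trans ?_
          rw [abs_mul, Nat.abs_cast]
        have h4 : |n * l₂ - d| ≤ n * |l₂| + |d| := by
          refine (abs_sub _ _).trans ?_
          rw [abs_mul, Nat.abs_cast]
        calc |n * l₂ - a| + |b| + |c| + |n * l₂ - d| ≤ 2 * n * |l₂| + S := by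
              rw [hS]; linarith
          _ ≤ n * (2 * |l₂| + S) := by nlinarith
          _ = K * (n * l₂ ^ 2) := by
              rw [hK, mul_left_comm, div_mul_cancel₀ _ hl₂2.ne']
          _ ≤ K * ((n * l₂ - l₁) * (n * l₂ - l₂)) := by
              have : 0 ≤ K := by positivity
              gcongr) he1 he2
  refine ⟨r, fun z => (X z, Y z), fun z => (X' z, Y' z), hr, hX.prodMk hY, by simp [hX0, hY0],
    by simp [hX'0, hY'0], fun z hz => ⟨(h z hz).1.prodMk (h z hz).2.1, ?_⟩⟩
  obtain ⟨-, -, h1, h2⟩ := h z hz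
  refine Prod.ext ?_ ?_
  · rw [pertField_fst, ← ha, ← hb]
    simp only [Prod.smul_fst, smul_eq_mul]
    rw [h1]
  · rw [pertField_snd, ← hc, ← hd]
    simp only [Prod.smul_snd, smul_eq_mul]
    rw [h2]
    ring

/-- Orbits on the invariant curve. -/
lemma isDecayingOrbit_curve {f : ℝ × ℝ → ℝ × ℝ} {W W' : ℝ → ℝ × ℝ} {r l z : ℝ} (hl : l < 0)
    (hW0 : W 0 = 0)
    (hW : ∀ z ∈ Ioo (-r) r, HasDerivAt W (W' z) z ∧ f (W z) = (l * z) • W' z) (hz : |z| < r) :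
    IsDecayingOrbit f (fun ξ => W (z * Real.exp (l * ξ))) := by
  have hmem : ∀ ξ : ℝ, 0 ≤ ξ → z * Real.exp (l * ξ) ∈ Ioo (-r) r := by
    intro ξ hξ
    refine abs_lt.1 (lt_of_le_of_lt ?_ hz)
    rw [abs_mul, abs_of_pos (Real.exp_pos _)]
    refine mul_le_of_le_one_right (abs_nonneg z) (Real.exp_le_one_iff.2 ?_)
    exact mul_nonpos_of_nonpos_of_nonneg hl.le hξ
  have hd : ∀ ξ : ℝ, 0 ≤ ξ → HasDerivAt (fun ξ => W (z * Real.exp (l * ξ)))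
      (f (W (z * Real.exp (l * ξ)))) ξ := by
    intro ξ hξ
    obtain ⟨h1, h2⟩ := hW _ (hmem ξ hξ)
    have h3 : HasDerivAt (fun ξ => z * Real.exp (l * ξ)) (l * (z * Real.exp (l * ξ))) ξ := by
      refine ((((hasDerivAt_id' ξ).const_mul l).exp).const_mul z).congr_deriv ?_
      ring
    rw [h2]
    exact h1.scomp ξ h3
  refine ⟨fun ξ hξ => (hd ξ hξ).continuousAt.continuousWithinAt, fun ξ hξ => hd ξ hξ.le, ?_⟩
  have h0 : (0 : ℝ) ∈ Ioo (-r) r := by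
    have := (abs_nonneg z).trans_lt hz
    exact ⟨by linarith, this⟩
  have h1 : Tendsto (fun ξ : ℝ => z * Real.exp (l * ξ)) atTop (𝓝 0) := by
    have := (Real.tendsto_exp_atBot.comp
      ((tendsto_id (α := ℝ) (x := atTop)).const_mul_atTop_of_neg hl)).const_mul z
    simpa [Function.comp_def] using this
  have h2 := (hW 0 h0).1.continuousAt.tendsto.comp h1
  rwa [hW0] at h2

end Gas

/-! ### The local stable curve -/

section Gas

variable {g : Gas} {up θp : ℝ}

set_option maxHeartbeats 800000 in
/-- The local stable curve of the equilibrium at a subsonic state, in the frame `e = (A, p)`,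
`e' = (1, k)` of eigenvectors with `A k = p - 1`. -/
theorem exists_stable_curve (g : Gas) (hup : 0 < up) (hθp : 0 < θp) {l₁ l₂ A p k : ℝ}
    (hl₁ : 0 < l₁) (hl₂ : l₂ < 0) (hp : p = 1 + A * k)
    (hchar : ∀ x : ℝ, (x - (up ^ 2 - g.R * θp) / (g.μ * up)) * (x - g.R * up / (g.κ * (g.γ - 1)))
        - g.R / g.μ * (g.R * θp / g.κ) = (x - l₁) * (x - l₂))
    (he : pertLin g up θp (A, p) = l₂ • (A, p)) (he' : pertLin g up θp (1, k) = l₁ • (1, k)) :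
    ∃ (W : ℝ → ℝ × ℝ) (z₁ C δ : ℝ), 0 < z₁ ∧ 0 < C ∧ 0 < δ ∧ W 0 = 0 ∧
      (∀ z, |z| ≤ z₁ → ‖W z‖ ≤ C * |z| ∧ |z| ≤ C * ‖W z‖ ∧ 0 < up + (W z).1 ∧ 0 < θp + (W z).2 ∧
        IsDecayingOrbit (pertField g up θp) (fun ξ => W (z * Real.exp (l₂ * ξ))) ∧
        (0 < z → 0 < (W z).2 - k * (W z).1) ∧ (z < 0 → (W z).2 - k * (W z).1 < 0)) ∧
      (∃ (a b : ℝ) (h : ℝ → ℝ), a < 0 ∧ 0 < b ∧ ContDiffOn ℝ ∞ h (Ioo a b) ∧ h 0 = 0 ∧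
        deriv h 0 = 0 ∧
        W '' Ioo (-z₁) z₁ = (fun s : ℝ => s • (A, p) + h s • ((1, k) : ℝ × ℝ)) '' Ioo a b) ∧
      (∀ ε, 0 < ε → ∃ η, 0 < η ∧ ∀ z, |z| ≤ z₁ → |z| < η →
        |p * (W z).1 - A * (W z).2| ≤ ε * ‖W z‖) ∧
      ∀ w, IsDecayingOrbit (pertField g up θp) w → (∀ ξ, 0 ≤ ξ → 0 < up + (w ξ).1) →
        (∀ ξ, 0 ≤ ξ → 0 < θp + (w ξ).2) → sqLen (w 0) ≤ δ ^ 2 → ∃ z ∈ Ioo (-z₁) z₁, w 0 = W z := by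
  obtain ⟨r, W, W', hr, hWs, hW0, hW'0, hW⟩ := exists_pertField_curve hl₁ hl₂ hchar he
  -- coordinates in the frame of eigenvectors
  set S : ℝ → ℝ := fun z => (W z).2 - k * (W z).1 with hS
  set T : ℝ → ℝ := fun z => p * (W z).1 - A * (W z).2 with hT
  have hframe : ∀ q : ℝ × ℝ, (q.2 - k * q.1) • ((A, p) : ℝ × ℝ) +
      (p * q.1 - A * q.2) • ((1, k) : ℝ × ℝ) = q := by
    intro q
    rw [hp]
    refine Prod.ext ?_ ?_ <;> simp <;> ring
  have hsJ : ∀ v : ℝ × ℝ, (pertLin g up θp v).2 - k * (pertLin g up θp v).1 =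
      l₂ * (v.2 - k * v.1) ∧ p * (pertLin g up θp v).1 - A * (pertLin g up θp v).2 =
      l₁ * (p * v.1 - A * v.2) := by
    intro v
    have h := congrArg (pertLin g up θp) (hframe v)
    rw [map_add, map_smul, map_smul, he, he'] at h
    rw [← h, hp]
    simp only [Prod.fst_add, Prod.snd_add, Prod.smul_fst, Prod.smul_snd, smul_eq_mul]
    constructor <;> ring
  have h0 : (0 : ℝ) ∈ Ioo (-r) r := ⟨by linarith, hr⟩
  have hW1s : ContDiffOn ℝ ∞ (fun z => (W z).1) (Ioo (-r) r) := contDiff_fst.comp_contDiffOn hWs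
  have hW2s : ContDiffOn ℝ ∞ (fun z => (W z).2) (Ioo (-r) r) := contDiff_snd.comp_contDiffOn hWs
  have hSs : ContDiffOn ℝ ∞ S (Ioo (-r) r) := hW2s.sub (contDiffOn_const.mul hW1s)
  have hTs : ContDiffOn ℝ ∞ T (Ioo (-r) r) :=
    (contDiffOn_const.mul hW1s).sub (contDiffOn_const.mul hW2s)
  have hW1d : HasDerivAt (fun z => (W z).1) A 0 := by
    have := (hW 0 h0).1.fst
    rw [hW'0] at this
    exact this
  have hW2d : HasDerivAt (fun z => (W z).2) p 0 := by
    have := (hW 0 h0).1.snd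
    rw [hW'0] at this
    exact this
  have hSd : HasDerivAt S 1 0 := by
    refine (hW2d.fun_sub (hW1d.const_mul k)).congr_deriv ?_
    rw [hp]; ring
  have hTd : HasDerivAt T 0 0 := by
    refine ((hW1d.const_mul p).fun_sub (hW2d.const_mul A)).congr_deriv ?_
    ring
  have hS0 : S 0 = 0 := by simp [hS, hW0]
  have hT0 : T 0 = 0 := by simp [hT, hW0]
  have hSapp : ∀ z, S z = (W z).2 - k * (W z).1 := fun _ => rfl
  have hTapp : ∀ z, T z = p * (W z).1 - A * (W z).2 := fun _ => rfl
  clear_value S T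
  clear hS hT
  -- the cone estimate
  set K := 2 * (A ^ 2 + p ^ 2 + (1 + k ^ 2)) with hK
  have hKpos : 0 < K := by positivity
  set m := min l₁ (-l₂) / K with hm
  have hm0 : 0 < m := div_pos (lt_min hl₁ (neg_pos.2 hl₂)) hKpos
  -- In eigencoordinates the form is `t² - s²`; half its derivative along J is `l₁ t² - l₂ s²`,
  -- which is positive definite.
  obtain ⟨r₁, hr₁, hquad⟩ := exists_quadForm_sub_nonpos (hasStrictFDerivAt_pertField g up θp)
    (α := p ^ 2 - k ^ 2) (β := k - p * A) (ε := A ^ 2 - 1) hm0 (by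
      intro v
      obtain ⟨j1, j2⟩ := hsJ v
      have e : (p ^ 2 - k ^ 2) * v.1 * (pertLin g up θp v).1 + (k - p * A) *
          (v.1 * (pertLin g up θp v).2 + v.2 * (pertLin g up θp v).1) +
          (A ^ 2 - 1) * v.2 * (pertLin g up θp v).2 =
          (p * v.1 - A * v.2) * (p * (pertLin g up θp v).1 - A * (pertLin g up θp v).2) -
          (v.2 - k * v.1) * ((pertLin g up θp v).2 - k * (pertLin g up θp v).1) := by ring
      rw [e, j1, j2]
      set s := v.2 - k * v.1 with hs
      set t := p * v.1 - A * v.2 with ht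
      have hv := hframe v
      rw [← hs, ← ht] at hv
      have hv1 : v.1 = s * A + t := by
        have := congrArg Prod.fst hv; simp at this; linarith
      have hv2 : v.2 = s * p + t * k := by
        have := congrArg Prod.snd hv; simp at this; linarith
      have hsq : sqLen v ≤ K * (s ^ 2 + t ^ 2) := by
        unfold sqLen
        rw [hv1, hv2, hK]
        nlinarith [sq_nonneg (s * A - t), sq_nonneg (s * p - t * k), mul_nonneg (sq_nonneg s) (sq_nonneg k),
          sq_nonneg s, sq_nonneg t, mul_nonneg (sq_nonneg t) (sq_nonneg A),
          mul_nonneg (sq_nonneg t) (sq_nonneg p)]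
      have h1 : m * sqLen v ≤ m * (K * (s ^ 2 + t ^ 2)) := mul_le_mul_of_nonneg_left hsq hm0.le
      have h2 : m * (K * (s ^ 2 + t ^ 2)) = min l₁ (-l₂) * (s ^ 2 + t ^ 2) := by
        rw [hm]; field_simp
      have h3 : min l₁ (-l₂) * s ^ 2 ≤ -l₂ * s ^ 2 :=
        mul_le_mul_of_nonneg_right (min_le_right _ _) (sq_nonneg s)
      have h4 : min l₁ (-l₂) * t ^ 2 ≤ l₁ * t ^ 2 :=
        mul_le_mul_of_nonneg_right (min_le_left _ _) (sq_nonneg t)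
      nlinarith)
  -- a small interval of parameters
  have hWc : ContinuousAt W 0 := (hW 0 h0).1.continuousAt
  have ev1 : ∀ᶠ z in 𝓝 (0 : ℝ), z ∈ Ioo (-r) r := Ioo_mem_nhds h0.1 h0.2
  have ev2 : ∀ᶠ z in 𝓝 (0 : ℝ), sqLen (W z) < r₁ ^ 2 := by
    refine (continuous_sqLen.continuousAt.comp hWc).eventually_lt_const ?_
    simp only [Function.comp, hW0, sqLen]
    simp
    positivity
  have ev3 : ∀ᶠ z in 𝓝 (0 : ℝ), 0 < up + (W z).1 := by
    refine (continuousAt_const.add hW1d.continuousAt).eventually_const_lt ?_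
    simpa [hW0] using hup
  have ev4 : ∀ᶠ z in 𝓝 (0 : ℝ), 0 < θp + (W z).2 := by
    refine (continuousAt_const.add hW2d.continuousAt).eventually_const_lt ?_
    simpa [hW0] using hθp
  have ev5 : ∀ᶠ z in 𝓝 (0 : ℝ), 0 < deriv S z := by
    have hc : ContinuousAt (deriv S) 0 :=
      (hSs.continuousOn_deriv_of_isOpen isOpen_Ioo (by simp)).continuousAt (Ioo_mem_nhds h0.1 h0.2)
    refine hc.eventually_const_lt ?_
    rw [hSd.deriv]; exact one_pos
  have ev6 : ∀ᶠ z in 𝓝 (0 : ℝ), |S z - z| ≤ 1 / 2 * |z| := by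
    have := (hasDerivAt_iff_isLittleO.1 hSd).bound (show (0 : ℝ) < 1 / 2 by norm_num)
    simpa [hS0] using this
  have ev7 : ∀ᶠ z in 𝓝 (0 : ℝ), ‖W z - z • (A, p)‖ ≤ 1 * |z| := by
    have h := (hW 0 h0).1
    rw [hW'0] at h
    have := (hasDerivAt_iff_isLittleO.1 h).bound one_pos
    simpa [hW0] using this
  obtain ⟨z₀, hz₀, hall⟩ := Metric.eventually_nhds_iff.1
    (ev1.and (ev2.and (ev3.and (ev4.and (ev5.and (ev6.and ev7))))))
  have hall' : ∀ z, |z| < z₀ → _ := fun z hz => @hall z (by simpa using hz)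
  set z₁ := z₀ / 2 with hz₁
  have hz₁0 : 0 < z₁ := by positivity
  have hz₁z : ∀ z, |z| ≤ z₁ → |z| < z₀ := fun z hz => by linarith
  have hsub : Ioo (-z₀) z₀ ⊆ Ioo (-r) r := fun z hz => (hall' z (abs_lt.2 hz)).1
  obtain ⟨hmono, kf, hks, hk1, hk2⟩ := exists_smooth_inverse (S := S) (show z₁ < z₀ by linarith) hz₁0
    (hSs.mono hsub) fun z hz => (hall' z (abs_lt.2 hz)).2.2.2.2.1
  have hz0 : (0 : ℝ) ∈ Ioo (-z₁) z₁ := ⟨by linarith, hz₁0⟩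
  have hz0' : (0 : ℝ) ∈ Ioo (-z₀) z₀ := ⟨by linarith, hz₀⟩
  obtain ⟨hSab, hk0⟩ := hk1 0 hz0
  rw [hS0] at hSab hk0
  obtain ⟨hSa, hSb⟩ : S (-z₁) < 0 ∧ 0 < S z₁ := hSab
  have hWr : ∀ z, |z| ≤ z₁ → |z| < r := fun z hz => abs_lt.2 (hall' z (hz₁z z hz)).1
  set C := max (‖((A, p) : ℝ × ℝ)‖ + 1) (2 * (1 + |k|)) with hC
  have hC1 : ‖((A, p) : ℝ × ℝ)‖ + 1 ≤ C := le_max_left _ _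
  have hC2 : 2 * (1 + |k|) ≤ C := le_max_right _ _
  have hC0 : 0 < C := lt_of_lt_of_le (by positivity) hC1
  have hSle : ∀ q : ℝ × ℝ, |q.2 - k * q.1| ≤ (1 + |k|) * ‖q‖ := by
    intro q
    have h1 : |q.1| ≤ ‖q‖ := norm_fst_le q
    have h2 : |q.2| ≤ ‖q‖ := norm_snd_le q
    calc |q.2 - k * q.1| ≤ |q.2| + |k| * |q.1| := by rw [← abs_mul]; exact abs_sub _ _
      _ ≤ ‖q‖ + |k| * ‖q‖ := by gcongr
      _ = _ := by ring
  have hlow : ∀ z, |z| ≤ z₁ → |z| ≤ C * ‖W z‖ := by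
    intro z hz
    have h6 := (hall' z (hz₁z z hz)).2.2.2.2.2.1
    have h1 := abs_sub_abs_le_abs_sub z (S z)
    rw [abs_sub_comm z] at h1
    have h2 : |z| ≤ 2 * |S z| := by linarith
    have h3 := hSle (W z)
    calc |z| ≤ 2 * |S z| := h2
      _ ≤ 2 * (1 + |k|) * ‖W z‖ := by rw [hSapp]; linarith
      _ ≤ C * ‖W z‖ := by gcongr
  -- openness of the parametrized neighbourhood
  obtain ⟨δ₁, hδ₁, hstay⟩ := exists_forall_stay g hup hθp hr₁
  set σ := min (-S (-z₁)) (S z₁) with hσ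
  have hσ0 : 0 < σ := lt_min (neg_pos.2 hSa) hSb
  set δ := min δ₁ (σ / (2 * (1 + |k|))) with hδ
  have hδ0 : 0 < δ := by positivity
  refine ⟨W, z₁, C, δ, hz₁0, hC0, hδ0, hW0, ?_, ?_, ?_, ?_⟩
  · intro z hz
    obtain ⟨-, -, h3, h4, -, -, h7⟩ := hall' z (hz₁z z hz)
    refine ⟨?_, hlow z hz, h3, h4, isDecayingOrbit_curve hl₂ hW0 hW (hWr z hz), fun h => ?_, fun h => ?_⟩
    · calc ‖W z‖ = ‖z • ((A, p) : ℝ × ℝ) + (W z - z • (A, p))‖ := by rw [add_sub_cancel]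
        _ ≤ |z| * ‖((A, p) : ℝ × ℝ)‖ + 1 * |z| := by
            refine (norm_add_le _ _).trans (add_le_add ?_ h7)
            rw [norm_smul, Real.norm_eq_abs]
        _ = (‖((A, p) : ℝ × ℝ)‖ + 1) * |z| := by ring
        _ ≤ C * |z| := by gcongr
    · have := hmono hz0' (abs_lt.1 (hz₁z z hz)) h
      rwa [hS0, hSapp] at this
    · have := hmono (abs_lt.1 (hz₁z z hz)) hz0' h
      rwa [hS0, hSapp] at this
  -- With the stable coordinate as abscissa the curve is the graph of `T ∘ S⁻¹`, which is flat at 0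
  -- because `T` has zero derivative there.
  · refine ⟨S (-z₁), S z₁, fun s => T (kf s), hSa, hSb, ?_, ?_, ?_, ?_⟩
    · refine (hTs.mono ?_).comp hks fun s hs => (hk2 s hs).1
      exact (Ioo_subset_Ioo (by linarith) (by linarith)).trans hsub
    · simp only [hk0, hT0]
    · have hkd : HasDerivAt kf (deriv kf 0) 0 :=
        ((hks.contDiffAt (Ioo_mem_nhds hSa hSb)).differentiableAt (by simp)).hasDerivAt
      have hTd' : HasDerivAt T 0 (kf 0) := by rw [hk0]; exact hTd
      have := hTd'.comp (0 : ℝ) hkd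
      rw [zero_mul] at this
      exact this.deriv
    · ext q
      constructor
      · rintro ⟨z, hz, rfl⟩
        obtain ⟨h1, h2⟩ := hk1 z hz
        refine ⟨S z, h1, ?_⟩
        have h3 := hframe (W z)
        rw [← hSapp, ← hTapp] at h3
        simp only [h2]
        exact h3
      · rintro ⟨s, hs, rfl⟩
        obtain ⟨h1, h2⟩ := hk2 s hs
        refine ⟨kf s, h1, ?_⟩
        have h3 := hframe (W (kf s))
        rw [← hSapp, ← hTapp, h2] at h3
        exact h3.symm
  · intro ε hε
    have := (hasDerivAt_iff_isLittleO.1 hTd).bound (show 0 < ε / C by positivity)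
    obtain ⟨η, hη, h⟩ := Metric.eventually_nhds_iff.1 this
    refine ⟨η, hη, fun z hz hzη => ?_⟩
    have h1 := @h z (by simpa using hzη)
    simp only [hT0, sub_zero, smul_zero, Real.norm_eq_abs] at h1
    rw [← hTapp]
    calc |T z| ≤ ε / C * |z| := h1
      _ ≤ ε / C * (C * ‖W z‖) := by gcongr; exact hlow z hz
      _ = ε * ‖W z‖ := by field_simp
  · intro w hw hU hΘ hw0
    have hstay' := hstay w hw hU hΘ (hw0.trans (by gcongr; exact min_le_left _ _))
    have hn : ‖w 0‖ ≤ δ := by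
      have := abs_le_of_sq_le_sq' ((norm_sq_le_sqLen (w 0)).trans hw0) hδ0.le
      exact this.2
    have hs : |(w 0).2 - k * (w 0).1| < σ := by
      calc |(w 0).2 - k * (w 0).1| ≤ (1 + |k|) * ‖w 0‖ := hSle _
        _ ≤ (1 + |k|) * (σ / (2 * (1 + |k|))) := by
            gcongr; exact hn.trans (min_le_right _ _)
        _ = σ / 2 := by field_simp
        _ < σ := by linarith
    obtain ⟨hs1, hs2⟩ := abs_lt.1 hs
    have hmem : (w 0).2 - k * (w 0).1 ∈ Ioo (S (-z₁)) (S z₁) :=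
      ⟨by linarith [min_le_left (-S (-z₁)) (S z₁)], by linarith [min_le_right (-S (-z₁)) (S z₁)]⟩
    obtain ⟨hz, hSz⟩ := hk2 _ hmem
    -- The point of the curve with the same stable coordinate as `w 0`. The difference then has `s =
    -- 0`, and `t² - s² ≤ 0` forces `t = 0`.
    set z := kf ((w 0).2 - k * (w 0).1) with hzdef
    have hzle : |z| ≤ z₁ := (abs_lt.2 hz).le
    refine ⟨z, hz, ?_⟩
    have hcurve := isDecayingOrbit_curve hl₂ hW0 hW (hWr z hzle)
    have hsmall : ∀ ξ : ℝ, 0 ≤ ξ → sqLen (W (z * Real.exp (l₂ * ξ))) < r₁ ^ 2 := by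
      intro ξ hξ
      refine (hall' _ (hz₁z _ ?_)).2.1
      rw [abs_mul, abs_of_pos (Real.exp_pos _)]
      refine (mul_le_of_le_one_right (abs_nonneg z) (Real.exp_le_one_iff.2 ?_)).trans hzle
      exact mul_nonpos_of_nonpos_of_nonneg hl₂.le hξ
    have hq := hquad w _ hw hcurve hstay' hsmall
    simp only [mul_zero, Real.exp_zero, mul_one] at hq
    set v := w 0 - W z with hv
    have hvs : v.2 - k * v.1 = 0 := by
      have h1 : (W z).2 - k * (W z).1 = (w 0).2 - k * (w 0).1 := by rw [← hSapp, hSz]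
      simp only [hv, Prod.fst_sub, Prod.snd_sub]
      linarith
    have hvt : (p * v.1 - A * v.2) ^ 2 ≤ 0 := by
      have e : (p * v.1 - A * v.2) ^ 2 = (p ^ 2 - k ^ 2) * v.1 ^ 2 + 2 * (k - p * A) * (v.1 * v.2)
        + (A ^ 2 - 1) * v.2 ^ 2 + (v.2 - k * v.1) ^ 2 := by ring
      rw [e, hvs]
      linarith
    have hvt' : p * v.1 - A * v.2 = 0 := pow_eq_zero_iff two_ne_zero |>.1 (le_antisymm hvt (sq_nonneg _))
    have := hframe v
    rw [hvs, hvt', zero_smul, zero_smul, add_zero] at this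
    exact sub_eq_zero.1 this.symm

end Gas

/-- Adjusting the length along the ray costs `|σ ‖e‖ - ‖w‖|`, at most `‖w - σ e‖` by the triangle
inequality. So tangency to a ray may be tested with any convenient nonnegative coefficient. -/
lemma norm_sub_ray_le {E : Type*} [NormedAddCommGroup E] [NormedSpace ℝ E] {e : E} (he : e ≠ 0)
    (w : E) {σ : ℝ} (hσ : 0 ≤ σ) : ‖w - (‖w‖ / ‖e‖) • e‖ ≤ 2 * ‖w - σ • e‖ := by
  have he' : 0 < ‖e‖ := norm_pos_iff.2 he
  have h1 : ‖(σ - ‖w‖ / ‖e‖) • e‖ ≤ ‖w - σ • e‖ := by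
    have h2 := abs_norm_sub_norm_le (σ • e) w
    rw [norm_smul, Real.norm_eq_abs, abs_of_nonneg hσ] at h2
    rw [norm_smul, Real.norm_eq_abs, ← abs_of_pos he', ← abs_mul, abs_of_pos he', sub_mul,
      div_mul_cancel₀ _ he'.ne', norm_sub_rev w]
    exact h2
  calc ‖w - (‖w‖ / ‖e‖) • e‖ = ‖(w - σ • e) + (σ - ‖w‖ / ‖e‖) • e‖ := by
        congr 1; module
    _ ≤ ‖w - σ • e‖ + ‖w - σ • e‖ := (norm_add_le _ _).trans (by gcongr)
    _ = _ := by ring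

lemma exists_exp_shift {l z z₁ : ℝ} (hl : l < 0) (hz : 0 < z) (hz₁ : z < z₁) :
    ∃ s, 0 < s ∧ z = z₁ * Real.exp (l * s) := by
  have h1 : 0 < z₁ := hz.trans hz₁
  refine ⟨Real.log (z / z₁) / l, div_pos_of_neg_of_neg (Real.log_neg (by positivity)
    ((div_lt_one h1).2 hz₁)) hl, ?_⟩
  rw [mul_div_cancel₀ _ hl.ne, Real.exp_log (by positivity)]
  field_simp

lemma exp_shift_mem {l z₁ s : ℝ} (hl : l < 0) (hz₁ : 0 < z₁) (hs : 0 < s) :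
    z₁ * Real.exp (l * s) ∈ Ioo 0 z₁ :=
  ⟨by positivity, mul_lt_of_lt_one_right hz₁ (Real.exp_lt_one_iff.2 (mul_neg_of_neg_of_pos hl hs))⟩

/-! ### Tangency and the subsonic case -/

section Gas

variable {g : Gas} {up θp : ℝ}

lemma isTrajectoryInto_of_orbit {v : ℝ → ℝ × ℝ} (hv : IsDecayingOrbit (pertField g up θp) v)
    (hne : ∀ ξ, 0 < ξ → v ξ ≠ 0) :
    IsTrajectoryInto (blField g up θp) (up, θp) ((fun ξ => (up, θp) + v ξ) '' Ioi 0) := by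
  refine ⟨fun ξ => (up, θp) + v ξ, fun ξ hξ => ?_, fun ξ hξ h => ?_, ?_, rfl⟩
  · rw [blField_add]
    exact (hv.ode ξ hξ).const_add _
  · exact hne ξ hξ (by simpa using h)
  · simpa using hv.lim.const_add (up, θp)

/-- Closeness to `p` in the plane forces a small parameter, because `|z| ≤ C ‖W z‖`; an estimate in
the parameter thus becomes one in the plane. -/
lemma tangentToLine_of_curve {W : ℝ → ℝ × ℝ} {z₁ C a b : ℝ} {p : ℝ × ℝ} {G : Set (ℝ × ℝ)}
    (hC : 0 < C) (hG : ∀ q ∈ G, ∃ z, |z| ≤ z₁ ∧ q = p + W z) (hW : ∀ z, |z| ≤ z₁ → |z| ≤ C * ‖W z‖)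
    (h : ∀ ε, 0 < ε → ∃ η, 0 < η ∧ ∀ z, |z| ≤ z₁ → |z| < η →
      |a * (W z).1 + b * (W z).2| ≤ ε * ‖W z‖) : TangentToLine G p a b := by
  unfold TangentToLine
  rw [isLittleO_iff]
  intro ε hε
  obtain ⟨η, hη, hb⟩ := h ε hε
  rw [eventually_nhdsWithin_iff, Metric.eventually_nhds_iff]
  refine ⟨η / C, by positivity, fun q hq hqG => ?_⟩
  obtain ⟨z, hz, rfl⟩ := hG q hqG
  rw [dist_eq_norm, add_sub_cancel_left] at hq
  have h1 : |z| < η := (hW z hz).trans_lt (by rwa [lt_div_iff₀ hC, mul_comm] at hq)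
  rw [add_sub_cancel_left, Real.norm_eq_abs]
  simpa using hb z hz h1

/-- The sign of `σ` selects the side on which the curve arrives, and `norm_sub_ray_le` reduces the
claim to smallness of the transversal coordinate `τ`. -/
lemma tangentToRay_of_curve {W : ℝ → ℝ × ℝ} {z₁ C : ℝ} {p e e' : ℝ × ℝ} {G : Set (ℝ × ℝ)}
    {σ τ : ℝ × ℝ → ℝ} (hC : 0 < C) (he : e ≠ 0) (hst : ∀ q, q = σ q • e + τ q • e')
    (hG : ∀ q ∈ G, ∃ z, |z| ≤ z₁ ∧ q = p + W z ∧ 0 ≤ σ (W z))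
    (hW : ∀ z, |z| ≤ z₁ → |z| ≤ C * ‖W z‖)
    (h : ∀ ε, 0 < ε → ∃ η, 0 < η ∧ ∀ z, |z| ≤ z₁ → |z| < η → |τ (W z)| ≤ ε * ‖W z‖) :
    TangentToRay G p e := by
  unfold TangentToRay
  rw [isLittleO_iff]
  intro ε hε
  obtain ⟨η, hη, hb⟩ := h (ε / (2 * (‖e'‖ + 1))) (by positivity)
  rw [eventually_nhdsWithin_iff, Metric.eventually_nhds_iff]
  refine ⟨η / C, by positivity, fun q hq hqG => ?_⟩
  obtain ⟨z, hz, rfl, hσ⟩ := hG q hqG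
  rw [dist_eq_norm, add_sub_cancel_left] at hq
  have h1 : |z| < η := (hW z hz).trans_lt (by rwa [lt_div_iff₀ hC, mul_comm] at hq)
  rw [add_sub_cancel_left]
  refine (norm_sub_ray_le he (W z) hσ).trans ?_
  have h2 : W z - σ (W z) • e = τ (W z) • e' := by
    rw [sub_eq_iff_eq_add, add_comm]; exact hst _
  rw [h2, norm_smul, Real.norm_eq_abs]
  calc 2 * (|τ (W z)| * ‖e'‖) ≤ 2 * (ε / (2 * (‖e'‖ + 1)) * ‖W z‖ * (‖e'‖ + 1)) := by
        gcongr
        · exact hb z hz h1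
        · linarith
    _ = ε * ‖W z‖ := by field_simp

/-- The subsonic case. -/
theorem subsonic_case (g : Gas) (hup : 0 < up) (hθp : 0 < θp) (hM : mach g up θp < 1) :
    ∃ δ : ℝ, 0 < δ ∧ IsSaddle (blField g up θp) (up, θp) ∧
        ∃ (c₂ l₁ l₂ a₂ : ℝ) (Γ₁ Γ₂ M : Set (ℝ × ℝ)),
          0 < c₂ ∧
          c₂ ^ 2 + ((mach g up θp ^ 2 * g.γ - 1) / (mach g up θp ^ 2 * g.R * g.γ)
              - g.μ / (g.κ * (g.γ - 1))) * c₂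
            - g.μ / (mach g up θp ^ 2 * g.R * g.γ * g.κ) = 0 ∧
          0 < l₁ ∧ l₂ < 0 ∧
          Module.End.HasEigenvalue (Matrix.toLin' (linPart g up θp)) l₁ ∧
          Module.End.HasEigenvalue (Matrix.toLin' (linPart g up θp)) l₂ ∧
          a₂ = -(g.R / (g.μ * (l₁ - l₂))) ∧
          IsTrajectoryInto (blField g up θp) (up, θp) Γ₁ ∧
          IsTrajectoryInto (blField g up θp) (up, θp) Γ₂ ∧
          M = Γ₁ ∪ {(up, θp)} ∪ Γ₂ ∧
          IsSmoothGraphOver M (up, θp) (a₂, 1 + a₂ * c₂ * up) (1, c₂ * up) ∧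
          TangentToLine M (up, θp) (1 + a₂ * c₂ * up) (-a₂) ∧
          TangentToRay Γ₁ (up, θp) (a₂, 1 + a₂ * c₂ * up) ∧
          TangentToRay Γ₂ (up, θp) (-(a₂, 1 + a₂ * c₂ * up)) ∧
          (∀ vm um θm vp : ℝ, 0 < vm → 0 < um → 0 < θm → 0 < vp →
            0 < len (up - um) (θp - θm) → len (up - um) (θp - θm) ≤ δ →
            SolvableIff g vm um θm vp up θp M ∧ AtMostOneSolution g vm um θm vp up θp) ∧
          ∃ c : ℝ, 0 < c ∧ ∀ n : ℕ, ∃ C : ℝ, 0 < C ∧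
            ∀ vm um θm vp : ℝ, 0 < vm → 0 < um → 0 < θm → 0 < vp →
            0 < len (up - um) (θp - θm) → len (up - um) (θp - θm) ≤ δ →
            ∀ V U Θ : ℝ → ℝ, IsBLSolution g vm um θm vp up θp V U Θ →
              ContDiffOn ℝ ∞ U (Ici 0) ∧ ContDiffOn ℝ ∞ Θ (Ici 0) ∧
              ∀ ξ : ℝ, 0 ≤ ξ → (U ξ, Θ ξ) ∈ M ∧
                derivLen n up θp U Θ ξ ≤
                  C * len (up - um) (θp - θm) * Real.exp (-(c * ξ)) := by
  obtain ⟨c₂, l₁, l₂, a₂, hc₂, hquad, hl₁, hl₂, ha₂, he, he', hchar⟩ :=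
    exists_subsonic_spectrum g hup hθp hM
  obtain ⟨W, z₁, C, δ, hz₁, hC, hδ, hW0, hW, ⟨a, b, h, ha, hb, hhs, hh0, hh'0, himg⟩, htan, hall⟩ :=
    exists_stable_curve g hup hθp hl₁ hl₂ (p := 1 + a₂ * c₂ * up) (A := a₂) (k := c₂ * up)
      (by ring) hchar he he'
  have he'0 : ((1, c₂ * up) : ℝ × ℝ) ≠ 0 := fun h => one_ne_zero (congrArg Prod.fst h)
  have ha₂0 : a₂ ≠ 0 := by
    have hs : 0 < l₁ - l₂ := by linarith
    have := g.R_pos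
    have := g.μ_pos
    have : 0 < g.R / (g.μ * (l₁ - l₂)) := by positivity
    rw [ha₂]; linarith
  have he0 : ((a₂, 1 + a₂ * c₂ * up) : ℝ × ℝ) ≠ 0 := fun h => ha₂0 (congrArg Prod.fst h)
  have hWne : ∀ z, |z| ≤ z₁ → z ≠ 0 → W z ≠ 0 := by
    intro z hz hz0 h0
    have := (hW z hz).2.1
    rw [h0, norm_zero, mul_zero] at this
    exact hz0 (abs_nonpos_iff.1 this)
  have hlow : ∀ z, |z| ≤ z₁ → |z| ≤ C * ‖W z‖ := fun z hz => (hW z hz).2.1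
  have habs : |z₁| = z₁ := abs_of_pos hz₁
  have habs' : |-z₁| = z₁ := by rw [abs_neg, habs]
  have hv₁ := (hW z₁ habs.le).2.2.2.2.1
  have hv₂ := (hW (-z₁) habs'.le).2.2.2.2.1
  set Γ₁ : Set (ℝ × ℝ) := (fun ξ => (up, θp) + W (z₁ * Real.exp (l₂ * ξ))) '' Ioi 0 with hΓ₁
  set Γ₂ : Set (ℝ × ℝ) := (fun ξ => (up, θp) + W (-z₁ * Real.exp (l₂ * ξ))) '' Ioi 0 with hΓ₂
  set M : Set (ℝ × ℝ) := (fun z => (up, θp) + W z) '' Ioo (-z₁) z₁ with hMdef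
  have hΓ₁z : ∀ q ∈ Γ₁, ∃ z, 0 < z ∧ |z| ≤ z₁ ∧ q = (up, θp) + W z := by
    rintro q ⟨ξ, hξ, rfl⟩
    have := exp_shift_mem hl₂ hz₁ hξ
    exact ⟨_, this.1, by rw [abs_of_pos this.1]; exact this.2.le, rfl⟩
  have hΓ₂z : ∀ q ∈ Γ₂, ∃ z, z < 0 ∧ |z| ≤ z₁ ∧ q = (up, θp) + W z := by
    rintro q ⟨ξ, hξ, rfl⟩
    have := exp_shift_mem hl₂ hz₁ hξ
    refine ⟨-z₁ * Real.exp (l₂ * ξ), by linarith [this.1], ?_, rfl⟩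
    rw [neg_mul, abs_neg, abs_of_pos this.1]; exact this.2.le
  have hMz : ∀ q ∈ M, ∃ z, |z| ≤ z₁ ∧ q = (up, θp) + W z := by
    rintro q ⟨z, hz, rfl⟩
    exact ⟨z, (abs_lt.2 hz).le, rfl⟩
  have hst : ∀ q : ℝ × ℝ, q = (q.2 - c₂ * up * q.1) • ((a₂, 1 + a₂ * c₂ * up) : ℝ × ℝ) +
      ((1 + a₂ * c₂ * up) * q.1 - a₂ * q.2) • ((1, c₂ * up) : ℝ × ℝ) := by
    intro q
    refine Prod.ext ?_ ?_ <;> simp <;> ring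
  -- every orbit on the curve is a shift of one of two orbits
  have hshift : ∀ z ∈ Ioo (-z₁) z₁, z ≠ 0 → ∃ s, 0 < s ∧ |z| = z₁ * Real.exp (l₂ * s) ∧
      (z = z₁ * Real.exp (l₂ * s) ∨ z = -z₁ * Real.exp (l₂ * s)) := by
    intro z hz hz0
    rcases lt_or_gt_of_ne hz0 with h | h
    · obtain ⟨s, hs, e⟩ := exists_exp_shift hl₂ (neg_pos.2 h) (show -z < z₁ by linarith [hz.1])
      exact ⟨s, hs, by rw [abs_of_neg h, e], Or.inr (by linarith)⟩
    · obtain ⟨s, hs, e⟩ := exists_exp_shift hl₂ h hz.2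
      exact ⟨s, hs, by rw [abs_of_pos h, e], Or.inl e⟩
  have hlen : ∀ um θm : ℝ, len (up - um) (θp - θm) ≤ δ → sqLen (um - up, θm - θp) ≤ δ ^ 2 := by
    intro um θm h
    rw [len_sub_eq] at h
    exact (Real.sqrt_le_left hδ.le).1 h
  refine ⟨δ, hδ, ⟨blField_equilibrium g up θp, (hasFDerivAt_blField g up θp).differentiableAt,
    l₁, l₂, hl₁, hl₂, ?_, ?_⟩, c₂, l₁, l₂, a₂, Γ₁, Γ₂, M, hc₂, hquad, hl₁, hl₂,
    hasEigenvalue_linPart he'0 he', hasEigenvalue_linPart he0 he, ha₂,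
    isTrajectoryInto_of_orbit hv₁ ?_, isTrajectoryInto_of_orbit hv₂ ?_, ?_, ?_, ?_, ?_, ?_, ?_, ?_⟩
  · rw [(hasFDerivAt_blField g up θp).fderiv]
    exact hasEigenvalue_of_apply_eq he'0 he'
  · rw [(hasFDerivAt_blField g up θp).fderiv]
    exact hasEigenvalue_of_apply_eq he0 he
  · intro ξ hξ
    have := exp_shift_mem hl₂ hz₁ hξ
    exact hWne _ (by rw [abs_of_pos this.1]; exact this.2.le) this.1.ne'
  · intro ξ hξ
    have := exp_shift_mem hl₂ hz₁ hξ
    refine hWne _ (by rw [neg_mul, abs_neg, abs_of_pos this.1]; exact this.2.le) ?_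
    rw [neg_mul]
    exact neg_ne_zero.2 this.1.ne'
  · ext q
    constructor
    · rintro ⟨z, hz, rfl⟩
      by_cases hz0 : z = 0
      · refine Or.inl (Or.inr ?_)
        simp [hz0, hW0]
      · obtain ⟨s, hs, -, e | e⟩ := hshift z hz hz0
        · exact Or.inl (Or.inl ⟨s, hs, by simp only [e]⟩)
        · exact Or.inr ⟨s, hs, by simp only [e]⟩
    · rintro ((⟨ξ, hξ, rfl⟩ | rfl) | ⟨ξ, hξ, rfl⟩)
      · have := exp_shift_mem hl₂ hz₁ hξ
        exact ⟨_, ⟨by linarith [this.1], this.2⟩, rfl⟩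
      · exact ⟨0, ⟨by linarith, hz₁⟩, by simp [hW0]⟩
      · have := exp_shift_mem hl₂ hz₁ hξ
        exact ⟨_, ⟨by linarith [this.2], by linarith [this.1]⟩, rfl⟩
  · refine ⟨a, b, h, ha, hb, hhs, hh0, hh'0, ?_⟩
    have h1 : M = (fun q => (up, θp) + q) '' (W '' Ioo (-z₁) z₁) := by
      rw [hMdef, ← image_comp]; rfl
    rw [h1, himg, ← image_comp]
    refine image_congr fun s _ => ?_
    simp only [Function.comp]
    rw [add_assoc]
  · refine tangentToLine_of_curve hC hMz hlow fun ε hε => ?_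
    obtain ⟨η, hη, h⟩ := htan ε hε
    refine ⟨η, hη, fun z hz hz' => ?_⟩
    have := h z hz hz'
    rwa [show (1 + a₂ * c₂ * up) * (W z).1 + -a₂ * (W z).2 =
      (1 + a₂ * c₂ * up) * (W z).1 - a₂ * (W z).2 by ring]
  · refine tangentToRay_of_curve hC he0 hst (fun q hq => ?_) hlow htan
    obtain ⟨z, hz0, hz, rfl⟩ := hΓ₁z q hq
    exact ⟨z, hz, rfl, ((hW z hz).2.2.2.2.2.1 hz0).le⟩
  · refine tangentToRay_of_curve (σ := fun q => -(q.2 - c₂ * up * q.1))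
      (τ := fun q => (1 + a₂ * c₂ * up) * q.1 - a₂ * q.2) (e' := (1, c₂ * up)) hC (neg_ne_zero.2 he0)
      (fun q => ?_) (fun q hq => ?_) hlow htan
    · simp only [neg_smul_neg]
      exact hst q
    · obtain ⟨z, hz0, hz, rfl⟩ := hΓ₂z q hq
      exact ⟨z, hz, rfl, by linarith [(hW z hz).2.2.2.2.2.2 hz0]⟩
  · intro vm um θm vp hvm hum hθm hvp hpos hle
    refine ⟨solvableIff_of_orbit hvm hum hvp ?_ ?_, atMostOneSolution hvm hum hvp⟩
    · intro w hw hU hΘ hw0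
      obtain ⟨z, hz, e⟩ := hall w hw hU hΘ (by rw [hw0]; exact hlen um θm hle)
      refine ⟨z, hz, ?_⟩
      simp only [← e, hw0]
      simp
    · rintro ⟨z, hz, e⟩
      have hz' : |z| ≤ z₁ := (abs_lt.2 hz).le
      have hz'' : ∀ ξ : ℝ, 0 ≤ ξ → |z * Real.exp (l₂ * ξ)| ≤ z₁ := by
        intro ξ hξ
        rw [abs_mul, abs_of_pos (Real.exp_pos _)]
        refine (mul_le_of_le_one_right (abs_nonneg z) (Real.exp_le_one_iff.2 ?_)).trans hz'
        exact mul_nonpos_of_nonpos_of_nonneg hl₂.le hξ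
      refine ⟨_, (hW z hz').2.2.2.2.1, fun ξ hξ => (hW _ (hz'' ξ hξ)).2.2.1,
        fun ξ hξ => (hW _ (hz'' ξ hξ)).2.2.2.1, ?_⟩
      simp only [mul_zero, Real.exp_zero, mul_one]
      have e' : W z = (um, θm) - (up, θp) := by rw [← e]; simp
      simpa using e'
  · refine ⟨-l₂, neg_pos.2 hl₂, fun n => ?_⟩
    have hbd : ∀ ζ : ℝ, |ζ| = z₁ → ∃ D, 0 < D ∧ ∀ ξ, 0 < ξ →
        |iteratedDeriv n (fun ξ => (W (ζ * Real.exp (l₂ * ξ))).1) ξ| +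
        |iteratedDeriv n (fun ξ => (W (ζ * Real.exp (l₂ * ξ))).2) ξ| ≤ D * Real.exp (l₂ * ξ) := by
      intro ζ hζ
      have hx1 : ∀ ξ : ℝ, 0 < ξ → Real.exp (l₂ * ξ) ≤ 1 := fun ξ hξ =>
        Real.exp_le_one_iff.2 (mul_nonpos_of_nonpos_of_nonneg hl₂.le hξ.le)
      obtain ⟨⟨D₁, hD₁, h1⟩, ⟨D₂, hD₂, h2⟩⟩ := derivBound_orbit
        (hW ζ hζ.le).2.2.2.2.1.ode (x := fun ξ => Real.exp (l₂ * ξ))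
        (fun ξ _ => (Real.exp_pos _).le) hx1 (C := C * z₁) (by positivity) (by
          intro ξ hξ
          have h3 : |ζ * Real.exp (l₂ * ξ)| = z₁ * Real.exp (l₂ * ξ) := by
            rw [abs_mul, hζ, abs_of_pos (Real.exp_pos _)]
          have := (hW (ζ * Real.exp (l₂ * ξ)) (by
            rw [h3]; exact mul_le_of_le_one_right hz₁.le (hx1 ξ hξ))).1
          rw [h3] at this
          linarith) n
      refine ⟨D₁ + D₂, by positivity, fun ξ hξ => ?_⟩
      have e1 := h1 n le_rfl ξ hξ
      have e2 := h2 n le_rfl ξ hξ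
      simp only [Pi.one_apply, one_pow, mul_one, pow_one] at e1 e2
      linarith
    obtain ⟨D₁, hD₁, hb₁⟩ := hbd z₁ habs
    obtain ⟨D₂, hD₂, hb₂⟩ := hbd (-z₁) habs'
    -- `D₁`, `D₂` bound the two reference orbits. The time shift `s` contributes `exp (l₂ s) = |z| /
    -- z₁`, and `|z|` is at most `C` times the size of the data; this is the linear factor in the
    -- estimate.
    refine ⟨(D₁ + D₂) * (C / z₁), by positivity, ?_⟩
    intro vm um θm vp hvm hum hθm hvp hpos hle V U Θ hsol
    have hpert := hsol.isPertSolution hvm hum hvp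
    have horb := hpert.orbit
    have hw0 : (U 0 - up, Θ 0 - θp) = (um - up, θm - θp) := by rw [hsol.U_zero, hsol.Θ_zero]
    obtain ⟨z, hz, e⟩ := hall _ horb hpert.U_pos hpert.Θ_pos (by
      simp only [hw0]; exact hlen um θm hle)
    simp only [hw0] at e
    have hz' : |z| ≤ z₁ := (abs_lt.2 hz).le
    have hz0 : z ≠ 0 := by
      rintro rfl
      rw [len_sub_eq, e, hW0] at hpos
      simp [sqLen] at hpos
    have heq := horb.eqOn (locallyLipschitz_pertField g up θp) (hW z hz').2.2.2.2.1
      (by simp only [mul_zero, Real.exp_zero, mul_one, hw0, e])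
    obtain ⟨s, hs, hzs, hcase⟩ := hshift z hz hz0
    have hexp : ∀ ζ ξ : ℝ, ζ * Real.exp (l₂ * s) * Real.exp (l₂ * ξ) =
        ζ * Real.exp (l₂ * (ξ + s)) := by
      intro ζ ξ
      rw [mul_assoc, ← Real.exp_add]; congr 2; ring
    obtain ⟨ζ, hζ, hζz⟩ : ∃ ζ, |ζ| = z₁ ∧ z = ζ * Real.exp (l₂ * s) := by
      rcases hcase with h | h
      · exact ⟨z₁, habs, h⟩
      · exact ⟨-z₁, habs', h⟩
    have hbζ : ∀ ξ, 0 < ξ → |iteratedDeriv n (fun ξ => (W (ζ * Real.exp (l₂ * ξ))).1) ξ| +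
        |iteratedDeriv n (fun ξ => (W (ζ * Real.exp (l₂ * ξ))).2) ξ| ≤
        (D₁ + D₂) * Real.exp (l₂ * ξ) := by
      intro ξ hξ
      have hE := Real.exp_pos (l₂ * ξ)
      rcases eq_or_eq_neg_of_abs_eq hζ with h | h
      · rw [h]; nlinarith [hb₁ ξ hξ]
      · rw [h]; nlinarith [hb₂ ξ hξ]
    obtain ⟨hUs, hΘs, hder⟩ := regularity_of_shift (v := fun ξ => W (ζ * Real.exp (l₂ * ξ))) hs
      (contDiffOn_of_ode (contDiff_pertField g up θp) isOpen_Ioi (hW ζ hζ.le).2.2.2.2.1.ode)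
      (fun ξ hξ => by
        have := heq hξ
        simp only [hζz, hexp] at this
        exact this)
    refine ⟨hUs, hΘs, fun ξ hξ => ⟨⟨z * Real.exp (l₂ * ξ), ?_, ?_⟩, ?_⟩⟩
    · refine abs_lt.1 ?_
      rw [abs_mul, abs_of_pos (Real.exp_pos _)]
      refine (mul_le_of_le_one_right (abs_nonneg z) (Real.exp_le_one_iff.2 ?_)).trans_lt (abs_lt.2 hz)
      exact mul_nonpos_of_nonpos_of_nonneg hl₂.le hξ
    · have := heq hξ
      simp only at this
      simp only [← this]
      simp
    · refine (hder n ξ hξ).trans ((hbζ (ξ + s) (by linarith)).trans ?_)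
      have h1 : Real.exp (l₂ * s) = |z| / z₁ := by rw [hzs]; field_simp
      have h2 : |z| ≤ C * len (up - um) (θp - θm) := by
        refine (hlow z hz').trans ?_
        rw [← e, len_sub_eq]
        gcongr
        exact norm_le_sqrt_sqLen _
      have h3 : Real.exp (l₂ * (ξ + s)) = Real.exp (l₂ * s) * Real.exp (-(-l₂ * ξ)) := by
        rw [← Real.exp_add]; congr 1; ring
      rw [h3, h1]
      calc (D₁ + D₂) * (|z| / z₁ * Real.exp (-(-l₂ * ξ)))
          ≤ (D₁ + D₂) * ((C * len (up - um) (θp - θm)) / z₁ * Real.exp (-(-l₂ * ξ))) := by gcongr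
        _ = _ := by ring

end Gas

/-! ### Bounded solutions of unstable scalar equations -/

section ScalarEquations

open MeasureTheory

/-- The bounded solution of the linear equation `ζ' = l ζ + φ` with `l > 0` and bounded `φ`. -/
lemma exists_bounded_solution_linear {l B : ℝ} (hl : 0 < l) {φ : ℝ → ℝ} (hφ : Continuous φ)
    (hB : ∀ s, |φ s| ≤ B) :
    ∃ ζ : ℝ → ℝ, (∀ s, HasDerivAt ζ (l * ζ s + φ s) s) ∧ ∀ s, |ζ s| ≤ B / l := by
  set ψ : ℝ → ℝ := fun r => Real.exp (-l * r) * φ r with hψ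
  have hψc : Continuous ψ := by fun_prop
  have hexp : ∀ s, IntegrableOn (fun r => Real.exp (-l * r)) (Ioi s) := fun s =>
    integrableOn_exp_mul_Ioi (by linarith) s
  have hψb : ∀ r, ‖ψ r‖ ≤ B * Real.exp (-l * r) := by
    intro r
    rw [hψ, Real.norm_eq_abs, abs_mul, abs_of_pos (Real.exp_pos _), mul_comm]
    exact mul_le_mul_of_nonneg_right (hB r) (Real.exp_pos _).le
  have hψi : ∀ s, IntegrableOn ψ (Ioi s) := fun s =>
    ((hexp s).const_mul B).mono' hψc.aestronglyMeasurable (.of_forall hψb)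
  -- This is the negative of the integral of `exp (l (s - r)) φ r` over `r > s`, split at 0 so that
  -- the fundamental theorem of calculus applies.
  refine ⟨fun s => Real.exp (l * s) * ((∫ r in (0 : ℝ)..s, ψ r) - ∫ r in Ioi 0, ψ r),
    fun s => ?_, fun s => ?_⟩
  · have h1 : HasDerivAt (fun s => Real.exp (l * s)) (Real.exp (l * s) * l) s := by
      simpa using ((hasDerivAt_id' s).const_mul l).exp
    have h2 : HasDerivAt (fun s => ∫ r in (0 : ℝ)..s, ψ r) (ψ s) s :=
      intervalIntegral.integral_hasDerivAt_right (hψc.intervalIntegrable _ _)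
        (hψc.stronglyMeasurableAtFilter _ _) hψc.continuousAt
    refine (h1.fun_mul (h2.sub_const _)).congr_deriv ?_
    have h3 : Real.exp (l * s) * ψ s = φ s := by
      rw [hψ]
      simp only
      rw [← mul_assoc, ← Real.exp_add]
      simp
    rw [h3]
    ring
  · have h1 : (∫ r in (0 : ℝ)..s, ψ r) - ∫ r in Ioi 0, ψ r = - ∫ r in Ioi s, ψ r := by
      rw [← intervalIntegral.integral_interval_add_Ioi (hψi 0) (hψi s)]
      ring
    simp only
    rw [h1, abs_mul, abs_of_pos (Real.exp_pos _), abs_neg]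
    have h2 : |∫ r in Ioi s, ψ r| ≤ B * (Real.exp (-l * s) / l) := by
      rw [← Real.norm_eq_abs]
      refine (norm_integral_le_of_norm_le ((hexp s).const_mul B) (.of_forall hψb)).trans ?_
      rw [integral_const_mul, integral_exp_mul_Ioi (by linarith) s, neg_div_neg_eq]
    calc Real.exp (l * s) * |∫ r in Ioi s, ψ r|
        ≤ Real.exp (l * s) * (B * (Real.exp (-l * s) / l)) := by gcongr
      _ = B / l * (Real.exp (l * s) * Real.exp (-l * s)) := by ring
      _ = B / l := by rw [← Real.exp_add]; simp

/-- The bounded solution of `ζ' = l ζ + R(s, ζ)`, for bounded `R` with Lipschitz constant less than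
`l` in `ζ`. -/
theorem exists_bounded_solution {l B k : ℝ} (hl : 0 < l) (hk0 : 0 ≤ k) (hk : k < l)
    {R : ℝ → ℝ → ℝ} (hR : Continuous fun q : ℝ × ℝ => R q.1 q.2) (hB : ∀ s z, |R s z| ≤ B)
    (hlip : ∀ s z z', |R s z - R s z'| ≤ k * |z - z'|) :
    ∃ ζ : ℝ → ℝ, (∀ s, HasDerivAt ζ (l * ζ s + R s (ζ s)) s) ∧ ∀ s, |ζ s| ≤ B / l := by
  have hφ : ∀ ζ : BoundedContinuousFunction ℝ ℝ, Continuous fun s => R s (ζ s) := fun ζ =>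
    hR.comp (continuous_id.prodMk ζ.continuous)
  choose T hT hTB using fun ζ : BoundedContinuousFunction ℝ ℝ =>
    exists_bounded_solution_linear hl (hφ ζ) (fun s => hB s (ζ s))
  set T' : BoundedContinuousFunction ℝ ℝ → BoundedContinuousFunction ℝ ℝ := fun ζ =>
    BoundedContinuousFunction.ofNormedAddCommGroup (T ζ)
      (continuous_iff_continuousAt.2 fun s => (hT ζ s).continuousAt) (B / l) (hTB ζ) with hT'
  have hcon : ContractingWith (k / l).toNNReal T' := by
    refine ⟨?_, LipschitzWith.of_dist_le_mul fun ζ ζ' => ?_⟩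
    · rw [Real.toNNReal_lt_one]
      exact (div_lt_one hl).2 hk
    · rw [Real.coe_toNNReal _ (by positivity)]
      refine (BoundedContinuousFunction.dist_le (mul_nonneg (by positivity) dist_nonneg)).2 fun s => ?_
      -- The difference of two images is a bounded solution of the linear equation with forcing at
      -- most `k` times the distance, so the contraction factor is `k / l`.
      have h := abs_le_of_bounded_unstable hl (v := fun s => T ζ s - T ζ' s)
        (g := fun s => R s (ζ s) - R s (ζ' s)) (a := s) (M := k * dist ζ ζ') (B := B / l + B / l)
        (fun ξ _ => ((hT ζ ξ).fun_sub (hT ζ' ξ)).congr_deriv (by ring))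
        (fun ξ _ => (abs_sub _ _).trans (add_le_add (hTB ζ ξ) (hTB ζ' ξ)))
        (fun ξ _ => (hlip ξ _ _).trans (mul_le_mul_of_nonneg_left
          (by simpa [Real.dist_eq] using ζ.dist_coe_le_dist (g := ζ') ξ) hk0))
      calc dist (T' ζ s) (T' ζ' s) = |T ζ s - T ζ' s| := Real.dist_eq _ _
        _ ≤ k * dist ζ ζ' / l := h
        _ = k / l * dist ζ ζ' := by ring
  set ζ := hcon.fixedPoint T' with hζ
  have hfix : T' ζ = ζ := hcon.fixedPoint_isFixedPt
  have hfix' : T ζ = ζ := by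
    conv_rhs => rw [← hfix]
    rfl
  refine ⟨ζ, fun s => ?_, fun s => ?_⟩
  · have := hT ζ s
    rwa [hfix'] at this
  · have := hTB ζ s
    rwa [hfix'] at this

/-- The scalar equation `σ' = a(σ)` with `a` continuous, bounded and bounded below by a positive
constant. -/
lemma exists_scalar_solution {a : ℝ → ℝ} (ha : Continuous a) {m M : ℝ} (hm : 0 < m)
    (hma : ∀ s, m ≤ a s) (haM : ∀ s, a s ≤ M) (s₀ : ℝ) :
    ∃ σ : ℝ → ℝ, σ 0 = s₀ ∧ ∀ ξ, HasDerivAt σ (a (σ ξ)) ξ := by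
  have ha0 : ∀ s, 0 < a s := fun s => hm.trans_le (hma s)
  have hM : 0 < M := (ha0 0).trans_le (haM 0)
  have hac : Continuous fun s => (a s)⁻¹ := ha.inv₀ fun s => (ha0 s).ne'
  -- Separation of variables: time as a function of position. The bounds on `a` make it an
  -- increasing bijection, and the solution is its inverse.
  set τ : ℝ → ℝ := fun s => ∫ r in s₀..s, (a r)⁻¹ with hτ
  have hd : ∀ s, HasDerivAt τ (a s)⁻¹ s := fun s =>
    intervalIntegral.integral_hasDerivAt_right (hac.intervalIntegrable _ _)
      (hac.stronglyMeasurableAtFilter _ _) hac.continuousAt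
  have hmono : StrictMono τ := strictMono_of_deriv_pos fun s => by
    rw [(hd s).deriv]; exact inv_pos.2 (ha0 s)
  have hgrow : Monotone fun s => τ s - M⁻¹ * s := by
    refine monotone_of_deriv_nonneg
      (fun s => ((hd s).fun_sub ((hasDerivAt_id' s).const_mul M⁻¹)).differentiableAt) fun s => ?_
    rw [((hd s).fun_sub ((hasDerivAt_id' s).const_mul M⁻¹)).deriv, mul_one, sub_nonneg]
    exact inv_anti₀ (ha0 s) (haM s)
  have hτ0 : τ s₀ = 0 := by simp [hτ]
  have hcont : Continuous τ := continuous_iff_continuousAt.2 fun s => (hd s).continuousAt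
  have hsurj : Function.Surjective τ := by
    refine hcont.surjective ?_ ?_
    · refine tendsto_atTop_mono' _ (f₁ := fun s => M⁻¹ * s - M⁻¹ * s₀) ?_ ?_
      · filter_upwards [eventually_ge_atTop s₀] with s hs
        have := hgrow hs
        simp only [hτ0] at this
        linarith
      · exact tendsto_atTop_add_const_right _ _ (tendsto_id.const_mul_atTop (inv_pos.2 hM))
    · refine tendsto_atBot_mono' _ (f₁ := fun s => M⁻¹ * s - M⁻¹ * s₀) ?_ ?_
      · filter_upwards [eventually_le_atBot s₀] with s hs
        have := hgrow hs
        simp only [hτ0] at this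
        linarith
      · exact tendsto_atBot_add_const_right _ _ (tendsto_id.const_mul_atBot (inv_pos.2 hM))
  set e := hmono.orderIsoOfSurjective τ hsurj with he
  have hτe : ∀ ξ, τ (e.symm ξ) = ξ := fun ξ => e.apply_symm_apply ξ
  refine ⟨e.symm, ?_, fun ξ => ?_⟩
  · exact hmono.injective (by rw [hτe, hτ0])
  · have := HasDerivAt.of_local_left_inverse (e.symm.continuous.continuousAt (x := ξ))
      (hd (e.symm ξ)) (inv_pos.2 (ha0 _)).ne' (.of_forall hτe)
    rwa [inv_inv] at this

end ScalarEquations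

/-! ### The saddle-node normal form and the cusp -/

/-- A quadratic form plus the cube of a linear form. -/
def quadCubic (k₀ k₁ k₂ k₃ p q x y : ℝ) : ℝ :=
  k₀ * x ^ 2 + k₁ * x * y + k₂ * y ^ 2 + k₃ * (p * x + q * y) ^ 3

/-- Apart from the pure square of `x`, every monomial is of third order in `x` or contains `y`,
hence is of lower weight on a cusp `y² ≤ C x³`. -/
lemma exists_quadCubic_bound (k₀ k₁ k₂ k₃ p q : ℝ) : ∃ K, 0 < K ∧ ∀ x y : ℝ, |x| ≤ 1 → |y| ≤ 1 →
    |quadCubic k₀ k₁ k₂ k₃ p q x y - k₀ * x ^ 2| ≤ K * (|x| ^ 3 + |y| * (|x| + |y|)) := by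
  refine ⟨|k₁| + |k₂| + 7 * (|k₃| * (|p| + |q|) ^ 3) + 1, by positivity, fun x y hx hy => ?_⟩
  have h0 : quadCubic k₀ k₁ k₂ k₃ p q x y - k₀ * x ^ 2 =
      k₁ * x * y + k₂ * y ^ 2 + k₃ * (p * x + q * y) ^ 3 := by unfold quadCubic; ring
  have hX := abs_nonneg x
  have hY := abs_nonneg y
  have h1 : |p * x + q * y| ≤ (|p| + |q|) * (|x| + |y|) := by
    refine (abs_add_le _ _).trans ?_
    rw [abs_mul, abs_mul]
    nlinarith [mul_nonneg (abs_nonneg p) hY, mul_nonneg (abs_nonneg q) hX]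
  have h2 : |k₃ * (p * x + q * y) ^ 3| ≤ |k₃| * (|p| + |q|) ^ 3 * (|x| + |y|) ^ 3 := by
    rw [abs_mul, abs_pow, mul_assoc, ← mul_pow]
    gcongr
  have h3 : (|x| + |y|) ^ 3 ≤ 7 * (|x| ^ 3 + |y| * (|x| + |y|)) := by
    have e1 : |x| ^ 2 * |y| ≤ |x| * |y| := by
      have := mul_le_mul_of_nonneg_left hx (mul_nonneg hX hY)
      nlinarith
    have e2 : |x| * |y| ^ 2 ≤ |x| * |y| := by
      have := mul_le_mul_of_nonneg_left hy (mul_nonneg hX hY)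
      nlinarith
    have e3 : |y| ^ 3 ≤ |y| * |y| := by
      have := mul_le_mul_of_nonneg_left hy (mul_nonneg hY hY)
      nlinarith
    have e4 : 0 ≤ |x| ^ 3 := by positivity
    have e5 : 0 ≤ |y| * |y| := by positivity
    nlinarith [mul_nonneg hX hY]
  have h4 : |k₁ * x * y| ≤ |k₁| * (|x| ^ 3 + |y| * (|x| + |y|)) := by
    rw [abs_mul, abs_mul, mul_assoc]
    gcongr
    nlinarith [pow_nonneg hX 3]
  have h5 : |k₂ * y ^ 2| ≤ |k₂| * (|x| ^ 3 + |y| * (|x| + |y|)) := by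
    rw [abs_mul, abs_pow]
    gcongr
    nlinarith [pow_nonneg hX 3, mul_nonneg hX hY]
  have h6 : 0 ≤ |x| ^ 3 + |y| * (|x| + |y|) := by positivity
  have h7 : |k₃| * (|p| + |q|) ^ 3 * (|x| + |y|) ^ 3 ≤
      |k₃| * (|p| + |q|) ^ 3 * (7 * (|x| ^ 3 + |y| * (|x| + |y|))) := by gcongr
  rw [h0]
  calc _ ≤ |k₁ * x * y| + |k₂ * y ^ 2| + |k₃ * (p * x + q * y) ^ 3| := abs_add_three _ _ _
    _ ≤ _ := by nlinarith

/-- Coefficients of a planar field in which a saddle-node at `0` has the coordinate axes as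
eigendirections and attracts along the positive first axis. -/
structure SaddleNodeForm where
  (l f₀ f₁ f₂ f₃ g₀ g₁ g₂ g₃ p q : ℝ)
  l_pos : 0 < l
  f₀_neg : f₀ < 0

namespace SaddleNodeForm

variable (S : SaddleNodeForm)

/-- The field `(F(x, y), l y + G(x, y))`. -/
def field (w : ℝ × ℝ) : ℝ × ℝ :=
  (quadCubic S.f₀ S.f₁ S.f₂ S.f₃ S.p S.q w.1 w.2,
   S.l * w.2 + quadCubic S.g₀ S.g₁ S.g₂ S.g₃ S.p S.q w.1 w.2)

lemma locallyLipschitz_field : LocallyLipschitz S.field := by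
  have : ContDiff ℝ 1 S.field := by unfold field quadCubic; fun_prop
  exact this.locallyLipschitz

lemma field_zero : S.field 0 = 0 := by simp [field, quadCubic]

-- The expression is the derivative of `y² - C x³` along the field. Its leading part `2 l y² - 3 C
-- f₀ x⁴` is positive definite in `(y, x²)` and, for large `C`, dominates the cross term `|y| x²`.
set_option maxHeartbeats 800000 in
lemma exists_parabola : ∃ C r, 0 < C ∧ 0 < r ∧ r ≤ 1 ∧ ∀ w : ℝ × ℝ, sqLen w ≤ r ^ 2 →
    0 ≤ 2 * w.2 * (S.field w).2 - 3 * C * w.1 ^ 2 * (S.field w).1 := by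
  obtain ⟨K₁, hK₁, hF⟩ := exists_quadCubic_bound S.f₀ S.f₁ S.f₂ S.f₃ S.p S.q
  obtain ⟨K₂, hK₂, hG⟩ := exists_quadCubic_bound S.g₀ S.g₁ S.g₂ S.g₃ S.p S.q
  have hl := S.l_pos
  set a := -S.f₀ with ha
  have ha0 : 0 < a := neg_pos.2 S.f₀_neg
  set K := |S.g₀| + 2 * K₂ + K₁ with hK
  have hK0 : 0 < K := by positivity
  -- Chosen so that `C a = K² / l`. Completing the square in `2 K |y| x² ≤ l y² + (K² / l) x⁴` then
  -- uses half of the `y²` term and a third of the `x⁴` term.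
  set C := K ^ 2 / (S.l * a) with hC
  have hC0 : 0 < C := by positivity
  have hCa : C * a = K ^ 2 / S.l := by rw [hC]; field_simp
  -- The last two entries let the remaining `y²` and `x⁴` terms, respectively, absorb the errors of
  -- higher order.
  set r := min 1 (min (S.l / (2 * K + 6 * C * K)) (2 * (K ^ 2 / S.l) / (6 * C * K))) with hr
  have hr0 : 0 < r := by positivity
  have hr1 : r ≤ 1 := min_le_left _ _
  have hr2 : r * (2 * K + 6 * C * K) ≤ S.l :=
    (le_div_iff₀ (by positivity)).1 ((min_le_right _ _).trans (min_le_left _ _))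
  have hr3 : r * (6 * C * K) ≤ 2 * (K ^ 2 / S.l) :=
    (le_div_iff₀ (by positivity)).1 ((min_le_right _ _).trans (min_le_right _ _))
  refine ⟨C, r, hC0, hr0, hr1, ?_⟩
  rintro ⟨x, y⟩ hw
  have hn : ‖(x, y)‖ ≤ r := by
    have := abs_le_of_sq_le_sq ((norm_sq_le_sqLen _).trans hw) hr0.le
    rwa [abs_of_nonneg (norm_nonneg _)] at this
  have hx : |x| ≤ r := (norm_fst_le (x, y)).trans hn
  have hy : |y| ≤ r := (norm_snd_le (x, y)).trans hn
  simp only [field]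
  have h1 := (abs_le.1 (hF x y (hx.trans hr1) (hy.trans hr1))).2
  have h2 := hG x y (hx.trans hr1) (hy.trans hr1)
  generalize quadCubic S.f₀ S.f₁ S.f₂ S.f₃ S.p S.q x y = F at h1 ⊢
  generalize quadCubic S.g₀ S.g₁ S.g₂ S.g₃ S.p S.q x y = G at h2 ⊢
  have hx2 : x ^ 2 = |x| ^ 2 := (sq_abs x).symm
  have hy2 : y ^ 2 = |y| ^ 2 := (sq_abs y).symm
  have hX := abs_nonneg x
  have hY := abs_nonneg y
  rw [hx2] at h1 h2
  have hyG : -(|y| * (K * (|x| ^ 2 + |y| ^ 2))) ≤ y * G := by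
    have hG' : |G| ≤ K * (|x| ^ 2 + |y| ^ 2) := by
      have e1 : |G| ≤ |G - S.g₀ * |x| ^ 2| + |S.g₀ * |x| ^ 2| := by
        have := abs_add_le (G - S.g₀ * |x| ^ 2) (S.g₀ * |x| ^ 2)
        rwa [sub_add_cancel] at this
      rw [abs_mul S.g₀, abs_of_nonneg (pow_nonneg hX 2)] at e1
      have e2 : |x| ^ 3 + |y| * (|x| + |y|) ≤ 2 * (|x| ^ 2 + |y| ^ 2) := by
        have : |x| ^ 3 ≤ |x| ^ 2 := pow_le_pow_of_le_one hX (hx.trans hr1) (by norm_num)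
        nlinarith [sq_nonneg (|x| - |y|)]
      have e3 := mul_le_mul_of_nonneg_left e2 hK₂.le
      rw [hK]
      nlinarith [abs_nonneg S.g₀, sq_nonneg |x|, sq_nonneg |y|,
        mul_nonneg (abs_nonneg S.g₀) (sq_nonneg |y|), mul_nonneg hK₁.le (sq_nonneg |x|),
        mul_nonneg hK₁.le (sq_nonneg |y|)]
    refine (neg_le_neg (mul_le_mul_of_nonneg_left hG' hY)).trans ?_
    rw [← abs_mul]
    exact neg_abs_le _
  have hF' : |x| ^ 2 * F ≤ -(a * |x| ^ 4) + K * (|x| ^ 5 + |x| ^ 3 * |y| + |x| ^ 2 * |y| ^ 2) := by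
    have e1 : F ≤ -(a * |x| ^ 2) + K * (|x| ^ 3 + |y| * (|x| + |y|)) := by
      have : K₁ ≤ K := by rw [hK]; linarith [abs_nonneg S.g₀]
      have := mul_le_mul_of_nonneg_right this
        (show 0 ≤ |x| ^ 3 + |y| * (|x| + |y|) by positivity)
      rw [ha]
      linarith
    have := mul_le_mul_of_nonneg_left e1 (sq_nonneg |x|)
    refine this.trans (le_of_eq ?_)
    ring
  have e1 : 2 * K * (|y| * |x| ^ 2) ≤ S.l * |y| ^ 2 + K ^ 2 / S.l * |x| ^ 4 := by
    have : 0 ≤ (S.l * |y| - K * |x| ^ 2) ^ 2 / S.l := by positivity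
    have e : (S.l * |y| - K * |x| ^ 2) ^ 2 / S.l =
      S.l * |y| ^ 2 + K ^ 2 / S.l * |x| ^ 4 - 2 * K * (|y| * |x| ^ 2) := by
      field_simp; ring
    linarith
  have e2 : |y| ^ 3 ≤ r * |y| ^ 2 := by
    have := mul_le_mul_of_nonneg_right hy (sq_nonneg |y|); nlinarith
  have e3 : |x| ^ 5 ≤ r * |x| ^ 4 := by
    have := mul_le_mul_of_nonneg_right hx (pow_nonneg hX 4); nlinarith
  have e4 : |x| ^ 3 * |y| ≤ r * (|x| ^ 4 + |y| ^ 2) := by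
    have h := mul_le_mul_of_nonneg_right hx (mul_nonneg (pow_nonneg hX 2) hY)
    have h' : |x| ^ 2 * |y| ≤ |x| ^ 4 + |y| ^ 2 := by
      linear_combination (sq_nonneg (|x| ^ 2 - |y|) + pow_nonneg hX 4 + sq_nonneg |y|) / 2
    have h'' := mul_le_mul_of_nonneg_left h' hr0.le
    linear_combination h + h''
  have e5 : |x| ^ 2 * |y| ^ 2 ≤ r * |y| ^ 2 := by
    refine mul_le_mul_of_nonneg_right ?_ (sq_nonneg _)
    linear_combination hx + mul_le_mul_of_nonneg_left (hx.trans hr1) hX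
  have e6 := mul_le_mul_of_nonneg_left hF' (show 0 ≤ 3 * C by positivity)
  have e7 := mul_le_mul_of_nonneg_left e2 (show 0 ≤ 2 * K by positivity)
  have e8 := mul_le_mul_of_nonneg_left (add_le_add (add_le_add e3 e4) e5)
    (show 0 ≤ 3 * C * K by positivity)
  have e9 := mul_le_mul_of_nonneg_right hr2 (sq_nonneg |y|)
  have e10 := mul_le_mul_of_nonneg_right hr3 (pow_nonneg hX 4)
  have e11 : 3 * C * (a * |x| ^ 4) = 3 * (K ^ 2 / S.l) * |x| ^ 4 := by rw [← hCa]; ring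
  rw [hx2]
  have e12 : y * y = |y| ^ 2 := by rw [← hy2]; ring
  calc (0 : ℝ) ≤ 2 * (S.l * |y| ^ 2) - 2 * (|y| * (K * (|x| ^ 2 + |y| ^ 2)))
      - 3 * C * (-(a * |x| ^ 4) + K * (|x| ^ 5 + |x| ^ 3 * |y| + |x| ^ 2 * |y| ^ 2)) := by
        linear_combination e1 + e7 + e8 + e9 + e10 - e11
    _ ≤ 2 * (S.l * |y| ^ 2) + 2 * (y * G) - 3 * C * (|x| ^ 2 * F) := by linarith
    _ = _ := by rw [← e12]; ring

/-- Orbits that decay near a saddle-node do so within a cusp around the positive first axis. -/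
theorem orbit_mem_cusp {C r : ℝ} (hC : 0 < C)
    (h : ∀ w : ℝ × ℝ, sqLen w ≤ r ^ 2 →
      0 ≤ 2 * w.2 * (S.field w).2 - 3 * C * w.1 ^ 2 * (S.field w).1)
    {w : ℝ → ℝ × ℝ} (hw : IsDecayingOrbit S.field w) (hr : ∀ ξ, 0 ≤ ξ → sqLen (w ξ) < r ^ 2)
    (h0 : w 0 ≠ 0) {ξ : ℝ} (hξ : 0 ≤ ξ) : 0 < (w ξ).1 ∧ (w ξ).2 ^ 2 ≤ C * (w ξ).1 ^ 3 := by
  -- `y² - C x³` increases to its limit 0, so it is nonpositive. This gives the cusp and `x ≥ 0`; if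
  -- `x` vanished, so would `y`, and then the whole orbit.
  have hmono : MonotoneOn (fun ξ => (w ξ).2 ^ 2 - C * (w ξ).1 ^ 3) (Ici 0) := by
    refine monotoneOn_Ici_of_hasDerivAt_nonneg ?_ (fun ξ hξ => ?_) fun ξ hξ => h _ (hr ξ hξ.le).le
    · exact (((continuous_snd.comp_continuousOn hw.cont).pow 2).sub
        (((continuous_fst.comp_continuousOn hw.cont).pow 3).const_smul C))
    · have h1 : HasDerivAt (fun ξ => (w ξ).1) (S.field (w ξ)).1 ξ := (hw.ode ξ hξ).fst
      have h2 : HasDerivAt (fun ξ => (w ξ).2) (S.field (w ξ)).2 ξ := (hw.ode ξ hξ).snd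
      refine ((h2.fun_pow 2).fun_sub ((h1.fun_pow 3).const_mul C)).congr_deriv ?_
      norm_num
      ring
  have hlim : Tendsto (fun ξ => (w ξ).2 ^ 2 - C * (w ξ).1 ^ 3) atTop (𝓝 0) := by
    have hc : Continuous fun q : ℝ × ℝ => q.2 ^ 2 - C * q.1 ^ 3 := by fun_prop
    simpa [Function.comp_def] using (hc.tendsto 0).comp hw.lim
  have h1 := monotoneOn_le_of_tendsto hmono hlim hξ
  have h2 : 0 ≤ (w ξ).1 := by
    by_contra! hneg
    have : (w ξ).1 ^ 3 < 0 := by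
      have := mul_pos_of_neg_of_neg hneg hneg
      nlinarith
    nlinarith [sq_nonneg (w ξ).2, mul_pos_of_neg_of_neg (neg_neg_of_pos hC) this]
  refine ⟨h2.lt_of_ne fun h3 => h0 ?_, by linarith⟩
  refine hw.zero_of_eq_zero S.locallyLipschitz_field S.field_zero hξ ?_
  rw [← h3] at h1
  have h4 : (w ξ).2 = 0 := by
    have : (w ξ).2 ^ 2 ≤ 0 := by simpa using h1
    exact pow_eq_zero_iff (two_ne_zero) |>.1 (le_antisymm this (sq_nonneg _))
  exact Prod.ext h3.symm h4

end SaddleNodeForm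

/-! ### The blow-up chart and the stable orbit -/

/-- The form factored as `x ^ 2 * blowUp (x, z)` along `y = x z`. -/
def blowUp (k₀ k₁ k₂ k₃ p q : ℝ) (w : ℝ × ℝ) : ℝ :=
  k₀ + k₁ * w.2 + k₂ * w.2 ^ 2 + k₃ * w.1 * (p + q * w.2) ^ 3

lemma quadCubic_mul (k₀ k₁ k₂ k₃ p q x z : ℝ) :
    quadCubic k₀ k₁ k₂ k₃ p q x (x * z) = x ^ 2 * blowUp k₀ k₁ k₂ k₃ p q (x, z) := by
  unfold quadCubic blowUp
  ring

lemma contDiff_blowUp (k₀ k₁ k₂ k₃ p q : ℝ) {n : WithTop ℕ∞} :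
    ContDiff ℝ n (blowUp k₀ k₁ k₂ k₃ p q) := by
  unfold blowUp
  fun_prop

namespace SaddleNodeForm

variable (S : SaddleNodeForm)

/-- First component of the field in the chart `y = x z`. -/
def A : ℝ × ℝ → ℝ := blowUp S.f₀ S.f₁ S.f₂ S.f₃ S.p S.q

/-- Nonlinear part of the second component of the field in the chart `y = x z`. -/
def B : ℝ × ℝ → ℝ := blowUp S.g₀ S.g₁ S.g₂ S.g₃ S.p S.q

/-- In this chart `x' = x² A` and `z' = l z + x (B - z A)`. Hence `s = 1 / x` moves with speed `-A`,
which is near `-f₀ > 0`, and `dz/ds` is `rate * z + rem`. -/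
lemma field_mul (x z : ℝ) :
    S.field (x, x * z) = (x ^ 2 * S.A (x, z), S.l * (x * z) + x ^ 2 * S.B (x, z)) := by
  simp only [field, quadCubic_mul, A, B]

/-- Rate of the linear part of the equation for `z` as a function of `1 / x`. -/
noncomputable def rate : ℝ := -S.l / S.f₀

lemma rate_pos : 0 < S.rate := div_pos_of_neg_of_neg (neg_neg_of_pos S.l_pos) S.f₀_neg

/-- Remainder in the equation for `z` as a function of `1 / x`. -/
noncomputable def rem (w : ℝ × ℝ) : ℝ :=
  -(S.l * w.2 + w.1 * (S.B w - w.2 * S.A w)) / S.A w - S.rate * w.2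

lemma rate_add_rem {w : ℝ × ℝ} (hA : S.A w ≠ 0) :
    (S.rate * w.2 + S.rem w) * -S.A w = S.l * w.2 + w.1 * (S.B w - w.2 * S.A w) := by
  unfold rem
  field_simp
  ring

lemma A_zero : S.A 0 = S.f₀ := by simp [A, blowUp]

lemma contDiffAt_rem {w : ℝ × ℝ} (hA : S.A w ≠ 0) : ContDiffAt ℝ 1 S.rem w := by
  have h1 : ContDiff ℝ 1 S.A := contDiff_blowUp _ _ _ _ _ _
  have h2 : ContDiff ℝ 1 S.B := contDiff_blowUp _ _ _ _ _ _
  unfold rem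
  exact ((ContDiff.neg (by fun_prop)).contDiffAt.div h1.contDiffAt hA).sub
    (by fun_prop)

/-- `rate` is exactly the linear coefficient in `z` at the origin, so the remainder has arbitrarily
small Lipschitz constant in `z` nearby. Its dependence on `x` need not be of second order. -/
lemma fderiv_rem_apply (t : ℝ) : fderiv ℝ S.rem 0 (0, t) = 0 := by
  have hf := S.f₀_neg.ne
  have hA0 : S.A 0 ≠ 0 := by rw [S.A_zero]; exact hf
  have h1 : HasDerivAt (fun s : ℝ => S.rem (0, s)) (fderiv ℝ S.rem 0 (0, 1)) 0 := by
    have hr : HasFDerivAt S.rem (fderiv ℝ S.rem 0) ((0 : ℝ), (0 : ℝ)) :=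
      ((S.contDiffAt_rem hA0).differentiableAt (by simp)).hasFDerivAt
    exact hr.comp_hasDerivAt (0 : ℝ) ((hasDerivAt_const (0 : ℝ) (0 : ℝ)).prodMk (hasDerivAt_id' 0))
  have hAd : HasDerivAt (fun s : ℝ => S.A (0, s)) (fderiv ℝ S.A 0 (0, 1)) 0 := by
    have hr : HasFDerivAt S.A (fderiv ℝ S.A 0) ((0 : ℝ), (0 : ℝ)) :=
      ((contDiff_blowUp _ _ _ _ _ _ (n := 1)).contDiffAt.differentiableAt (by simp)).hasFDerivAt
    exact hr.comp_hasDerivAt (0 : ℝ) ((hasDerivAt_const (0 : ℝ) (0 : ℝ)).prodMk (hasDerivAt_id' 0))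
  have h2 : HasDerivAt (fun s : ℝ => S.rem (0, s)) 0 0 := by
    have hd := ((((hasDerivAt_id' (0 : ℝ)).const_mul S.l).fun_neg).fun_div hAd hA0).fun_sub
      ((hasDerivAt_id' (0 : ℝ)).const_mul S.rate)
    refine (hd.congr_of_eventuallyEq (.of_forall fun s => ?_)).congr_deriv ?_
    · simp [rem]
    · have e : S.A (0, 0) = S.f₀ := S.A_zero
      rw [e]
      unfold rate
      field_simp
      ring
  have h3 : fderiv ℝ S.rem 0 (0, 1) = 0 := h1.unique h2
  have h4 : ((0, t) : ℝ × ℝ) = t • (0, 1) := by simp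
  rw [h4, map_smul, h3, smul_zero]

/-- Bounds for the equation for `z` near the origin of the chart. -/
lemma exists_chart_bounds : ∃ η, 0 < η ∧ η ≤ 1 ∧ ∃ x₀, 0 < x₀ ∧ x₀ ≤ η ∧
    (∀ x z, |x| ≤ x₀ → |z| ≤ η → 2 * S.f₀ ≤ S.A (x, z) ∧ S.A (x, z) ≤ S.f₀ / 2) ∧
    (∀ x z z', |x| ≤ x₀ → |z| ≤ η → |z'| ≤ η →
      |S.rem (x, z) - S.rem (x, z')| ≤ S.rate / 4 * |z - z'|) ∧
    ∀ x z, |x| ≤ x₀ → |z| ≤ η → |S.rem (x, z)| ≤ S.rate / 2 * η := by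
  have hf := S.f₀_neg
  have hrate := S.rate_pos
  have hA0 : S.A 0 ≠ 0 := by rw [S.A_zero]; exact hf.ne
  have hAc : ContinuousAt S.A 0 := (contDiff_blowUp _ _ _ _ _ _ (n := 1)).continuous.continuousAt
  have hev1 : ∀ᶠ w in 𝓝 (0 : ℝ × ℝ), 2 * S.f₀ ≤ S.A w ∧ S.A w ≤ S.f₀ / 2 := by
    have h : S.A 0 ∈ Icc (2 * S.f₀) (S.f₀ / 2) ∧ Icc (2 * S.f₀) (S.f₀ / 2) ∈ 𝓝 (S.A 0) := by
      rw [S.A_zero]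
      exact ⟨⟨by linarith, by linarith⟩, Icc_mem_nhds (by linarith) (by linarith)⟩
    exact hAc.eventually_mem h.2
  have hstr : HasStrictFDerivAt S.rem (fderiv ℝ S.rem 0) 0 :=
    (S.contDiffAt_rem hA0).hasStrictFDerivAt (by simp)
  have hev2 := (hasStrictFDerivAt_iff_isLittleO.1 hstr).bound (show 0 < S.rate / 4 by positivity)
  obtain ⟨d₁, hd₁, h1⟩ := Metric.eventually_nhds_iff.1 hev1
  obtain ⟨d₂, hd₂, h2⟩ := Metric.eventually_nhds_iff.1 hev2
  set η := min 1 (min (d₁ / 2) (d₂ / 2)) with hη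
  have hη0 : 0 < η := by positivity
  have hη1 : η ≤ d₁ / 2 := (min_le_right _ _).trans (min_le_left _ _)
  have hη2 : η ≤ d₂ / 2 := (min_le_right _ _).trans (min_le_right _ _)
  have hr0 : S.rem 0 = 0 := by simp [rem]
  have hc : ContinuousAt S.rem 0 := (S.contDiffAt_rem hA0).continuousAt
  obtain ⟨d₃, hd₃, h3⟩ := Metric.continuousAt_iff.1 hc (S.rate / 4 * η) (by positivity)
  have hdist : ∀ x z : ℝ, |x| ≤ η → |z| ≤ η → dist (x, z) (0 : ℝ × ℝ) ≤ η := by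
    intro x z hx hz
    rw [dist_zero_right, Prod.norm_def]
    exact max_le hx hz
  have hlip : ∀ x z z', |x| ≤ η → |z| ≤ η → |z'| ≤ η →
      |S.rem (x, z) - S.rem (x, z')| ≤ S.rate / 4 * |z - z'| := by
    intro x z z' hx hz hz'
    have h := @h2 ((x, z), (x, z')) (by
      rw [Prod.dist_eq, max_lt_iff]
      exact ⟨(hdist x z hx hz).trans_lt (by linarith), (hdist x z' hx hz').trans_lt (by linarith)⟩)
    simp only [Prod.mk_sub_mk, sub_self, S.fderiv_rem_apply, sub_zero, Real.norm_eq_abs] at h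
    have hn : ‖((0 : ℝ), z - z')‖ = |z - z'| := by simp [Prod.norm_def]
    rwa [hn] at h
  refine ⟨η, hη0, min_le_left _ _, min η (d₃ / 2), by positivity, min_le_left _ _, ?_, ?_, ?_⟩
  · intro x z hx hz
    exact h1 ((hdist x z (hx.trans (min_le_left _ _)) hz).trans_lt (by linarith))
  · exact fun x z z' hx => hlip x z z' (hx.trans (min_le_left _ _))
  · intro x z hx hz
    have e1 := hlip x z 0 (hx.trans (min_le_left _ _)) hz (by simpa using hη0.le)
    have e2 : |S.rem (x, 0)| < S.rate / 4 * η := by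
      have := @h3 (x, 0) (by
        rw [dist_zero_right, Prod.norm_def]
        simp only [norm_zero]
        rw [max_eq_left (norm_nonneg _), Real.norm_eq_abs]
        linarith [min_le_right η (d₃ / 2)])
      rwa [hr0, dist_zero_right, Real.norm_eq_abs] at this
    rw [sub_zero] at e1
    have e3 := abs_add_le (S.rem (x, z) - S.rem (x, 0)) (S.rem (x, 0))
    rw [sub_add_cancel] at e3
    have e4 : S.rate / 4 * |z| ≤ S.rate / 4 * η := by gcongr
    linarith

/-- The orbit of a saddle-node that decays along the positive first axis: existence, uniqueness, and
algebraic decay. -/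
theorem exists_stable_orbit {ε : ℝ} (hε : 0 < ε) : ∃ r m K : ℝ, 0 < r ∧ 0 < m ∧ 0 < K ∧ ∃ v : ℝ → ℝ × ℝ,
    IsDecayingOrbit S.field v ∧
    (∀ ξ, 0 ≤ ξ → sqLen (v ξ) < ε ^ 2) ∧
    (∀ ξ, 0 ≤ ξ → 0 < (v ξ).1 ∧ (v ξ).1 ≤ 1 ∧ (v ξ).2 ^ 2 ≤ K * (v ξ).1 ^ 3) ∧
    (∀ s ξ, 0 ≤ s → 0 ≤ ξ → (v (ξ + s)).1 ≤ (v s).1 / (1 + m * (v s).1 * ξ)) ∧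
    ∀ w, IsDecayingOrbit S.field w → (∀ ξ, 0 ≤ ξ → sqLen (w ξ) < r ^ 2) → w 0 ≠ 0 →
      ∃ s, 0 < s ∧ w 0 = v s := by
  have hf := S.f₀_neg
  have hrate := S.rate_pos
  obtain ⟨C, r₁, hC, hr₁, hr₁1, hpar⟩ := S.exists_parabola
  obtain ⟨η, hη, hη1, x₁, hx₁, hx₁η, hA, hlip, hbd⟩ := S.exists_chart_bounds
  have hmin : 0 < min r₁ ε := lt_min hr₁ hε
  set x₀ := min x₁ (min r₁ ε / 2) with hx₀
  have hx₀0 : 0 < x₀ := by positivity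
  have hx₀1 : x₀ ≤ x₁ := min_le_left _ _
  have hx₀m : x₀ ≤ min r₁ ε / 2 := min_le_right _ _
  have hx₀r : x₀ ≤ r₁ / 2 := hx₀m.trans (by linarith [min_le_left r₁ ε])
  -- the bounded solution of the equation for `z`
  set X : ℝ → ℝ := fun s => (max s x₀⁻¹)⁻¹ with hX
  have hs₀ : 0 < x₀⁻¹ := by positivity
  have hmax : ∀ s, 0 < max s x₀⁻¹ := fun s => hs₀.trans_le (le_max_right _ _)
  have hXc : Continuous X := (continuous_id.max continuous_const).inv₀ fun s => (hmax s).ne'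
  have hX0 : ∀ s, 0 < X s := fun s => inv_pos.2 (hmax s)
  have hXx : ∀ s, |X s| ≤ x₁ := fun s => by
    rw [abs_of_pos (hX0 s)]
    exact (inv_le_of_inv_le₀ hx₀0 (le_max_right _ _)).trans hx₀1
  -- Bounding `x` by `x₀` in `X` and clamping `z` makes the equation global with a bounded,
  -- Lipschitz remainder. The clamp of `z` is inactive because `|ζ| ≤ η`, and `X s = 1 / s` for `s ≥
  -- 1 / x₀`, where the orbit lives.
  set cl : ℝ → ℝ := fun z => projIcc (-η) η (by linarith) z with hcl
  have hclη : ∀ z, |cl z| ≤ η := fun z => abs_le.2 (projIcc (-η) η (by linarith) z).2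
  have hcllip : ∀ z z', |cl z - cl z'| ≤ |z - z'| := fun z z' => abs_projIcc_sub_projIcc _
  have hclc : Continuous cl := continuous_subtype_val.comp continuous_projIcc
  have hcleq : ∀ z, |z| ≤ η → cl z = z := fun z hz => by
    rw [hcl]
    simp only
    rw [projIcc_of_mem _ (abs_le.1 hz)]
  have hAne : ∀ x z, |x| ≤ x₁ → |z| ≤ η → S.A (x, z) ≠ 0 := fun x z hx hz => by
    have := (hA x z hx hz).2
    exact (by linarith : S.A (x, z) < 0).ne
  have hRc : Continuous fun q : ℝ × ℝ => S.rem (X q.1, cl q.2) := by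
    refine continuous_iff_continuousAt.2 fun q => ?_
    exact ContinuousAt.comp (g := S.rem) (f := fun q : ℝ × ℝ => (X q.1, cl q.2))
      (S.contDiffAt_rem (hAne _ _ (hXx _) (hclη _))).continuousAt
      ((hXc.comp continuous_fst).prodMk (hclc.comp continuous_snd)).continuousAt
  obtain ⟨ζ, hζ, hζb⟩ := exists_bounded_solution hrate (k := S.rate / 4) (by positivity)
    (by linarith) (R := fun s z => S.rem (X s, cl z)) hRc
    (fun s z => hbd _ _ (hXx s) (hclη z))
    (fun s z z' => (hlip _ _ _ (hXx s) (hclη z) (hclη z')).trans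
      (mul_le_mul_of_nonneg_left (hcllip z z') (by positivity)))
  have hζη : ∀ s, |ζ s| ≤ η := fun s => by
    refine (hζb s).trans ?_
    rw [div_le_iff₀ hrate]
    nlinarith
  have hζd : ∀ s, HasDerivAt ζ (S.rate * ζ s + S.rem (X s, ζ s)) s := fun s => by
    have := hζ s
    rwa [hcleq _ (hζη s)] at this
  have hζc : Continuous ζ := continuous_iff_continuousAt.2 fun s => (hζd s).continuousAt
  -- the time parametrization
  have hAc : Continuous S.A := (contDiff_blowUp _ _ _ _ _ _ (n := 1)).continuous
  obtain ⟨σ, hσ0, hσ⟩ := exists_scalar_solution (a := fun s => -S.A (X s, ζ s))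
    (hAc.comp (hXc.prodMk hζc)).neg (m := -S.f₀ / 2) (M := -2 * S.f₀) (by linarith)
    (fun s => by have := (hA _ _ (hXx s) (hζη s)).2; linarith)
    (fun s => by have := (hA _ _ (hXx s) (hζη s)).1; linarith) x₀⁻¹
  have hσgrow : ∀ s ξ, 0 ≤ ξ → σ s + -S.f₀ / 2 * ξ ≤ σ (ξ + s) := by
    intro s ξ hξ
    have hmono : Monotone fun ξ => σ ξ - -S.f₀ / 2 * ξ := by
      have hd : ∀ ξ, HasDerivAt (fun ξ => σ ξ - -S.f₀ / 2 * ξ)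
          (-S.A (X (σ ξ), ζ (σ ξ)) - -S.f₀ / 2) ξ := fun ξ =>
        ((hσ ξ).fun_sub ((hasDerivAt_id' ξ).const_mul (-S.f₀ / 2))).congr_deriv (by ring)
      refine monotone_of_deriv_nonneg (fun ξ => (hd ξ).differentiableAt) fun ξ => ?_
      rw [(hd ξ).deriv]
      have := (hA _ _ (hXx (σ ξ)) (hζη (σ ξ))).2
      linarith
    have := hmono (show s ≤ ξ + s by linarith)
    simp only at this
    linarith
  have hσs₀ : ∀ ξ, 0 ≤ ξ → x₀⁻¹ ≤ σ ξ := by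
    intro ξ hξ
    have := hσgrow 0 ξ hξ
    rw [hσ0, add_zero] at this
    nlinarith
  have hσpos : ∀ ξ, 0 ≤ ξ → 0 < σ ξ := fun ξ hξ => hs₀.trans_le (hσs₀ ξ hξ)
  have hσX : ∀ ξ, 0 ≤ ξ → X (σ ξ) = (σ ξ)⁻¹ := fun ξ hξ => by
    rw [hX]; simp only; rw [max_eq_left (hσs₀ ξ hξ)]
  have hσtop : Tendsto σ atTop atTop := by
    refine tendsto_atTop_mono' _ (f₁ := fun ξ => x₀⁻¹ + -S.f₀ / 2 * ξ) ?_ ?_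
    · filter_upwards [eventually_ge_atTop 0] with ξ hξ
      have := hσgrow 0 ξ hξ
      rwa [hσ0, add_zero] at this
    · exact tendsto_atTop_add_const_left _ _ (tendsto_id.const_mul_atTop (by linarith))
  have hσc : Continuous σ := continuous_iff_continuousAt.2 fun ξ => (hσ ξ).continuousAt
  have hσsurj : ∀ t, x₀⁻¹ ≤ t → ∃ ξ, 0 ≤ ξ ∧ σ ξ = t := by
    intro t ht
    obtain ⟨b, hb0, hb⟩ := (hσtop.eventually_ge_atTop t).and (eventually_ge_atTop 0) |>.exists
    obtain ⟨ξ, hξ, e⟩ := intermediate_value_Icc hb hσc.continuousOn ⟨by rwa [hσ0], hb0⟩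
    exact ⟨ξ, hξ.1, e⟩
  set v : ℝ → ℝ × ℝ := fun ξ => ((σ ξ)⁻¹, (σ ξ)⁻¹ * ζ (σ ξ)) with hv
  have hvo : IsDecayingOrbit S.field v := by
    have hd : ∀ ξ, 0 ≤ ξ → HasDerivAt v (S.field (v ξ)) ξ := by
      intro ξ hξ
      have hp := hσpos ξ hξ
      have h1 := hσ ξ
      have h2 := (hζd (σ ξ)).comp ξ h1
      have e := S.rate_add_rem (hAne _ _ (hXx (σ ξ)) (hζη (σ ξ)))
      rw [hσX ξ hξ] at h1 h2 e
      simp only at e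
      rw [e] at h2
      have h3 := (h1.fun_inv hp.ne')
      have h4 := h3.fun_mul h2
      refine (h3.prodMk h4).congr_deriv ?_
      rw [hv]
      simp only [field_mul, Function.comp]
      refine Prod.ext ?_ ?_
      · simp only
        field_simp
      · simp only
        field_simp
        ring
    refine ⟨fun ξ hξ => (hd ξ hξ).continuousAt.continuousWithinAt, fun ξ hξ => hd ξ hξ.le, ?_⟩
    have hinv : Tendsto (fun ξ => (σ ξ)⁻¹) atTop (𝓝 0) := hσtop.inv_tendsto_atTop
    refine hinv.prodMk_nhds ?_
    refine squeeze_zero_norm' (a := fun ξ => (σ ξ)⁻¹ * η) ?_ (by simpa using hinv.mul_const η)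
    filter_upwards [eventually_ge_atTop 0] with ξ hξ
    have := hσpos ξ hξ
    rw [norm_mul, Real.norm_eq_abs, Real.norm_eq_abs, abs_of_pos (by positivity)]
    exact mul_le_mul_of_nonneg_left (hζη _) (by positivity)
  have hv1 : ∀ ξ, 0 ≤ ξ → (v ξ).1 ≤ x₀ := fun ξ hξ => inv_le_of_inv_le₀ hx₀0 (hσs₀ ξ hξ)
  have hv0 : ∀ ξ, 0 ≤ ξ → 0 < (v ξ).1 := fun ξ hξ => inv_pos.2 (hσpos ξ hξ)
  have hvr : ∀ ξ, 0 ≤ ξ → sqLen (v ξ) < min r₁ ε ^ 2 := by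
    intro ξ hξ
    have h1 := hv0 ξ hξ
    have h2 := hv1 ξ hξ
    have h3 : (v ξ).2 ^ 2 ≤ (v ξ).1 ^ 2 := by
      have : (v ξ).2 = (v ξ).1 * ζ (σ ξ) := rfl
      rw [this, mul_pow]
      have h4 : ζ (σ ξ) ^ 2 ≤ 1 := by
        rw [sq_le_one_iff_abs_le_one]
        exact (hζη _).trans hη1
      nlinarith [sq_nonneg (v ξ).1]
    unfold sqLen
    nlinarith
  have hvne : v 0 ≠ 0 := fun h => (hv0 0 le_rfl).ne' (by rw [h]; rfl)
  have hcusp : ∀ ξ, 0 ≤ ξ → (v ξ).2 ^ 2 ≤ C * (v ξ).1 ^ 3 := fun ξ hξ =>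
    (S.orbit_mem_cusp hC hpar hvo
      (fun ξ hξ => (hvr ξ hξ).trans_le (by gcongr; exact min_le_left _ _)) hvne hξ).2
  -- The cusp estimate read on the slope: `ζ` tends to 0, although its construction only gives
  -- boundedness.
  have hζcusp : ∀ s, x₀⁻¹ ≤ s → ζ s ^ 2 ≤ C * s⁻¹ := by
    intro s hs
    obtain ⟨ξ, hξ, rfl⟩ := hσsurj s hs
    have h1 := hcusp ξ hξ
    have h2 := hσpos ξ hξ
    simp only [hv] at h1
    have h3 : ((σ ξ)⁻¹) ^ 2 * (ζ (σ ξ) ^ 2) ≤ ((σ ξ)⁻¹) ^ 2 * (C * (σ ξ)⁻¹) := by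
      refine le_trans (le_of_eq ?_) (h1.trans (le_of_eq ?_)) <;> ring
    exact le_of_mul_le_mul_left h3 (by positivity)
  -- In the cusp the slope satisfies `z² ≤ C x`, so `r ≤ η² / C` keeps other orbits in the chart.
  -- The rate `-f₀ / 2` is the lower bound for the speed of `1 / x`.
  refine ⟨min x₀ (η ^ 2 / C), -S.f₀ / 2, C, by positivity, by linarith, hC, v, hvo,
    fun ξ hξ => (hvr ξ hξ).trans_le (by gcongr; exact min_le_right _ _),
    fun ξ hξ => ⟨hv0 ξ hξ, (hv1 ξ hξ).trans (by linarith), hcusp ξ hξ⟩, ?_, ?_⟩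
  · intro s ξ hs hξ
    have h1 := hσpos s hs
    have h2 := hσgrow s ξ hξ
    have h3 : 0 ≤ -S.f₀ / 2 * ξ := by nlinarith
    have e : (v s).1 / (1 + -S.f₀ / 2 * (v s).1 * ξ) = (σ s + -S.f₀ / 2 * ξ)⁻¹ := by
      have h4 : 0 ≤ -S.f₀ / 2 * (σ s)⁻¹ * ξ := by
        have := mul_nonneg h3 (inv_pos.2 h1).le
        linarith
      simp only [hv]
      rw [inv_eq_one_div (σ s + _), div_eq_div_iff (by positivity) (by positivity)]
      field_simp
    rw [e]
    exact inv_anti₀ (by positivity) h2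
  · intro w hw hwr hw0
    set r := min x₀ (η ^ 2 / C) with hr
    have hr0 : 0 < r := by positivity
    have hrx : r ≤ x₀ := min_le_left _ _
    have hrη : C * r ≤ η ^ 2 := by
      have := (le_div_iff₀ hC).1 (min_le_right x₀ (η ^ 2 / C))
      linarith
    have hwr' : ∀ ξ, 0 ≤ ξ → sqLen (w ξ) < r₁ ^ 2 := fun ξ hξ => (hwr ξ hξ).trans_le (by nlinarith)
    have hwc := fun ξ (hξ : 0 ≤ ξ) => S.orbit_mem_cusp hC hpar hw hwr' hw0 hξ
    have hwx : ∀ ξ, 0 ≤ ξ → (w ξ).1 < r := by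
      intro ξ hξ
      have := hwr ξ hξ
      unfold sqLen at this
      exact lt_of_pow_lt_pow_left₀ 2 hr0.le (by nlinarith [sq_nonneg (w ξ).2])
    set z : ℝ → ℝ := fun ξ => (w ξ).2 / (w ξ).1 with hz
    have hzw : ∀ ξ, 0 ≤ ξ → w ξ = ((w ξ).1, (w ξ).1 * z ξ) := fun ξ hξ => by
      have := (hwc ξ hξ).1
      refine Prod.ext rfl ?_
      simp only [hz]
      field_simp
    have hz2 : ∀ ξ, 0 ≤ ξ → z ξ ^ 2 ≤ C * (w ξ).1 := fun ξ hξ => by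
      obtain ⟨h1, h2⟩ := hwc ξ hξ
      simp only [hz]
      rw [div_pow, div_le_iff₀ (by positivity)]
      linarith
    have hzη : ∀ ξ, 0 ≤ ξ → |z ξ| ≤ η := fun ξ hξ => by
      refine abs_le_of_sq_le_sq ((hz2 ξ hξ).trans (le_trans ?_ hrη)) hη.le
      exact mul_le_mul_of_nonneg_left (hwx ξ hξ).le hC.le
    have hwx₁ : ∀ ξ, 0 ≤ ξ → |(w ξ).1| ≤ x₁ := fun ξ hξ => by
      rw [abs_of_pos (hwc ξ hξ).1]
      linarith [hwx ξ hξ]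
    have hXw : ∀ ξ, 0 ≤ ξ → X ((w ξ).1)⁻¹ = (w ξ).1 := fun ξ hξ => by
      have : x₀⁻¹ ≤ ((w ξ).1)⁻¹ := inv_anti₀ (hwc ξ hξ).1 ((hwx ξ hξ).le.trans hrx)
      simp only [hX]
      rw [max_eq_left this, inv_inv]
    have hzd : ∀ ξ, 0 < ξ → HasDerivAt z
        ((S.rate * z ξ + S.rem ((w ξ).1, z ξ)) * -S.A ((w ξ).1, z ξ)) ξ := by
      intro ξ hξ
      have h1 : HasDerivAt (fun ξ => (w ξ).1) (S.field (w ξ)).1 ξ := (hw.ode ξ hξ).fst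
      have h2 : HasDerivAt (fun ξ => (w ξ).2) (S.field (w ξ)).2 ξ := (hw.ode ξ hξ).snd
      have hp := (hwc ξ hξ.le).1
      refine (h2.fun_div h1 hp.ne').congr_deriv ?_
      rw [S.rate_add_rem (w := ((w ξ).1, z ξ)) (hAne _ _ (hwx₁ ξ hξ.le) (hzη ξ hξ.le))]
      rw [hzw ξ hξ.le, field_mul]
      simp only
      field_simp
      ring
    have hsd : ∀ ξ, 0 < ξ → HasDerivAt (fun ξ => ((w ξ).1)⁻¹) (-S.A ((w ξ).1, z ξ)) ξ := by
      intro ξ hξ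
      have h1 : HasDerivAt (fun ξ => (w ξ).1) (S.field (w ξ)).1 ξ := (hw.ode ξ hξ).fst
      have hp := (hwc ξ hξ.le).1
      refine (h1.fun_inv hp.ne').congr_deriv ?_
      rw [hzw ξ hξ.le, field_mul]
      simp only
      field_simp
    have hwc1 : ContinuousOn (fun ξ => (w ξ).1) (Ici 0) := continuous_fst.comp_continuousOn hw.cont
    have hwc2 : ContinuousOn (fun ξ => (w ξ).2) (Ici 0) := continuous_snd.comp_continuousOn hw.cont
    -- The two slopes, compared at the same `x`, separate because `rate` exceeds the Lipschitz
    -- constant of the remainder. Both tend to 0, so they coincide from the start.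
    have hmono : MonotoneOn (fun ξ => (z ξ - ζ ((w ξ).1)⁻¹) ^ 2) (Ici 0) := by
      refine monotoneOn_Ici_of_hasDerivAt_nonneg (v' := fun ξ => 2 * (z ξ - ζ ((w ξ).1)⁻¹) *
        ((S.rate * (z ξ - ζ ((w ξ).1)⁻¹) +
          (S.rem ((w ξ).1, z ξ) - S.rem ((w ξ).1, ζ ((w ξ).1)⁻¹))) * -S.A ((w ξ).1, z ξ)))
        ?_ (fun ξ hξ => ?_) fun ξ hξ => ?_
      · exact ((hwc2.div hwc1 fun ξ hξ => (hwc ξ hξ).1.ne').sub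
          (hζc.comp_continuousOn (hwc1.inv₀ fun ξ hξ => (hwc ξ hξ).1.ne'))).pow 2
      · have h1 := (hζd ((w ξ).1)⁻¹).comp ξ (hsd ξ hξ)
        rw [hXw ξ hξ.le] at h1
        refine (((hzd ξ hξ).sub h1).fun_pow 2).congr_deriv ?_
        simp only [Pi.sub_apply, Function.comp]
        norm_num
        ring
      · have h1 := hlip _ _ _ (hwx₁ ξ hξ.le) (hzη ξ hξ.le) (hζη ((w ξ).1)⁻¹)
        have h2 := (hA _ _ (hwx₁ ξ hξ.le) (hzη ξ hξ.le)).2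
        set D := z ξ - ζ ((w ξ).1)⁻¹
        set E := S.rem ((w ξ).1, z ξ) - S.rem ((w ξ).1, ζ ((w ξ).1)⁻¹)
        have h3 : 0 ≤ D * (S.rate * D + E) := by
          have e1 : -(|D| * |E|) ≤ D * E := by rw [← abs_mul]; exact neg_abs_le _
          have e2 := mul_le_mul_of_nonneg_left h1 (abs_nonneg D)
          have e3 : |D| * |D| = D * D := abs_mul_abs_self D
          nlinarith [mul_nonneg hrate.le (mul_self_nonneg D)]
        have h4 := mul_nonneg h3 (show 0 ≤ -S.A ((w ξ).1, z ξ) by linarith)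
        calc (0 : ℝ) ≤ 2 * (D * (S.rate * D + E) * -S.A ((w ξ).1, z ξ)) := by linarith
          _ = _ := by ring
    have hlim : Tendsto (fun ξ => (z ξ - ζ ((w ξ).1)⁻¹) ^ 2) atTop (𝓝 0) := by
      have hx : Tendsto (fun ξ => 4 * C * (w ξ).1) atTop (𝓝 0) := by
        simpa using ((continuous_fst.tendsto (0 : ℝ × ℝ)).comp hw.lim).const_mul (4 * C)
      refine squeeze_zero' (.of_forall fun ξ => sq_nonneg _) ?_ hx
      filter_upwards [eventually_ge_atTop 0] with ξ hξ
      have h1 := hz2 ξ hξ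
      have h2 := hζcusp ((w ξ).1)⁻¹ (inv_anti₀ (hwc ξ hξ).1 ((hwx ξ hξ).le.trans hrx))
      rw [inv_inv] at h2
      nlinarith [sq_nonneg (z ξ + ζ ((w ξ).1)⁻¹)]
    have h0 := monotoneOn_le_of_tendsto hmono hlim le_rfl
    have h0' : z 0 = ζ ((w 0).1)⁻¹ :=
      sub_eq_zero.1 ((pow_eq_zero_iff two_ne_zero).1 (le_antisymm h0 (sq_nonneg _)))
    have hlt : x₀⁻¹ < ((w 0).1)⁻¹ :=
      (inv_lt_inv₀ hx₀0 (hwc 0 le_rfl).1).2 ((hwx 0 le_rfl).trans_le hrx)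
    obtain ⟨s, hs, e⟩ := hσsurj _ hlt.le
    refine ⟨s, hs.lt_of_ne fun h => ?_, ?_⟩
    · rw [← h, hσ0] at e
      exact hlt.ne e
    · rw [hzw 0 le_rfl, h0', hv]
      simp only [e, inv_inv]

end SaddleNodeForm

/-! ### Derivatives along the saddle-node orbit -/

lemma hasDerivAt_iteratedDeriv_of_contDiffOn {f : ℝ → ℝ} {s : Set ℝ} (hs : IsOpen s)
    (hf : ContDiffOn ℝ ∞ f s) (n : ℕ) {ξ : ℝ} (hξ : ξ ∈ s) :
    HasDerivAt (iteratedDeriv n f) (iteratedDeriv (n + 1) f ξ) ξ := by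
  have h1 : DifferentiableOn ℝ (iteratedDerivWithin n f s) s :=
    hf.differentiableOn_iteratedDerivWithin (by exact_mod_cast WithTop.coe_lt_top _)
      hs.uniqueDiffOn
  have h2 : DifferentiableOn ℝ (iteratedDeriv n f) s :=
    h1.congr fun x hx => (iteratedDerivWithin_of_isOpen hs hx).symm
  rw [iteratedDeriv_succ]
  exact (h2.differentiableAt (hs.mem_nhds hξ)).hasDerivAt

lemma contDiffOn_quadCubic {k₀ k₁ k₂ k₃ p q : ℝ} {u v : ℝ → ℝ} {s : Set ℝ}
    (hu : ContDiffOn ℝ ∞ u s) (hv : ContDiffOn ℝ ∞ v s) :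
    ContDiffOn ℝ ∞ (fun ξ => quadCubic k₀ k₁ k₂ k₃ p q (u ξ) (v ξ)) s := by
  have : ContDiff ℝ ∞ fun w : ℝ × ℝ => quadCubic k₀ k₁ k₂ k₃ p q w.1 w.2 := by
    unfold quadCubic
    fun_prop
  exact this.comp_contDiffOn (hu.prodMk hv)

/-- All monomials are at least quadratic, so one power of `x` is gained. This is the extra power
that each further derivative acquires. -/
lemma DerivBound.quadCubic {x y u v : ℝ → ℝ} {N : ℕ} (hx : ∀ ξ, 0 < ξ → 0 ≤ x ξ)
    (hx1 : ∀ ξ, 0 < ξ → x ξ ≤ 1) (hy : ∀ ξ, 0 < ξ → 0 ≤ y ξ)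
    (hu : DerivBound x y 1 N u) (hv : DerivBound x y 1 N v)
    (hus : ContDiffOn ℝ ∞ u (Ioi 0)) (hvs : ContDiffOn ℝ ∞ v (Ioi 0)) (k₀ k₁ k₂ k₃ p q : ℝ) :
    DerivBound x y 2 N (fun ξ => quadCubic k₀ k₁ k₂ k₃ p q (u ξ) (v ξ)) := by
  have hls : ContDiffOn ℝ ∞ (fun ξ => p * u ξ + q * v ξ) (Ioi 0) :=
    (contDiffOn_const.mul hus).add (contDiffOn_const.mul hvs)
  have hl : DerivBound x y 1 N (fun ξ => p * u ξ + q * v ξ) :=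
    (hu.const_mul hx hy p).add (hv.const_mul hx hy q) (contDiffOn_const.mul hus)
      (contDiffOn_const.mul hvs)
  have hlls := hls.mul hls
  have hlll := ((hl.mul hx hy hl hls hls).mul hx hy hl hlls hls).mono_exp hx hx1 hy
    (show 2 ≤ 1 + 1 + 1 by omega)
  have huus := hus.mul hus
  have huvs := hus.mul hvs
  have hvvs := hvs.mul hvs
  have c (k : ℝ) {f : ℝ → ℝ} (hf : ContDiffOn ℝ ∞ f (Ioi 0)) :
    ContDiffOn ℝ ∞ (fun ξ => k * f ξ) (Ioi 0) := contDiffOn_const.mul hf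
  have h := ((((hu.mul hx hy hu hus hus).const_mul hx hy k₀).add
    ((hu.mul hx hy hv hus hvs).const_mul hx hy k₁) (c k₀ huus) (c k₁ huvs)).add
    ((hv.mul hx hy hv hvs hvs).const_mul hx hy k₂) ((c k₀ huus).add (c k₁ huvs)) (c k₂ hvvs)).add
    (hlll.const_mul hx hy k₃) (((c k₀ huus).add (c k₁ huvs)).add (c k₂ hvvs))
    (c k₃ (hlls.mul hls))
  convert h using 2
  unfold _root_.quadCubic
  ring

/-- Along a saddle-node orbit that decays in its positive first coordinate `x`, the `n`-th
derivatives are `O(x ^ (n + 1))`. -/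
theorem SaddleNodeForm.derivBound (S : SaddleNodeForm) {x y : ℝ → ℝ} {C : ℝ} (hC : 0 < C)
    (hode : ∀ ξ, 0 < ξ → HasDerivAt (fun ξ => (x ξ, y ξ)) (S.field (x ξ, y ξ)) ξ)
    (hx : ∀ ξ, 0 < ξ → 0 ≤ x ξ) (hx1 : ∀ ξ, 0 < ξ → x ξ ≤ 1)
    (hanti : ∀ ξ t, 0 < ξ → ξ ≤ t → x t ≤ x ξ) (hy : ∀ ξ, 0 < ξ → |y ξ| ≤ C * x ξ) (N : ℕ) :
    DerivBound x x 1 N x ∧ DerivBound x x 1 N y := by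
  have hl := S.l_pos
  have hsm : ContDiffOn ℝ ∞ (fun ξ => (x ξ, y ξ)) (Ioi 0) := by
    refine contDiffOn_of_ode (f := S.field) ?_ isOpen_Ioi hode
    unfold field _root_.quadCubic
    fun_prop
  have hxs : ContDiffOn ℝ ∞ x (Ioi 0) := contDiff_fst.comp_contDiffOn hsm
  have hys : ContDiffOn ℝ ∞ y (Ioi 0) := contDiff_snd.comp_contDiffOn hsm
  have hxd : ∀ ξ, 0 < ξ → HasDerivAt x (S.field (x ξ, y ξ)).1 ξ := fun ξ hξ => (hode ξ hξ).fst
  have hyd : ∀ ξ, 0 < ξ → HasDerivAt y (S.field (x ξ, y ξ)).2 ξ := fun ξ hξ => (hode ξ hξ).snd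
  induction N with
  | zero =>
    refine ⟨⟨1, one_pos, fun j hj ξ hξ => ?_⟩, ⟨C, hC, fun j hj ξ hξ => ?_⟩⟩
    · rw [Nat.le_zero.1 hj]
      simpa using (abs_of_nonneg (hx ξ hξ)).le
    · rw [Nat.le_zero.1 hj]
      simpa using hy ξ hξ
  | succ N ih =>
    obtain ⟨i1, i2⟩ := ih
    obtain ⟨D₁, hD₁, hF⟩ := i1.quadCubic hx hx1 hx i2 hxs hys S.f₀ S.f₁ S.f₂ S.f₃ S.p S.q
    obtain ⟨D₂, hD₂, hG⟩ := i1.quadCubic hx hx1 hx i2 hxs hys S.g₀ S.g₁ S.g₂ S.g₃ S.p S.q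
    have hGs : ContDiffOn ℝ ∞
        (fun ξ => _root_.quadCubic S.g₀ S.g₁ S.g₂ S.g₃ S.p S.q (x ξ) (y ξ)) (Ioi 0) :=
      contDiffOn_quadCubic hxs hys
    set G : ℝ → ℝ := fun ξ => _root_.quadCubic S.g₀ S.g₁ S.g₂ S.g₃ S.p S.q (x ξ) (y ξ)
    constructor
    · exact DerivBound.succ hx hx i1 hxd
        ⟨D₁, hD₁, fun ξ hξ => (hF N le_rfl ξ hξ).trans (le_of_eq (by ring))⟩
    -- The term `l y` gains nothing directly. But the `N`-th derivative of `y` is a bounded solution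
    -- of the same unstable equation, forced by that of `G`; as `x` is nonincreasing, the later
    -- forcing is bounded by its order at `ξ`, which has one more power of `x`.
    · have hlin : ∀ ξ, 0 < ξ → iteratedDeriv N (fun ξ => S.l * y ξ + G ξ) ξ =
          S.l * iteratedDeriv N y ξ + iteratedDeriv N G ξ := by
        intro ξ hξ
        have h1 : ContDiffAt ℝ N y ξ :=
          (hys.contDiffAt (Ioi_mem_nhds hξ)).of_le (by exact_mod_cast le_top)
        have h2 : ContDiffAt ℝ N G ξ :=
          (hGs.contDiffAt (Ioi_mem_nhds hξ)).of_le (by exact_mod_cast le_top)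
        rw [iteratedDeriv_fun_add (contDiffAt_const.mul h1) h2, iteratedDeriv_const_mul_field]
      have hder : ∀ ξ, 0 < ξ → HasDerivAt (iteratedDeriv N y)
          (S.l * iteratedDeriv N y ξ + iteratedDeriv N G ξ) ξ := by
        intro ξ hξ
        refine (hasDerivAt_iteratedDeriv_of_contDiffOn isOpen_Ioi hys N hξ).congr_deriv ?_
        rw [iteratedDeriv_succ', ← hlin ξ hξ]
        exact EqOn.iteratedDeriv_of_isOpen (fun t ht => (hyd t ht).deriv) isOpen_Ioi N hξ
      obtain ⟨E, hE, hyE⟩ := i2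
      refine DerivBound.succ hx hx ⟨E, hE, hyE⟩ hyd ⟨2 * D₂, by positivity, fun ξ hξ => ?_⟩
      have hGt : ∀ t, ξ ≤ t → |iteratedDeriv N G t| ≤ D₂ * (x ξ ^ 2 * x ξ ^ N) := by
        intro t ht
        have ht0 := hξ.trans_le ht
        have h1 := hx t ht0
        have h2 := hanti ξ t hξ ht
        refine (hG N le_rfl t ht0).trans ?_
        gcongr
      have hbd := abs_le_of_bounded_unstable hl (a := ξ) (fun t ht => hder t (hξ.trans_le ht))
        (B := E) (fun t ht => by
          have ht0 := hξ.trans_le ht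
          refine (hyE N le_rfl t ht0).trans (mul_le_of_le_one_right hE.le ?_)
          rw [← pow_add]
          exact pow_le_one₀ (hx t ht0) (hx1 t ht0)) hGt
      have h1 := hlin ξ hξ
      have h2 : (fun ξ => (S.field (x ξ, y ξ)).2) = fun ξ => S.l * y ξ + G ξ := rfl
      rw [h2, h1]
      have h3 := (le_div_iff₀ hl).1 hbd
      calc |S.l * iteratedDeriv N y ξ + iteratedDeriv N G ξ|
          ≤ S.l * |iteratedDeriv N y ξ| + |iteratedDeriv N G ξ| := by
            refine (abs_add_le _ _).trans ?_
            rw [abs_mul, abs_of_pos hl]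
        _ ≤ D₂ * (x ξ ^ 2 * x ξ ^ N) + D₂ * (x ξ ^ 2 * x ξ ^ N) := by
            have := hGt ξ le_rfl
            linarith
        _ = 2 * D₂ * (x ξ ^ 1 * x ξ ^ (N + 1)) := by ring

lemma IsDecayingOrbit.map {f f' : ℝ × ℝ → ℝ × ℝ} (T : ℝ × ℝ →L[ℝ] ℝ × ℝ)
    (hT : ∀ q, T (f q) = f' (T q)) {w : ℝ → ℝ × ℝ} (hw : IsDecayingOrbit f w) :
    IsDecayingOrbit f' (fun ξ => T (w ξ)) where
  cont := T.continuous.comp_continuousOn hw.cont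
  ode ξ hξ := by
    rw [← hT]
    exact T.hasFDerivAt.comp_hasDerivAt ξ (hw.ode ξ hξ)
  lim := by simpa [Function.comp_def] using (T.continuous.tendsto 0).comp hw.lim

/-! ### The transonic state as a saddle-node -/

section Gas

variable {g : Gas} {up θp : ℝ}

lemma sq_eq_of_mach_eq_one (g : Gas) (hθp : 0 < θp) (h : mach g up θp = 1) :
    up ^ 2 = g.R * g.γ * θp := by
  have hR := g.R_pos
  have hγ : 0 < g.γ := one_pos.trans g.one_lt_γ
  have h1 := mach_sq (up := up) g hθp
  rw [h, one_pow, eq_div_iff (by positivity), one_mul] at h1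
  exact h1.symm

/-- On the sonic line the term from `R θp / (κ up)` cancels the one from the product `X Y` exactly;
what is left is a sum of negative terms. -/
lemma transonic_coeff_neg (g : Gas) (hup : 0 < up) (hθp : 0 < θp)
    (hM : up ^ 2 = g.R * g.γ * θp) :
    g.R / g.μ * ((up ^ 2 - g.R * θp) / (g.μ * up) * (g.R * θp / (g.κ * up) - up / (2 * g.κ))
        - g.R * θp / g.κ * (1 / g.μ))
      - ((up ^ 2 - g.R * θp) / (g.μ * up)) ^ 2 * (g.R / (g.κ * (g.γ - 1))) < 0 := by
  have hμ := g.μ_pos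
  have hκ := g.κ_pos
  have hR := g.R_pos
  have hγ : 0 < g.γ - 1 := sub_pos.2 g.one_lt_γ
  have ha : (up ^ 2 - g.R * θp) / (g.μ * up) = g.R * θp * (g.γ - 1) / (g.μ * up) := by
    rw [hM]; ring
  rw [ha]
  have e : g.R / g.μ * (g.R * θp * (g.γ - 1) / (g.μ * up) *
        (g.R * θp / (g.κ * up) - up / (2 * g.κ)) - g.R * θp / g.κ * (1 / g.μ))
      - (g.R * θp * (g.γ - 1) / (g.μ * up)) ^ 2 * (g.R / (g.κ * (g.γ - 1))) =
      -(g.R / g.μ * (g.R * θp * (g.γ - 1) / (2 * g.μ * g.κ) + g.R * θp / g.κ * (1 / g.μ))) := by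
    field_simp
    ring
  rw [e]
  exact neg_neg_of_pos (by positivity)

/-- At a transonic state the linear part is singular. -/
lemma transonic_det (g : Gas) (hup : 0 < up) (hM : up ^ 2 = g.R * g.γ * θp) :
    (up ^ 2 - g.R * θp) / (g.μ * up) * (g.R * up / (g.κ * (g.γ - 1))) =
      g.R / g.μ * (g.R * θp / g.κ) := by
  have hμ := g.μ_pos
  have hκ := g.κ_pos
  have hγ : 0 < g.γ - 1 := sub_pos.2 g.one_lt_γ
  rw [show up ^ 2 - g.R * θp = g.R * θp * (g.γ - 1) by rw [hM]; ring]
  field_simp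

/-- Linear coordinates that bring the perturbation field at a transonic state to saddle-node
form. -/
lemma exists_transonic_coord (g : Gas) (hup : 0 < up) (hθp : 0 < θp)
    (hM : up ^ 2 = g.R * g.γ * θp) :
    ∃ (S : SaddleNodeForm) (T T' : ℝ × ℝ →L[ℝ] ℝ × ℝ), (∀ q, T (T' q) = q) ∧
      (∀ q, T' (T q) = q) ∧ (∀ q, T (pertField g up θp q) = S.field (T q)) ∧
      ∃ k, 0 < k ∧ ∀ q : ℝ × ℝ, (g.γ - 1) * up * q.1 + g.R * g.γ * q.2 = k * (T q).2 := by
  have hμ := g.μ_pos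
  have hκ := g.κ_pos
  have hR := g.R_pos
  have hγ : 0 < g.γ - 1 := sub_pos.2 g.one_lt_γ
  have hγ' : 0 < g.γ := one_pos.trans g.one_lt_γ
  have hneg := transonic_coeff_neg g hup hθp hM
  have hdet := transonic_det g hup hM
  have ha0 : 0 < (up ^ 2 - g.R * θp) / (g.μ * up) := by
    rw [show up ^ 2 - g.R * θp = g.R * θp * (g.γ - 1) by rw [hM]; ring]
    positivity
  have hline : ∀ q : ℝ × ℝ, (g.γ - 1) * up * q.1 + g.R * g.γ * q.2 =
      g.μ * g.γ * ((up ^ 2 - g.R * θp) / (g.μ * up) * q.1 + g.R / g.μ * q.2) := by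
    intro q
    have : up * up = g.R * g.γ * θp := by rw [← hM]; ring
    field_simp
    linear_combination (-q.1) * hM
  have hfst := fun q => pertField_fst (g := g) (up := up) (θp := θp) q
  have hsnd := fun q => pertField_snd (g := g) (up := up) (θp := θp) q
  have hb0 : 0 < g.R / g.μ := by positivity
  have hc0 : 0 < g.R * θp / g.κ := by positivity
  have hd0 : 0 < g.R * up / (g.κ * (g.γ - 1)) := by positivity
  generalize (up ^ 2 - g.R * θp) / (g.μ * up) = a at *
  generalize g.R / g.μ = b at *
  generalize g.R * θp / g.κ = c at *
  generalize g.R * up / (g.κ * (g.γ - 1)) = d at *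
  generalize g.R * θp / (g.κ * up) - up / (2 * g.κ) = α at *
  generalize g.R / (g.κ * (g.γ - 1)) = β at *
  generalize 1 / g.μ = n at *
  generalize 1 / (2 * g.κ) = η at *
  have hΔ : 0 < a ^ 2 + b * c := by positivity
  set x₁ := -b / (a ^ 2 + b * c) with hx₁
  set x₂ := a / (a ^ 2 + b * c) with hx₂
  set y₂ := c / (a ^ 2 + b * c) with hy₂
  have i1 : x₁ * -c + x₂ * a = 1 := by rw [hx₁, hx₂]; field_simp; ring
  have i2 : x₁ * a + x₂ * b = 0 := by rw [hx₁, hx₂]; field_simp; ring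
  have i3 : x₂ * -c + y₂ * a = 0 := by rw [hx₂, hy₂]; field_simp; ring
  have i4 : x₂ * a + y₂ * b = 1 := by rw [hx₂, hy₂]; field_simp
  let S : SaddleNodeForm :=
    { l := a + d
      f₀ := a * (α * x₁ ^ 2 + β * (x₁ * x₂)) - c * (n * x₁ ^ 2)
      f₁ := a * (α * (2 * x₁ * x₂) + β * (x₁ * y₂ + x₂ * x₂)) - c * (n * (2 * x₁ * x₂))
      f₂ := a * (α * x₂ ^ 2 + β * (x₂ * y₂)) - c * (n * x₂ ^ 2)
      f₃ := -(a * η)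
      g₀ := b * (α * x₁ ^ 2 + β * (x₁ * x₂)) + a * (n * x₁ ^ 2)
      g₁ := b * (α * (2 * x₁ * x₂) + β * (x₁ * y₂ + x₂ * x₂)) + a * (n * (2 * x₁ * x₂))
      g₂ := b * (α * x₂ ^ 2 + β * (x₂ * y₂)) + a * (n * x₂ ^ 2)
      g₃ := -(b * η)
      p := x₁
      q := x₂
      l_pos := by positivity
      f₀_neg := by
        have e : a * (α * x₁ ^ 2 + β * (x₁ * x₂)) - c * (n * x₁ ^ 2) =
            b / (a ^ 2 + b * c) ^ 2 * (b * (a * α - c * n) - a ^ 2 * β) := by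
          rw [hx₁, hx₂]; field_simp; ring
        rw [e]
        exact mul_neg_of_pos_of_neg (by positivity) hneg }
  let F : ℝ × ℝ →L[ℝ] ℝ := ContinuousLinearMap.fst ℝ ℝ ℝ
  let G : ℝ × ℝ →L[ℝ] ℝ := ContinuousLinearMap.snd ℝ ℝ ℝ
  -- The components of `T` are left eigenvectors of the linear part: the first for 0, the second for
  -- the trace `a + d`. The matrix of `T` is symmetric, with inverse entries `x₁, x₂, y₂`. The
  -- second component is proportional to the equation of the tangent line.
  let T : ℝ × ℝ →L[ℝ] ℝ × ℝ := (a • G - c • F).prod (a • F + b • G)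
  let T' : ℝ × ℝ →L[ℝ] ℝ × ℝ := (x₁ • F + x₂ • G).prod (x₂ • F + y₂ • G)
  have hT : ∀ q : ℝ × ℝ, T q = (a * q.2 - c * q.1, a * q.1 + b * q.2) := fun q => rfl
  have hT' : ∀ q : ℝ × ℝ, T' q = (x₁ * q.1 + x₂ * q.2, x₂ * q.1 + y₂ * q.2) := fun q => rfl
  have hT'T : ∀ q, T' (T q) = q := by
    intro q
    rw [hT', hT]
    refine Prod.ext ?_ ?_
    · simp only; linear_combination q.1 * i1 + q.2 * i2
    · simp only; linear_combination q.1 * i3 + q.2 * i4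
  have hTT' : ∀ q, T (T' q) = q := by
    intro q
    rw [hT, hT']
    refine Prod.ext ?_ ?_
    · simp only; linear_combination q.1 * i1 + q.2 * i3
    · simp only; linear_combination q.1 * i2 + q.2 * i4
  refine ⟨S, T, T', hTT', hT'T, fun q => ?_, g.μ * g.γ, by positivity, hline⟩
  obtain ⟨w, rfl⟩ : ∃ w, q = T' w := ⟨T q, (hT'T q).symm⟩
  rw [hTT', hT, hfst, hsnd, hT']
  refine Prod.ext ?_ ?_
  · simp only [SaddleNodeForm.field, quadCubic, S]
    linear_combination (x₂ * w.1 + y₂ * w.2) * hdet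
  · simp only [SaddleNodeForm.field, quadCubic, S]
    linear_combination (-(x₁ * w.1 + x₂ * w.2)) * hdet + (a + d) * (w.1 * i2 + w.2 * i4)

lemma isSaddleNode_transonic (g : Gas) (hup : 0 < up) (hθp : 0 < θp)
    (hM : up ^ 2 = g.R * g.γ * θp) : IsSaddleNode (blField g up θp) (up, θp) := by
  have hμ := g.μ_pos
  have hκ := g.κ_pos
  have hR := g.R_pos
  have hγ : 0 < g.γ - 1 := sub_pos.2 g.one_lt_γ
  have hneg := transonic_coeff_neg g hup hθp hM
  have hdet := transonic_det g hup hM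
  have hsm : ContDiff ℝ ∞ (blField g up θp) :=
    (contDiff_pertField g up θp).comp (contDiff_id.sub contDiff_const)
  have ha0 : 0 < (up ^ 2 - g.R * θp) / (g.μ * up) := by
    rw [show up ^ 2 - g.R * θp = g.R * θp * (g.γ - 1) by rw [hM]; ring]
    positivity
  have hfst := fun q => pertField_fst (g := g) (up := up) (θp := θp) q
  have hsnd := fun q => pertField_snd (g := g) (up := up) (θp := θp) q
  have hLf := fun q => pertLin_fst (g := g) (up := up) (θp := θp) q
  have hLs := fun q => pertLin_snd (g := g) (up := up) (θp := θp) q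
  have hb0 : 0 < g.R / g.μ := by positivity
  have hd0 : 0 < g.R * up / (g.κ * (g.γ - 1)) := by positivity
  refine ⟨blField_equilibrium g up θp, hsm.contDiffAt, ?_⟩
  rw [(hasFDerivAt_blField g up θp).fderiv]
  generalize (up ^ 2 - g.R * θp) / (g.μ * up) = a at *
  generalize g.R / g.μ = b at *
  generalize g.R * θp / g.κ = c at *
  generalize g.R * up / (g.κ * (g.γ - 1)) = d at *
  generalize g.R * θp / (g.κ * up) - up / (2 * g.κ) = α at *
  generalize g.R / (g.κ * (g.γ - 1)) = β at *
  generalize 1 / g.μ = n at *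
  generalize 1 / (2 * g.κ) = η at *
  -- The left null vector; the right one is `(b, -a)`. On that line the field is purely nonlinear,
  -- and its `ℓ`-component starts with the coefficient of `transonic_coeff_neg`.
  let ℓ : ℝ × ℝ →L[ℝ] ℝ := a • ContinuousLinearMap.snd ℝ ℝ ℝ - c • ContinuousLinearMap.fst ℝ ℝ ℝ
  have hℓ : ∀ q : ℝ × ℝ, ℓ q = a * q.2 - c * q.1 := fun q => rfl
  refine ⟨⟨a + d, by positivity, hasEigenvalue_of_apply_eq (v := (b, d))
    (fun h => hb0.ne' (congrArg Prod.fst h)) ?_⟩, (b, -a), ℓ,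
    fun h => hb0.ne' (congrArg Prod.fst h), fun h => ?_, ?_, ?_, ?_⟩
  · refine Prod.ext ?_ ?_
    · rw [hLf]; simp; ring
    · rw [hLs]; simp; linear_combination -hdet
  · have := congrArg (fun L : ℝ × ℝ →L[ℝ] ℝ => L (0, 1)) h
    simp [hℓ] at this
    exact ha0.ne' this
  · refine Prod.ext ?_ ?_
    · rw [hLf]; simp; ring
    · rw [hLs]; simp; linear_combination -hdet
  · refine ContinuousLinearMap.ext fun q => ?_
    rw [ContinuousLinearMap.comp_apply, hℓ, hLf, hLs, zero_apply]
    linear_combination q.2 * hdet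
  · have e : (fun t : ℝ => ℓ (blField g up θp ((up, θp) + t • (b, -a)))) =
        fun t => b * (b * (a * α - c * n) - a ^ 2 * β) * t ^ 2 + -(a * η * b ^ 3) * t ^ 3 := by
      funext t
      rw [blField_add, hℓ, hfst, hsnd]
      simp only [Prod.smul_mk, smul_eq_mul]
      linear_combination (-(a * t)) * hdet
    rw [e]
    set k := b * (b * (a * α - c * n) - a ^ 2 * β) with hk
    have hk0 : k ≠ 0 := (mul_neg_of_pos_of_neg hb0 hneg).ne
    have h1 : deriv (fun t : ℝ => k * t ^ 2 + -(a * η * b ^ 3) * t ^ 3) =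
        fun t => k * (2 * t) + -(a * η * b ^ 3) * (3 * t ^ 2) := by
      funext t
      have h := (((hasDerivAt_id' t).fun_pow 2).const_mul k).fun_add
        (((hasDerivAt_id' t).fun_pow 3).const_mul (-(a * η * b ^ 3)))
      rw [h.deriv]
      norm_num
    have h2 : HasDerivAt (fun t : ℝ => k * (2 * t) + -(a * η * b ^ 3) * (3 * t ^ 2)) (2 * k) 0 := by
      have h := (((hasDerivAt_id' (0 : ℝ)).const_mul 2).const_mul k).fun_add
        ((((hasDerivAt_id' (0 : ℝ)).fun_pow 2).const_mul 3).const_mul (-(a * η * b ^ 3)))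
      refine h.congr_deriv ?_
      norm_num
      ring
    rw [iteratedDeriv_succ, iteratedDeriv_one, h1, h2.deriv]
    exact mul_ne_zero two_ne_zero hk0

end Gas

/-! ### The transonic case -/

section Gas

variable {g : Gas} {up θp : ℝ}

/-- A half-trajectory that meets a given decaying orbit contains it or is contained in it. -/
lemma subset_or_subset_of_orbit {V : ℝ → ℝ × ℝ} (hV : IsDecayingOrbit (pertField g up θp) V)
    (hgraph : ∀ w, IsDecayingOrbit (pertField g up θp) w → w 0 ≠ 0 →
      ∃ t, 0 ≤ t ∧ ∃ s, 0 < s ∧ w t = V s)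
    {Γ' : Set (ℝ × ℝ)} (hΓ' : IsTrajectoryInto (blField g up θp) (up, θp) Γ') :
    (fun ξ => (up, θp) + V ξ) '' Ioi 0 ⊆ Γ' ∨ Γ' ⊆ (fun ξ => (up, θp) + V ξ) '' Ioi 0 := by
  obtain ⟨w, hw, hne, hlim, rfl⟩ := hΓ'
  set u : ℝ → ℝ × ℝ := fun ξ => w ξ - (up, θp) with hu
  have hwu : ∀ ξ, w ξ = (up, θp) + u ξ := fun ξ => by simp [hu]
  have hud : ∀ ξ, 0 < ξ → HasDerivAt u (pertField g up θp (u ξ)) ξ := fun ξ hξ =>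
    (hw ξ hξ).sub_const _
  have hulim : Tendsto u atTop (𝓝 0) := by simpa [hu] using hlim.sub_const (up, θp)
  -- A half-trajectory carries no condition at time 0, so it is restarted at time 1.
  have hu1 : IsDecayingOrbit (pertField g up θp) (fun ξ => u (ξ + 1)) := by
    refine ⟨fun ξ hξ => ?_, fun ξ hξ => (hud (ξ + 1) (by linarith)).comp_add_const ξ 1,
      hulim.comp (tendsto_atTop_add_const_right _ _ tendsto_id)⟩
    have h : (0 : ℝ) < ξ + 1 := by have : (0 : ℝ) ≤ ξ := hξ; linarith
    exact ((hud _ h).comp_add_const ξ 1).continuousAt.continuousWithinAt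
  obtain ⟨t, ht, s, hs, e⟩ := hgraph _ hu1 (by
    rw [zero_add]
    exact sub_ne_zero.2 (hne 1 one_pos))
  have ht1 : 0 < t + 1 := by linarith
  have hf := locallyLipschitz_pertField g up θp
  -- The two orbits pass through a common point, at times `s` and `t + 1`. They agree up to a time
  -- shift, and the one that reached it sooner is contained in the other.
  rcases le_total s (t + 1) with h | h
  · left
    rintro _ ⟨ξ, hξ, rfl⟩
    have hξ' : (0 : ℝ) < ξ := hξ
    have h1 : EqOn V (fun ξ => u (ξ + (t + 1 - s))) (Ioi 0) := by
      refine eqOn_Ioi_of_ode hf hs hV.ode (fun ξ hξ => ?_) ?_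
      · exact (hud _ (by linarith)).comp_add_const ξ _
      · rw [← e]
        congr 1
        ring
    refine ⟨ξ + (t + 1 - s), show (0 : ℝ) < _ by linarith, ?_⟩
    simp only
    rw [h1 hξ, hwu]
  · right
    rintro _ ⟨ξ, hξ, rfl⟩
    have hξ' : (0 : ℝ) < ξ := hξ
    have h1 : EqOn u (fun ξ => V (ξ + (s - (t + 1)))) (Ioi 0) := by
      refine eqOn_Ioi_of_ode hf ht1 hud (fun ξ hξ => ?_) ?_
      · exact (hV.ode _ (by linarith)).comp_add_const ξ _
      · rw [e]
        congr 1
        ring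
    refine ⟨ξ + (s - (t + 1)), show (0 : ℝ) < _ by linarith, ?_⟩
    simp only
    rw [hwu, h1 hξ]

/-- The transonic case. -/
theorem transonic_case (g : Gas) (hup : 0 < up) (hθp : 0 < θp) (hM : mach g up θp = 1) :
    ∃ δ : ℝ, 0 < δ ∧ IsSaddleNode (blField g up θp) (up, θp) ∧
        ∃ Γ : Set (ℝ × ℝ),
          IsTrajectoryInto (blField g up θp) (up, θp) Γ ∧
          (∀ Γ' : Set (ℝ × ℝ), IsTrajectoryInto (blField g up θp) (up, θp) Γ' →
            Γ ⊆ Γ' ∨ Γ' ⊆ Γ) ∧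
          TangentToLine Γ (up, θp) ((g.γ - 1) * up) (g.R * g.γ) ∧
          (∀ vm um θm vp : ℝ, 0 < vm → 0 < um → 0 < θm → 0 < vp →
            0 < len (up - um) (θp - θm) → len (up - um) (θp - θm) ≤ δ →
            SolvableIff g vm um θm vp up θp Γ ∧ AtMostOneSolution g vm um θm vp up θp) ∧
          ∀ n : ℕ, ∃ C : ℝ, 0 < C ∧
            ∀ vm um θm vp : ℝ, 0 < vm → 0 < um → 0 < θm → 0 < vp →
            0 < len (up - um) (θp - θm) → len (up - um) (θp - θm) ≤ δ →
            ∀ V U Θ : ℝ → ℝ, IsBLSolution g vm um θm vp up θp V U Θ →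
              ContDiffOn ℝ ∞ U (Ici 0) ∧ ContDiffOn ℝ ∞ Θ (Ici 0) ∧
              ∀ ξ : ℝ, 0 ≤ ξ → (U ξ, Θ ξ) ∈ Γ ∧
                derivLen n up θp U Θ ξ ≤
                  C * (len (up - um) (θp - θm) ^ (n + 1) /
                    (1 + len (up - um) (θp - θm) * ξ) ^ (n + 1)) := by
  have hsq := sq_eq_of_mach_eq_one g hθp hM
  obtain ⟨S, T, T', hTT', hT'T, hTf, k, hk, hline⟩ := exists_transonic_coord g hup hθp hsq
  have hT'f : ∀ q, T' (S.field q) = pertField g up θp (T' q) := fun q => by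
    rw [← hT'T (pertField g up θp (T' q)), hTf, hTT']
  set L := ‖T‖ + ‖T'‖ + 1 with hL
  have hL0 : 0 < L := by positivity
  have hTL : ∀ q, ‖T q‖ ≤ L * ‖q‖ := fun q => (T.le_opNorm q).trans (by
    gcongr; rw [hL]; linarith [norm_nonneg T'])
  have hT'L : ∀ q, ‖T' q‖ ≤ L * ‖q‖ := fun q => (T'.le_opNorm q).trans (by
    gcongr; rw [hL]; linarith [norm_nonneg T])
  -- Orbits within `r₀` of the equilibrium keep velocity and temperature positive; the stable orbit
  -- is started this close.
  set r₀ := min up θp with hr₀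
  have hr₀0 : 0 < r₀ := lt_min hup hθp
  obtain ⟨r, m, K, hr, hm, hK, v, hv, hvε, hvx, hvm, hvu⟩ :=
    S.exists_stable_orbit (show 0 < r₀ / L by positivity)
  set V : ℝ → ℝ × ℝ := fun ξ => T' (v ξ) with hVdef
  have hV : IsDecayingOrbit (pertField g up θp) V := hv.map T' hT'f
  have hVr₀ : ∀ ξ, 0 ≤ ξ → ‖V ξ‖ < r₀ := by
    intro ξ hξ
    have h1 : ‖v ξ‖ < r₀ / L := lt_of_pow_lt_pow_left₀ 2 (by positivity)
      ((norm_sq_le_sqLen _).trans_lt (hvε ξ hξ))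
    calc ‖V ξ‖ ≤ L * ‖v ξ‖ := hT'L _
      _ < L * (r₀ / L) := by gcongr
      _ = r₀ := by field_simp
  have hVU : ∀ ξ, 0 ≤ ξ → 0 < up + (V ξ).1 ∧ 0 < θp + (V ξ).2 := by
    intro ξ hξ
    have h1 := (norm_fst_le _).trans_lt (hVr₀ ξ hξ)
    have h2 := (norm_snd_le _).trans_lt (hVr₀ ξ hξ)
    rw [Real.norm_eq_abs] at h1 h2
    have := (abs_lt.1 h1).1
    have := (abs_lt.1 h2).1
    have : r₀ ≤ up := min_le_left _ _
    have : r₀ ≤ θp := min_le_right _ _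
    exact ⟨by linarith, by linarith⟩
  have hxV : ∀ ξ, 0 ≤ ξ → (v ξ).1 ≤ L * ‖V ξ‖ := by
    intro ξ hξ
    have h1 : ‖v ξ‖ ≤ L * ‖V ξ‖ := by
      have := hTL (V ξ)
      rwa [hVdef, hTT'] at this
    exact (le_abs_self _).trans ((norm_fst_le (v ξ)).trans h1)
  have hVne : ∀ ξ, 0 ≤ ξ → V ξ ≠ 0 := by
    intro ξ hξ h
    have := hxV ξ hξ
    rw [h, norm_zero, mul_zero] at this
    linarith [(hvx ξ hξ).1]
  have hr' : 0 < r / (2 * L) := by positivity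
  have hgraph : ∀ w, IsDecayingOrbit (pertField g up θp) w →
      (∀ ξ, 0 ≤ ξ → sqLen (w ξ) < (r / (2 * L)) ^ 2) → w 0 ≠ 0 → ∃ s, 0 < s ∧ w 0 = V s := by
    intro w hw hwr hw0
    obtain ⟨s, hs, e⟩ := hvu _ (hw.map T hTf) (fun ξ hξ => by
      have h1 := hwr ξ hξ
      have h2 := hTL (w ξ)
      have h3 := norm_sq_le_sqLen (w ξ)
      calc sqLen (T (w ξ)) ≤ 2 * ‖T (w ξ)‖ ^ 2 := sqLen_le_norm_sq _
        _ ≤ 2 * (L * ‖w ξ‖) ^ 2 := by gcongr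
        _ ≤ 4 * L ^ 2 * sqLen (w ξ) := by
          have := mul_le_mul_of_nonneg_left h3 (sq_nonneg L)
          have := mul_nonneg (sq_nonneg L) (sqLen_nonneg (w ξ))
          nlinarith
        _ < 4 * L ^ 2 * (r / (2 * L)) ^ 2 := by gcongr
        _ = r ^ 2 := by field_simp; norm_num)
      (fun h => hw0 (by rw [← hT'T (w 0), h, map_zero]))
    exact ⟨s, hs, by rw [hVdef]; simp only; rw [← e, hT'T]⟩
  obtain ⟨δ, hδ, hstay⟩ := exists_forall_stay g hup hθp hr'
  have hlen : ∀ um θm : ℝ, len (up - um) (θp - θm) ≤ δ → sqLen (um - up, θm - θp) ≤ δ ^ 2 := by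
    intro um θm h
    rw [len_sub_eq] at h
    exact (Real.sqrt_le_left hδ.le).1 h
  have hne0 : ∀ um θm : ℝ, 0 < len (up - um) (θp - θm) → ((um - up, θm - θp) : ℝ × ℝ) ≠ 0 := by
    intro um θm h h0
    rw [len_sub_eq, h0] at h
    simp [sqLen] at h
  have hf := locallyLipschitz_pertField g up θp
  refine ⟨δ, hδ, isSaddleNode_transonic g hup hθp hsq, (fun ξ => (up, θp) + V ξ) '' Ioi 0,
    isTrajectoryInto_of_orbit hV fun ξ hξ => hVne ξ hξ.le, fun Γ' hΓ' => ?_, ?_, ?_, ?_⟩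
  · refine subset_or_subset_of_orbit hV (fun w hw hw0 => ?_) hΓ'
    obtain ⟨t, ht, hwt⟩ := hw.eventually_sqLen_lt hr'
    obtain ⟨s, hs, e⟩ := hgraph _ (hw.shift ht) hwt
      (fun h => hw0 (hw.zero_of_eq_zero hf (pertField_zero g up θp) ht (by simpa using h)))
    exact ⟨t, ht, s, hs, by simpa using e⟩
  · unfold TangentToLine
    rw [isLittleO_iff]
    intro ε hε
    rw [eventually_nhdsWithin_iff, Metric.eventually_nhds_iff]
    -- In the cusp `|y| ≤ √(K x) x`, and at this distance `√(K x)` is at most `ε / (k L)`.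
    refine ⟨(ε / (k * L)) ^ 2 / (K * L), by positivity, fun q hq hqG => ?_⟩
    obtain ⟨ξ, hξ, rfl⟩ := hqG
    have hξ' : (0 : ℝ) ≤ ξ := le_of_lt hξ
    simp only at hq ⊢
    rw [dist_eq_norm, add_sub_cancel_left] at hq
    rw [add_sub_cancel_left, Real.norm_eq_abs]
    obtain ⟨h1, h2, h3⟩ := hvx ξ hξ'
    have h4 := hxV ξ hξ'
    have e1 : (g.γ - 1) * up * (((up, θp) + V ξ).1 - up) +
        g.R * g.γ * (((up, θp) + V ξ).2 - θp) = k * (v ξ).2 := by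
      have := hline (V ξ)
      rw [hVdef] at this
      simp only [hTT'] at this
      simp only [Prod.fst_add, Prod.snd_add, add_sub_cancel_left]
      exact this
    rw [e1, abs_mul, abs_of_pos hk]
    have h5 : K * (v ξ).1 ≤ (ε / (k * L)) ^ 2 := by
      rw [lt_div_iff₀ (by positivity)] at hq
      nlinarith
    have h6 : |(v ξ).2| ≤ ε / (k * L) * (v ξ).1 := by
      refine abs_le_of_sq_le_sq (h3.trans ?_) (by positivity)
      have := mul_le_mul_of_nonneg_right h5 (sq_nonneg (v ξ).1)
      linarith
    calc k * |(v ξ).2| ≤ k * (ε / (k * L) * (L * ‖V ξ‖)) := by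
          gcongr
          exact h6.trans (by gcongr)
      _ = ε * ‖V ξ‖ := by field_simp
  · intro vm um θm vp hvm' hum hθm hvp hpos hle
    refine ⟨solvableIff_of_orbit hvm' hum hvp ?_ ?_, atMostOneSolution hvm' hum hvp⟩
    · intro w hw hU hΘ hw0
      obtain ⟨s, hs, e⟩ := hgraph w hw (hstay w hw hU hΘ (by rw [hw0]; exact hlen um θm hle))
        (by rw [hw0]; exact hne0 um θm hpos)
      refine ⟨s, hs, ?_⟩
      simp only [← e, hw0]
      simp
    · rintro ⟨s, hs, e⟩
      have hs' : (0 : ℝ) < s := hs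
      refine ⟨_, hV.shift hs'.le, fun ξ hξ => (hVU _ (by linarith)).1,
        fun ξ hξ => (hVU _ (by linarith)).2, ?_⟩
      have e' : V s = (um, θm) - (up, θp) := by rw [← e]; simp
      simpa using e'
  · intro n
    have hanti : ∀ ξ t, 0 < ξ → ξ ≤ t → (v t).1 ≤ (v ξ).1 := by
      intro ξ t hξ ht
      have h := hvm ξ (t - ξ) hξ.le (by linarith)
      rw [sub_add_cancel] at h
      refine h.trans (div_le_self (hvx ξ hξ.le).1.le ?_)
      have := mul_nonneg (mul_pos hm (hvx ξ hξ.le).1).le (show 0 ≤ t - ξ by linarith)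
      linarith
    have hy : ∀ ξ, 0 < ξ → |(v ξ).2| ≤ (K + 1) * (v ξ).1 := by
      intro ξ hξ
      obtain ⟨h1, h2, h3⟩ := hvx ξ hξ.le
      refine abs_le_of_sq_le_sq (h3.trans ?_) (by positivity)
      calc K * (v ξ).1 ^ 3 = K * (v ξ).1 ^ 2 * (v ξ).1 := by ring
        _ ≤ K * (v ξ).1 ^ 2 * 1 := by gcongr
        _ ≤ ((K + 1) * (v ξ).1) ^ 2 := by nlinarith [sq_nonneg (v ξ).1, mul_nonneg hK.le (sq_nonneg (v ξ).1), sq_nonneg (K * (v ξ).1)]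
    have hx0 : ∀ ξ, 0 < ξ → 0 ≤ (v ξ).1 := fun ξ hξ => (hvx ξ hξ.le).1.le
    obtain ⟨i1, i2⟩ := S.derivBound (x := fun ξ => (v ξ).1) (y := fun ξ => (v ξ).2)
      (show 0 < K + 1 by positivity) hv.ode hx0 (fun ξ hξ => (hvx ξ hξ.le).2.1) hanti hy n
    have hvs : ContDiffOn ℝ ∞ v (Ioi 0) := by
      refine contDiffOn_of_ode (f := S.field) ?_ isOpen_Ioi hv.ode
      unfold SaddleNodeForm.field quadCubic
      fun_prop
    have hxs : ContDiffOn ℝ ∞ (fun ξ => (v ξ).1) (Ioi 0) := contDiff_fst.comp_contDiffOn hvs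
    have hys : ContDiffOn ℝ ∞ (fun ξ => (v ξ).2) (Ioi 0) := contDiff_snd.comp_contDiffOn hvs
    have hcomb : ∀ α β : ℝ, DerivBound (fun ξ => (v ξ).1) (fun ξ => (v ξ).1) 1 n
        (fun ξ => α * (v ξ).1 + β * (v ξ).2) := fun α β =>
      (i1.const_mul hx0 hx0 α).add (i2.const_mul hx0 hx0 β) (contDiffOn_const.mul hxs)
        (contDiffOn_const.mul hys)
    have hT'c : ∀ q : ℝ × ℝ, T' q = q.1 • T' (1, 0) + q.2 • T' (0, 1) := by
      intro q
      rw [← map_smul, ← map_smul, ← map_add]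
      simp
    obtain ⟨D₁, hD₁, hb₁⟩ := hcomb (T' (1, 0)).1 (T' (0, 1)).1
    obtain ⟨D₂, hD₂, hb₂⟩ := hcomb (T' (1, 0)).2 (T' (0, 1)).2
    have hV1 : (fun ξ => (V ξ).1) =
        fun ξ => (T' (1, 0)).1 * (v ξ).1 + (T' (0, 1)).1 * (v ξ).2 := by
      funext ξ
      rw [hVdef]
      simp only
      rw [hT'c (v ξ)]
      simp only [Prod.fst_add, Prod.smul_fst, smul_eq_mul]
      ring
    have hV2 : (fun ξ => (V ξ).2) =
        fun ξ => (T' (1, 0)).2 * (v ξ).1 + (T' (0, 1)).2 * (v ξ).2 := by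
      funext ξ
      rw [hVdef]
      simp only
      rw [hT'c (v ξ)]
      simp only [Prod.snd_add, Prod.smul_snd, smul_eq_mul]
      ring
    rw [← hV1] at hb₁
    rw [← hV2] at hb₂
    -- Two demands are met: `P ≥ L` bounds the starting value of `x` by `P ρ`, and `m P ≥ 1` turns
    -- `x / (1 + m x ξ)` into `P ρ / (1 + ρ ξ)`.
    set P := L + 1 / m with hP
    have hP0 : 0 < P := by positivity
    have hPm : 1 ≤ m * P := by
      rw [hP, mul_add, mul_one_div_cancel hm.ne']
      have := mul_pos hm hL0
      linarith
    refine ⟨(D₁ + D₂) * P ^ (n + 1), by positivity, ?_⟩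
    intro vm um θm vp hvm' hum hθm hvp hpos hle V₁ U Θ hsol
    have hpert := hsol.isPertSolution hvm' hum hvp
    have horb := hpert.orbit
    have hw0 : (U 0 - up, Θ 0 - θp) = (um - up, θm - θp) := by rw [hsol.U_zero, hsol.Θ_zero]
    obtain ⟨s, hs, e⟩ := hgraph _ horb (hstay _ horb hpert.U_pos hpert.Θ_pos (by
      simp only [hw0]; exact hlen um θm hle)) (by simp only [hw0]; exact hne0 um θm hpos)
    have heq := horb.eqOn hf (hV.shift hs.le) (by simpa using e)
    simp only [hw0] at e
    obtain ⟨hUs, hΘs, hder⟩ := regularity_of_shift (v := V) hs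
      (contDiffOn_of_ode (contDiff_pertField g up θp) isOpen_Ioi hV.ode) (fun ξ hξ => heq hξ)
    refine ⟨hUs, hΘs, fun ξ hξ => ⟨⟨ξ + s, show (0 : ℝ) < _ by linarith, ?_⟩, ?_⟩⟩
    · have : (U ξ - up, Θ ξ - θp) = V (ξ + s) := heq hξ
      simp only
      rw [← this]
      simp
    · have hξs : 0 < ξ + s := by linarith
      set ρ := len (up - um) (θp - θm) with hρ
      have hxρ : (v s).1 ≤ P * ρ := by
        have h1 := hxV s hs.le
        rw [← e] at h1
        have h2 := norm_le_sqrt_sqLen (um - up, θm - θp)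
        rw [← len_sub_eq, ← hρ] at h2
        calc (v s).1 ≤ L * ρ := h1.trans (by gcongr)
          _ ≤ P * ρ := by
            gcongr
            rw [hP]
            have : 0 < 1 / m := by positivity
            linarith
      have hxs0 := (hvx s hs.le).1
      have hdec : (v (ξ + s)).1 ≤ P * (ρ / (1 + ρ * ξ)) := by
        refine (hvm s ξ hs.le hξ).trans ?_
        have h1 : 0 ≤ m * (v s).1 * ξ := by positivity
        have h2 : 0 ≤ ρ * ξ := by positivity
        rw [← mul_div_assoc, div_le_div_iff₀ (by positivity) (by positivity)]
        have h3 : (v s).1 * (ρ * ξ) ≤ m * P * ((v s).1 * (ρ * ξ)) :=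
          le_mul_of_one_le_left (by positivity) hPm
        nlinarith
      have h1 := hb₁ n le_rfl (ξ + s) hξs
      have h2 := hb₂ n le_rfl (ξ + s) hξs
      have h3 := hder n ξ hξ
      have h4 : (v (ξ + s)).1 ^ (n + 1) ≤ (P * (ρ / (1 + ρ * ξ))) ^ (n + 1) :=
        pow_le_pow_left₀ (hx0 _ hξs) hdec _
      calc derivLen n up θp U Θ ξ ≤ (D₁ + D₂) * (v (ξ + s)).1 ^ (n + 1) := by
            rw [← pow_add, add_comm 1 n] at h1 h2
            linarith
        _ ≤ (D₁ + D₂) * (P * (ρ / (1 + ρ * ξ))) ^ (n + 1) := by gcongr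
        _ = _ := by rw [mul_pow, div_pow]; ring

end Gas

/-! ### Assembly of the cases -/

theorem lemma2p1 (g : Gas) (up θp : ℝ) (hθp : 0 < θp) :
    -- no solution when `up ≤ 0`
    (up ≤ 0 → ∀ vm um θm vp : ℝ, 0 < vm → 0 < um → 0 < θm → 0 < vp →
      NoSolution g vm um θm vp up θp) ∧
    (0 < up → ∃ δ : ℝ, 0 < δ ∧
      -- supersonic case
      (1 < mach g up θp → ∀ vm um θm vp : ℝ, 0 < vm → 0 < um → 0 < θm → 0 < vp →
        0 < len (up - um) (θp - θm) → len (up - um) (θp - θm) ≤ δ →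
        NoSolution g vm um θm vp up θp) ∧
      -- transonic case
      (mach g up θp = 1 →
        IsSaddleNode (blField g up θp) (up, θp) ∧
        ∃ Γ : Set (ℝ × ℝ),
          IsTrajectoryInto (blField g up θp) (up, θp) Γ ∧
          (∀ Γ' : Set (ℝ × ℝ), IsTrajectoryInto (blField g up θp) (up, θp) Γ' →
            Γ ⊆ Γ' ∨ Γ' ⊆ Γ) ∧
          TangentToLine Γ (up, θp) ((g.γ - 1) * up) (g.R * g.γ) ∧
          (∀ vm um θm vp : ℝ, 0 < vm → 0 < um → 0 < θm → 0 < vp →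
            0 < len (up - um) (θp - θm) → len (up - um) (θp - θm) ≤ δ →
            SolvableIff g vm um θm vp up θp Γ ∧ AtMostOneSolution g vm um θm vp up θp) ∧
          ∀ n : ℕ, ∃ C : ℝ, 0 < C ∧
            ∀ vm um θm vp : ℝ, 0 < vm → 0 < um → 0 < θm → 0 < vp →
            0 < len (up - um) (θp - θm) → len (up - um) (θp - θm) ≤ δ →
            ∀ V U Θ : ℝ → ℝ, IsBLSolution g vm um θm vp up θp V U Θ →
              ContDiffOn ℝ ∞ U (Ici 0) ∧ ContDiffOn ℝ ∞ Θ (Ici 0) ∧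
              ∀ ξ : ℝ, 0 ≤ ξ → (U ξ, Θ ξ) ∈ Γ ∧
                derivLen n up θp U Θ ξ ≤
                  C * (len (up - um) (θp - θm) ^ (n + 1) /
                    (1 + len (up - um) (θp - θm) * ξ) ^ (n + 1))) ∧
      -- subsonic case
      (mach g up θp < 1 →
        IsSaddle (blField g up θp) (up, θp) ∧
        ∃ (c₂ l₁ l₂ a₂ : ℝ) (Γ₁ Γ₂ M : Set (ℝ × ℝ)),
          0 < c₂ ∧
          c₂ ^ 2 + ((mach g up θp ^ 2 * g.γ - 1) / (mach g up θp ^ 2 * g.R * g.γ)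
              - g.μ / (g.κ * (g.γ - 1))) * c₂
            - g.μ / (mach g up θp ^ 2 * g.R * g.γ * g.κ) = 0 ∧
          0 < l₁ ∧ l₂ < 0 ∧
          Module.End.HasEigenvalue (Matrix.toLin' (linPart g up θp)) l₁ ∧
          Module.End.HasEigenvalue (Matrix.toLin' (linPart g up θp)) l₂ ∧
          a₂ = -(g.R / (g.μ * (l₁ - l₂))) ∧
          IsTrajectoryInto (blField g up θp) (up, θp) Γ₁ ∧
          IsTrajectoryInto (blField g up θp) (up, θp) Γ₂ ∧
          M = Γ₁ ∪ {(up, θp)} ∪ Γ₂ ∧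
          IsSmoothGraphOver M (up, θp) (a₂, 1 + a₂ * c₂ * up) (1, c₂ * up) ∧
          TangentToLine M (up, θp) (1 + a₂ * c₂ * up) (-a₂) ∧
          TangentToRay Γ₁ (up, θp) (a₂, 1 + a₂ * c₂ * up) ∧
          TangentToRay Γ₂ (up, θp) (-(a₂, 1 + a₂ * c₂ * up)) ∧
          (∀ vm um θm vp : ℝ, 0 < vm → 0 < um → 0 < θm → 0 < vp →
            0 < len (up - um) (θp - θm) → len (up - um) (θp - θm) ≤ δ →
            SolvableIff g vm um θm vp up θp M ∧ AtMostOneSolution g vm um θm vp up θp) ∧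
          ∃ c : ℝ, 0 < c ∧ ∀ n : ℕ, ∃ C : ℝ, 0 < C ∧
            ∀ vm um θm vp : ℝ, 0 < vm → 0 < um → 0 < θm → 0 < vp →
            0 < len (up - um) (θp - θm) → len (up - um) (θp - θm) ≤ δ →
            ∀ V U Θ : ℝ → ℝ, IsBLSolution g vm um θm vp up θp V U Θ →
              ContDiffOn ℝ ∞ U (Ici 0) ∧ ContDiffOn ℝ ∞ Θ (Ici 0) ∧
              ∀ ξ : ℝ, 0 ≤ ξ → (U ξ, Θ ξ) ∈ M ∧
                derivLen n up θp U Θ ξ ≤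
                  C * len (up - um) (θp - θm) * Real.exp (-(c * ξ)))) := by
  have hlen0 : ∀ um θm : ℝ, 0 < len (up - um) (θp - θm) →
      ((um - up, θm - θp) : ℝ × ℝ) ≠ 0 := by
    intro um θm h h0
    rw [len_sub_eq, h0] at h
    simp [sqLen] at h
  refine ⟨fun hup vm um θm vp hvm hum hθm hvp => ?_, fun hup => ?_⟩
  · exact noSolution_of_orbit hvm hum hvp fun hfl =>
      absurd (up_pos_of_flux hvm hum hvp hfl) hup.not_gt
  -- The Mach number is fixed by the right end state, so for given `up`, `θp` only one case is not
  -- vacuous, and `δ` is the one of that case.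
  · rcases lt_trichotomy (mach g up θp) 1 with hM | hM | hM
    · obtain ⟨δ, hδ, h⟩ := subsonic_case g hup hθp hM
      exact ⟨δ, hδ, fun h' => absurd hM h'.not_gt, fun h' => absurd h' hM.ne, fun _ => h⟩
    · obtain ⟨δ, hδ, h⟩ := transonic_case g hup hθp hM
      exact ⟨δ, hδ, fun h' => absurd hM h'.ne', fun _ => h, fun h' => absurd hM h'.ne⟩
    -- Any `δ` serves here, since supersonic nonexistence needs only that the two states differ.
    · refine ⟨1, one_pos, fun _ vm um θm vp hvm hum hθm hvp hpos _ => ?_,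
        fun h' => absurd h' hM.ne', fun h' => absurd hM h'.not_gt⟩
      refine noSolution_of_orbit hvm hum hvp fun _ => ?_
      rintro ⟨w, hw, hw0⟩
      exact hlen0 um θm hpos (hw0 ▸ hw.eq_zero_of_supersonic hup hθp hM)
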